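/- **Setting.** Let $\mathcal X\subset\mathbb R^d$ be compact and non-empty, let $\Theta\subset(0,\infty)^m$ be a compact non-empty set of lengthscale vectors, and let $(k_\theta)_{\theta\in\Theta}$ be the Matérn kernels of a fixed smoothness $\nu>0$ and a fixed output variance $\sigma_f^2\in(0,1]$ on $\mathcal X$, where each coordinate of $\mathbb R^d$ is divided by one of the $m$ lengthscales (isotropic: $m=1$; ARD: $m=d$). Assume $f\in\mathcal H_{k_\theta}$ with $\|f\|_{k_\theta}\le B$ for the true $\theta\in\Theta$ and, more precisely, $\sup_{\hat\theta\in\Theta}\|f\|_{k_{\hat\theta}}\le B$, $B>0$; let $x^\ast\in\arg\max_{\mathcal X}f$. Observations are $y_t=f(x_t)+\epsilon_t$ with $\mathbb E[e^{s\epsilon_t}\mid\mathcal F_{t-1}]\le e^{s^2R^2/2}$ for all $s\in\mathbb R$, where $\mathcal F_{t-1}$ is the history up to and including the choice of $x_t$. The GP surrogate has zero mean and noise variance $\sigma^2$ with $1\le\sigma\le\sigma_{\max}$ (for instance $\sigma^2=1+2/T$), and $\mu_{t-1}(\cdot;\hat\theta)$, $\sigma_{t-1}^2(\cdot;\hat\theta)$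 are its posterior mean and variance given $(x_i,y_i)_{i<t}$ under $k_{\hat\theta}$. Let $\gamma_t(\hat\theta)=\max_{x_1,\dots,x_t\in\mathcal X}\frac12\log\det(I+\sigma^{-2}[k_{\hat\theta}(x_i,x_j)]_{i,j})$, $\Gamma_{t}=\max_{\hat\theta\in\Theta}\gamma_{t}(\hat\theta)$, let $N_\varepsilon(\Theta,d)$ be the $\varepsilon$-covering number of $\Theta$ for $d(\theta,\theta')=\sup_{x,x'\in\mathcal X}|k_\theta(x,x')-k_{\theta'}(x,x')|$, and put $\varepsilon_T=T^{-4}$, $$\beta_t^{1/2}(\delta)=B+R\sqrt{2\Bigl(\Gamma_{t-1}+1+\log\frac{6N_{\varepsilon_T}(\Theta,d)}{\delta}\Bigr)} .$$ **Algorithm (OSCBO with UCB, horizon $T$).** Let $p\in\{1,2\}$, $\hat\rho>0$, $\tilde\rho=\max\{\hat\rho/2,T^{-1/4}\}$, $\eta=\delta/3$, $L^s_t(\hat\theta)=\frac{\log(1+\sigma^{-2}\sigma^2_{t-1}(x_t;\hat\theta))}{\log(1+\sigma^{-2})}$, $L^c_t(\hat\theta)=\Bigl(\frac{|y_t-\mu_{t-1}(x_t;\hat\theta)|}{\beta_t^{1/2}(\delta)\sqrt{\sigma_{t-1}^2(x_t;\hat\theta)+\sigma^2}}\Bigr)^p-1$.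 In round $t=1,\dots,T$: if $\sum_{j<t}L^c_j(\hat\theta_{j-1})>(T-t)\tilde\rho+M_t-1$ with $M_t=\frac2{\tilde\rho}\sqrt T+(2+\frac3{\tilde\rho})\sqrt{8t\log(18t^2/\eta)}+(1+\frac2{\tilde\rho})R^P+\frac1{\tilde\rho}R^D$ ($R^P,R^D\ge0$ given), both learners are re-initialized and the recovery phase begins (re-initialization either at every such round or only at the first). The primal learner (follow the perturbed leader with fresh i.i.d. exponential perturbations $\xi_{t-1}$) outputs a minimizer $\hat\theta_{t-1}$, up to an error $g+h\|\xi_{t-1}\|_1$, of $\hat\theta\mapsto\sum_j\bigl(v_jL_j^s(\hat\theta)+\lambda_{j-1}L_j^c(\hat\theta)\bigr)-\langle\hat\theta,\xi_{t-1}\rangle$ over $\Theta$ or over an $\varepsilon_T$-cover of $\Theta$, the sum being over the rounds $j<t$ since the last initialization, with $v_j=1$ in the play phase and $v_j$ a fixed number in $[0,1]$ in recovery. The dual learner (online mirror descent with negative entropy, initialized at a positive value, positive step sizes, gradient $-L_t^c(\hat\theta_{t-1})$) updates $\lambda$ in $[0,1/\tilde\rho]$ in the play phase and in $[0,1]$ in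 recovery. Then $x_t\in\arg\max_{x\in\mathcal X}\mu_{t-1}(x;\hat\theta_{t-1})+\beta_t^{1/2}(\delta)\sigma_{t-1}(x;\hat\theta_{t-1})$ is queried. **Theorem.** There are a constant $C>0$ and an integer $q\ge0$, depending only on $\mathcal X$, $\Theta$, the kernel family, $R$ and $\sigma_{\max}$, such that for all $T\ge1$, $\delta\in(0,1)$, $B>0$, $f$, $\theta$ as above, every choice of the tuning parameters and every run of OSCBO, with probability at least $1-\delta$, $$R_T=\sum_{t=1}^T\bigl(f(x^\ast)-f(x_t)\bigr)\le C(1+\log T)^q\Bigl(B+\sqrt{\Gamma_{T-1}+\log\tfrac{6N_{\varepsilon_T}(\Theta,d)}{\delta}}\Bigr)\Bigl(T^{3/4}+\sqrt{T\gamma_T(\theta)}\Bigr).$$ Moreover, if $\nu>d/2$, this bound is sublinear: for fixed $B,\delta,\theta$ and any $\sigma=\sigma_T\in[1,\sigma_{\max}]$, its right-hand side divided by $T$ tends to $0$ as $T\to\infty$. -/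

import Mathlib

open MeasureTheory ProbabilityTheory Filter Topology

noncomputable section

namespace OSCBO

/-! ### The Matérn kernel family -/

/-- Modified Bessel function of the second kind, for real order `ν` and real argument `z > 0`,
through the integral `K_ν(z) = (1/2) (z/2)^(-ν) ∫_0^∞ exp(-u - z²/(4u)) u^(ν-1) du`. -/
def besselK (ν z : ℝ) : ℝ :=
  (1 / 2) * (z / 2) ^ (-ν) *
    ∫ u in Set.Ioi (0 : ℝ), Real.exp (-u - z ^ 2 / (4 * u)) * u ^ (ν - 1)

/-- Distance after dividing the coordinate `i` by its lengthscale `θ (grp i)`. -/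
def scaledDist {d m : ℕ} (grp : Fin d → Fin m) (θ : Fin m → ℝ)
    (x x' : EuclideanSpace ℝ (Fin d)) : ℝ :=
  √(∑ i, ((x i - x' i) / θ (grp i)) ^ 2)

open Classical in
/-- Matérn kernel of smoothness `ν` and output variance `var`, with its limit `var` at
distance zero. -/
def matern {d m : ℕ} (ν var : ℝ) (grp : Fin d → Fin m) (θ : Fin m → ℝ)
    (x x' : EuclideanSpace ℝ (Fin d)) : ℝ :=
  if scaledDist grp θ x x' = 0 then var
  else var * (2 ^ (1 - ν) / Real.Gamma ν * (√(2 * ν) * scaledDist grp θ x x') ^ ν *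
    besselK ν (√(2 * ν) * scaledDist grp θ x x'))

/-- The fixed data: a compact input space `X ⊆ ℝ^d`, a compact set `Θ ⊆ (0, ∞)^m` of
lengthscale vectors, and a Matérn family indexed by `Θ` with output variance at most one.
The coordinate `i` uses the lengthscale number `grp i`: `m = 1` is the isotropic case, and
`m = d`, `grp = id` is automatic relevance determination. -/
structure Problem (d m : ℕ) where
  ν : ℝ
  var : ℝ
  grp : Fin d → Fin m
  X : Set (EuclideanSpace ℝ (Fin d))
  Θ : Set (Fin m → ℝ)
  ν_pos : 0 < ν
  var_pos : 0 < var
  var_le_one : var ≤ 1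
  X_compact : IsCompact X
  X_nonempty : X.Nonempty
  Θ_compact : IsCompact Θ
  Θ_nonempty : Θ.Nonempty
  Θ_pos : ∀ θ ∈ Θ, ∀ i, 0 < θ i

/-- The kernel `k_θ` of the family. -/
def Problem.ker {d m : ℕ} (P : Problem d m) (θ : Fin m → ℝ) :
    EuclideanSpace ℝ (Fin d) → EuclideanSpace ℝ (Fin d) → ℝ :=
  matern P.ν P.var P.grp θ

/-- `f`, restricted to `X`, lies in the reproducing kernel Hilbert space of the kernel `k` on `X`
and has norm at most `B` there. -/
def InRKHSBall {E : Type} (X : Set E) (k : E → E → ℝ) (B : ℝ) (f : E → ℝ) : Prop :=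
  ∃ (H : Type) (_ : NormedAddCommGroup H) (_ : InnerProductSpace ℝ H) (_ : CompleteSpace H)
    (_ : RKHS ℝ H X ℝ),
    (∀ x x' : X, RKHS.kernel H x x' 1 = k x x') ∧
    ∃ h : H, (∀ x : X, h x = f x) ∧ ‖h‖ ≤ B

/-! ### Gaussian process posterior and information gain -/

section GP

variable {E : Type} {n : ℕ}

def gram (k : E → E → ℝ) (x : Fin n → E) : Matrix (Fin n) (Fin n) ℝ :=
  Matrix.of fun i j => k (x i) (x j)

def kvec (k : E → E → ℝ) (x : Fin n → E) (z : E) : Fin n → ℝ := fun i => k (x i) z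

/-- Posterior mean at `z` given the data `(x i, y i)`, with noise variance `σ ^ 2`. -/
def postMean (k : E → E → ℝ) (σ : ℝ) (x : Fin n → E) (y : Fin n → ℝ) (z : E) : ℝ :=
  kvec k x z ⬝ᵥ ((gram k x + σ ^ 2 • (1 : Matrix (Fin n) (Fin n) ℝ))⁻¹).mulVec y

/-- Posterior variance at `z`. -/
def postVar (k : E → E → ℝ) (σ : ℝ) (x : Fin n → E) (z : E) : ℝ :=
  k z z - kvec k x z ⬝ᵥ
    ((gram k x + σ ^ 2 • (1 : Matrix (Fin n) (Fin n) ℝ))⁻¹).mulVec (kvec k x z)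

/-- Posterior standard deviation at `z`. -/
def postStd (k : E → E → ℝ) (σ : ℝ) (x : Fin n → E) (z : E) : ℝ := √(postVar k σ x z)

def infoGain (k : E → E → ℝ) (σ : ℝ) (x : Fin n → E) : ℝ :=
  (1 / 2) * Real.log (1 + (σ ^ 2)⁻¹ • gram k x).det

/-- Maximum information gain of `n` evaluations in `X`. -/
def maxInfoGain (k : E → E → ℝ) (σ : ℝ) (X : Set E) (n : ℕ) : ℝ :=
  ⨆ x : Fin n → X, infoGain k σ (fun i => (x i : E))

end GP

variable {d m : ℕ}

/-- `γ_n(θ)`. -/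
def Problem.gain (P : Problem d m) (σ : ℝ) (n : ℕ) (θ : Fin m → ℝ) : ℝ :=
  maxInfoGain (P.ker θ) σ P.X n

/-- `Γ_n`, the maximum of `γ_n` over `Θ`. -/
def Problem.supGain (P : Problem d m) (σ : ℝ) (n : ℕ) : ℝ :=
  ⨆ θ : P.Θ, P.gain σ n θ

/-- The distance `d(θ, θ') = sup_{x, x' ∈ X} |k_θ(x, x') - k_θ'(x, x')|`. -/
def Problem.kdist (P : Problem d m) (θ θ' : Fin m → ℝ) : ℝ :=
  ⨆ q : P.X × P.X, |P.ker θ q.1 q.2 - P.ker θ' q.1 q.2|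

/-- `A` is an `ε`-cover of `Θ` for the distance `d`, with centres in `Θ`. -/
def Problem.IsNet (P : Problem d m) (ε : ℝ) (A : Set (Fin m → ℝ)) : Prop :=
  A ⊆ P.Θ ∧ ∀ θ ∈ P.Θ, ∃ θ' ∈ A, P.kdist θ θ' ≤ ε

/-- The `ε`-covering number of `Θ` for the distance `d`. -/
def Problem.covNum (P : Problem d m) (ε : ℝ) : ℕ :=
  sInf {n : ℕ | ∃ s : Finset (Fin m → ℝ), P.IsNet ε ↑s ∧ s.card = n}

/-- The covering radius `ε_T = T^(-4)`. -/
def epsT (T : ℕ) : ℝ := ((T : ℝ) ^ 4)⁻¹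

/-! ### The algorithm -/

/-- Surrogate noise level `σ`, norm bound `B`, sub-Gaussian constant `R`, failure probability `δ`
and horizon `T`. -/
structure Config where
  σ : ℝ
  B : ℝ
  R : ℝ
  δ : ℝ
  T : ℕ

/-- `β_t^(1/2)(δ)` for `t = n + 1`. -/
def betaSqrt (P : Problem d m) (c : Config) (n : ℕ) : ℝ :=
  c.B + c.R * √(2 * (P.supGain c.σ n + 1 + Real.log (6 * P.covNum (epsT c.T) / c.δ)))

/-- Tuning inputs of the algorithm: the exponent `p` of the calibration constraint, the supplied
margin `ρhat`, the regret bounds `RP`, `RD` of the two regret minimizers that enter the switching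
threshold, the rate `τ` of the exponential perturbations, the accuracy `(g, h)` of the optimization
oracle, the step sizes and starting points of mirror descent, the weight of the sharpness loss in
the primal utility after the switch to recovery, and whether the regret minimizers restart at every
round at which the threshold is exceeded or only at the first one. -/
structure Tuning where
  p : ℕ
  ρhat : ℝ
  RP : ℝ
  RD : ℝ
  τ : ℝ
  g : ℝ
  h : ℝ
  step : ℕ → ℝ
  lamPlay : ℝ
  lamRec : ℝ
  recWeight : ℝ
  restart : Prop
  p_mem : p = 1 ∨ p = 2
  ρhat_pos : 0 < ρhat
  RP_nonneg : 0 ≤ RP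
  RD_nonneg : 0 ≤ RD
  τ_pos : 0 < τ
  g_nonneg : 0 ≤ g
  h_nonneg : 0 ≤ h
  step_pos : ∀ n, 0 < step n
  lamPlay_pos : 0 < lamPlay
  lamRec_pos : 0 < lamRec
  lamRec_le : lamRec ≤ 1
  recWeight_nonneg : 0 ≤ recWeight
  recWeight_le : recWeight ≤ 1

/-- `ρ̃ = max (ρhat / 2) T^(-1/4)`. -/
def rhoTilde (c : Config) (a : Tuning) : ℝ := max (a.ρhat / 2) ((c.T : ℝ) ^ (-(1 / 4) : ℝ))

/-- `E_{t,η} = √(8 t log(18 t² / η))` with `η = δ / 3`. -/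
def errTerm (c : Config) (t : ℕ) : ℝ := √(8 * t * Real.log (18 * (t : ℝ) ^ 2 / (c.δ / 3)))

/-- The violation budget `M_ρ̃` at round `t`. -/
def budget (c : Config) (a : Tuning) (t : ℕ) : ℝ :=
  2 / rhoTilde c a * √c.T + (2 + 3 / rhoTilde c a) * errTerm c t
    + (1 + 2 / rhoTilde c a) * a.RP + 1 / rhoTilde c a * a.RD

/-- One trajectory. Index `n` is the round `t = n + 1`: `x n = x_{n+1}` and `y n = y_{n+1}` are the
query and the observation of that round, `th n` and `lam n` the hyperparameter and the multiplier
used in it, so that the posterior of that round rests on `x 0, …, x (n - 1)`. -/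
structure Path (d m : ℕ) where
  x : ℕ → EuclideanSpace ℝ (Fin d)
  y : ℕ → ℝ
  th : ℕ → Fin m → ℝ
  lam : ℕ → ℝ

/-- The trajectory of the processes `x`, `y`, `th`, `lam` at `ω`. -/
def pathOf {Ω : Type*} (x : ℕ → Ω → EuclideanSpace ℝ (Fin d)) (y : ℕ → Ω → ℝ)
    (th : ℕ → Ω → Fin m → ℝ) (lam : ℕ → Ω → ℝ) (ω : Ω) : Path d m :=
  ⟨fun n => x n ω, fun n => y n ω, fun n => th n ω, fun n => lam n ω⟩

section Trajectory

variable (P : Problem d m) (c : Config) (a : Tuning) (w : Path d m)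

/-- Posterior mean before round `n + 1`. -/
def mean (n : ℕ) (θ : Fin m → ℝ) (z : EuclideanSpace ℝ (Fin d)) : ℝ :=
  postMean (P.ker θ) c.σ (fun i : Fin n => w.x i) (fun i : Fin n => w.y i) z

/-- Posterior variance before round `n + 1`. -/
def variance (n : ℕ) (θ : Fin m → ℝ) (z : EuclideanSpace ℝ (Fin d)) : ℝ :=
  postVar (P.ker θ) c.σ (fun i : Fin n => w.x i) z

/-- The upper confidence bound that is maximized in round `n + 1`. -/
def ucb (n : ℕ) (z : EuclideanSpace ℝ (Fin d)) : ℝ :=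
  mean P c w n (w.th n) z
    + betaSqrt P c n * postStd (P.ker (w.th n)) c.σ (fun i : Fin n => w.x i) z

/-- Sharpness loss of round `n + 1`. -/
def sharpLoss (n : ℕ) (θ : Fin m → ℝ) : ℝ :=
  1 / Real.log (1 + (c.σ ^ 2)⁻¹) * Real.log (1 + (c.σ ^ 2)⁻¹ * variance P c w n θ (w.x n))

/-- Calibration constraint of round `n + 1`. -/
def calLoss (n : ℕ) (θ : Fin m → ℝ) : ℝ :=
  |w.y n - mean P c w n θ (w.x n)| ^ a.p
    / (betaSqrt P c n * √(variance P c w n θ (w.x n) + c.σ ^ 2)) ^ a.p - 1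

/-- Cumulative violation before round `n + 1`. -/
def violation (n : ℕ) : ℝ := ∑ j ∈ Finset.range n, calLoss P c a w j (w.th j)

/-- The switching test of round `t = n + 1`: `V_t > (T - t) ρ̃ + M_ρ̃ - 1`. -/
def Exceeds (n : ℕ) : Prop :=
  ((c.T : ℝ) - (n + 1)) * rhoTilde c a + budget c a (n + 1) - 1 < violation P c a w n

/-- Round `n + 1` belongs to the recovery phase. -/
def InRecovery (n : ℕ) : Prop := ∃ j ≤ n, Exceeds P c a w j

/-- Both regret minimizers are initialized anew, for recovery, in round `n + 1`. -/
def Reinit (n : ℕ) : Prop := Exceeds P c a w n ∧ (a.restart ∨ ∀ j < n, ¬ Exceeds P c a w j)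

/-- Round at which the regret minimizers in use at index `n` were initialized. -/
def rmStart (n : ℕ) : ℕ := sSup {j | j ≤ n ∧ Reinit P c a w j}

open Classical in
/-- Weight of the sharpness loss. -/
def sharpWeight (n : ℕ) : ℝ := if InRecovery P c a w n then a.recWeight else 1

/-- Primal utility `L^s + λ L^c` of round `n + 1`. -/
def primalUtility (n : ℕ) (θ : Fin m → ℝ) : ℝ :=
  sharpWeight P c a w n * sharpLoss P c w n θ + w.lam n * calLoss P c a w n θ

/-- Dual utility `λ ↦ - L^s - λ L^c` of round `n + 1`. -/
def dualUtility (n : ℕ) (l : ℝ) : ℝ :=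
  -(sharpWeight P c a w n * sharpLoss P c w n (w.th n)) - l * calLoss P c a w n (w.th n)

/-- Objective of follow-the-perturbed-leader at index `n`, with perturbation `η`. -/
def ftplObjective (n : ℕ) (η θ : Fin m → ℝ) : ℝ :=
  ∑ j ∈ Finset.Ico (rmStart P c a w n) n, primalUtility P c a w j θ - ∑ i, θ i * η i

open Classical in
/-- Domain of the multiplier: `[0, 1/ρ̃]` in the play phase and `[0, 1]` in recovery. -/
def dualDomain (n : ℕ) : Set ℝ :=
  Set.Icc 0 (if InRecovery P c a w n then 1 else 1 / rhoTilde c a)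

/-- Bregman divergence of the negative entropy `λ log λ - λ`. -/
def bregman (l l' : ℝ) : ℝ := l * Real.log (l / l') - l + l'

/-- `w.lam (n + 1)` is the mirror-descent update of `w.lam n`. -/
def OMDStep (n : ℕ) : Prop :=
  w.lam (n + 1) ∈ dualDomain P c a w (n + 1) ∧
  IsMinOn (fun l => deriv (dualUtility P c a w n) (w.lam n) * l
      + 1 / a.step n * bregman l (w.lam n))
    (dualDomain P c a w (n + 1)) (w.lam (n + 1))

end Trajectory

/-- A run of OSCBO with UCB acquisition for `c.T` rounds on the objective `f`, on a probability
space `(Ω, μ)`. The σ-algebra `ℱ n` is the information available when `y n` is about to be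
observed: it contains the queries up to `x n`, the perturbations and decisions that led to them,
and the earlier noise. Follow-the-perturbed-leader minimizes over `act`, an `ε_T`-cover of `Θ` with
centres in `Θ`, finite or not; `act = Θ` is one. -/
structure Run {Ω : Type*} [mΩ : MeasurableSpace Ω] (μ : Measure Ω) (P : Problem d m) (c : Config)
    (a : Tuning) (f : EuclideanSpace ℝ (Fin d) → ℝ) where
  x : ℕ → Ω → EuclideanSpace ℝ (Fin d)
  y : ℕ → Ω → ℝ
  noise : ℕ → Ω → ℝ
  th : ℕ → Ω → Fin m → ℝ
  lam : ℕ → Ω → ℝ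
  pert : ℕ → Ω → Fin m → ℝ
  act : Set (Fin m → ℝ)
  ℱ : Filtration ℕ mΩ
  /- information structure -/
  x_meas : ∀ n < c.T, Measurable[ℱ n] (x n)
  th_meas : ∀ n < c.T, Measurable[ℱ n] (th n)
  lam_meas : ∀ n < c.T, Measurable[ℱ n] (lam n)
  pert_meas : ∀ n < c.T, Measurable[ℱ n] (pert n)
  noise_meas : ∀ n < c.T, Measurable[ℱ (n + 1)] (noise n)
  /- observations with conditionally `R`-sub-Gaussian noise -/
  obs : ∀ n < c.T, ∀ ω, y n ω = f (x n ω) + noise n ω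
  noise_integrable : ∀ n < c.T, ∀ s : ℝ, Integrable (fun ω => Real.exp (s * noise n ω)) μ
  noise_subG : ∀ n < c.T, ∀ s : ℝ,
    μ[fun ω => Real.exp (s * noise n ω) | ℱ n] ≤ᵐ[μ] fun _ => Real.exp (s ^ 2 * c.R ^ 2 / 2)
  /- fresh perturbations with independent exponential components -/
  pert_law : ∀ n < c.T, μ.map (pert n) = Measure.pi fun _ : Fin m => expMeasure a.τ
  pert_indep : ∀ n < c.T, Indep (MeasurableSpace.comap (pert n) inferInstance)
    (⨆ j ∈ Finset.range n, MeasurableSpace.comap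
      (fun ω => (x j ω, y j ω, th j ω, lam j ω, pert j ω)) inferInstance) μ
  /- primal regret minimizer -/
  act_net : P.IsNet (epsT c.T) act
  th_mem : ∀ n < c.T, ∀ ω, th n ω ∈ act
  ftpl : ∀ n < c.T, ∀ ω, ∀ θ ∈ act,
    ftplObjective P c a (pathOf x y th lam ω) n (pert n ω) (th n ω)
      ≤ ftplObjective P c a (pathOf x y th lam ω) n (pert n ω) θ + (a.g + a.h * ∑ i, |pert n ω i|)
  /- dual regret minimizer -/
  lamPlay_le : a.lamPlay ≤ 1 / rhoTilde c a
  lam_zero : ∀ ω, ¬ Reinit P c a (pathOf x y th lam ω) 0 → lam 0 ω = a.lamPlay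
  lam_reinit : ∀ n < c.T, ∀ ω, Reinit P c a (pathOf x y th lam ω) n → lam n ω = a.lamRec
  omd : ∀ n, n + 1 < c.T → ∀ ω, ¬ Reinit P c a (pathOf x y th lam ω) (n + 1) →
    OMDStep P c a (pathOf x y th lam ω) n
  /- acquisition -/
  x_mem : ∀ n < c.T, ∀ ω, x n ω ∈ P.X
  x_max : ∀ n < c.T, ∀ ω, IsMaxOn (ucb P c (pathOf x y th lam ω) n) P.X (x n ω)

/-- Cumulative regret of the run after `c.T` rounds, with respect to the point `xstar`. -/
def Run.regret {Ω : Type*} [MeasurableSpace Ω] {μ : Measure Ω} {P : Problem d m} {c : Config}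
    {a : Tuning} {f : EuclideanSpace ℝ (Fin d) → ℝ} (r : Run μ P c a f)
    (xstar : EuclideanSpace ℝ (Fin d)) (ω : Ω) : ℝ :=
  ∑ n ∈ Finset.range c.T, (f xstar - f (r.x n ω))

/-- `(B + √(Γ_{T-1} + log(6 N_{ε_T}(Θ, d) / δ))) (T^(3/4) + √(T γ_T(θ)))`. -/
def regretRate (P : Problem d m) (σ B δ : ℝ) (T : ℕ) (θ : Fin m → ℝ) : ℝ :=
  (B + √(P.supGain σ (T - 1) + Real.log (6 * P.covNum (epsT T) / δ)))
    * ((T : ℝ) ^ (3 / 4 : ℝ) + √(T * P.gain σ T θ))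

end OSCBO

end

/-!
Posterior means and confidence widths are controlled on one event of probability at least `1 - δ`,
for all `θ ∈ Θ` at once: the method of mixtures gives a self-normalized bound on the noise under
each hyperparameter of a minimal `T⁻⁴`-net of `Θ`, and uniform closeness of the kernels carries it
over to the rest of `Θ`. On this event the regret of a UCB round is at most twice the width at the
query plus a lower-order slack, whichever hyperparameters `θ̂` the learners have chosen; nothing
else about the learners matters.

To compare the widths under the varying `θ̂` with `γ_T(θ)`, write the Matérn kernel as a Gamma
mixture of Gaussian kernels. As the lengthscales stay in a compact subset of `(0, ∞)^m`, any two
kernels of the family are comparable in the positive semidefinite order with a common constant `b`,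
and so are their posterior variances; the sum of `σ²_{t-1}(x_t; θ)` is bounded by the information
gain.

For sublinearity, the same mixture gives the spectral measure of the kernel, which has polynomial
tails. Discarding the high frequencies and expanding the remaining plane waves in Taylor series
shows that the Gram matrices are nearly of low rank, whence `Γ_n = O(n ^ a)` with `a < 1 / 2` when
`ν > d / 2`; the logarithm of the covering number only grows like `log T`.
-/

noncomputable section

namespace OSCBO

/-! ### Positive semidefinite kernels and the Gaussian process posterior -/

section Posterior

open Matrix

variable {E : Type} {n : ℕ} {k : E → E → ℝ} {σ : ℝ}

/-- A positive semidefinite kernel: all its Gram matrices are positive semidefinite. -/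
def IsPSDKernel (k : E → E → ℝ) : Prop := ∀ (n : ℕ) (x : Fin n → E), (gram k x).PosSemidef

/-- The kernel order with constant `b`: `b k - a` has nonnegative quadratic forms. Equivalently,
the unit ball of the RKHS of `a` lies in the ball of radius `√b` of the RKHS of `k`. -/
def KernelLE (a k : E → E → ℝ) (b : ℝ) : Prop :=
  ∀ (n : ℕ) (x : Fin n → E) (c : Fin n → ℝ),
    c ⬝ᵥ gram a x *ᵥ c ≤ b * (c ⬝ᵥ gram k x *ᵥ c)

/-- The covariance matrix `K + σ² I` of noisy observations at the points `x`. -/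
def noisyGram (k : E → E → ℝ) (σ : ℝ) (x : Fin n → E) : Matrix (Fin n) (Fin n) ℝ :=
  gram k x + σ ^ 2 • (1 : Matrix (Fin n) (Fin n) ℝ)

/-- The weights `α = (K + σ² I)⁻¹ k_x(z)` with which the observations enter the posterior mean
at `z`. -/
def krigingWeights (k : E → E → ℝ) (σ : ℝ) (x : Fin n → E) (z : E) : Fin n → ℝ :=
  (noisyGram k σ x)⁻¹ *ᵥ kvec k x z

/-- The squared RKHS norm of `k(·, z) - ∑ i, α i k(·, x i)`, written out. -/
def residualSq (k : E → E → ℝ) (x : Fin n → E) (z : E) (α : Fin n → ℝ) : ℝ :=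
  k z z - 2 * (α ⬝ᵥ kvec k x z) + α ⬝ᵥ gram k x *ᵥ α

lemma dotProduct_mulVec_comm {ι R : Type*} [Fintype ι] [CommSemiring R] {M : Matrix ι ι R}
    (hM : M.IsSymm) (v w : ι → R) : v ⬝ᵥ M *ᵥ w = w ⬝ᵥ M *ᵥ v := by
  rw [dotProduct_mulVec, ← mulVec_transpose, hM.eq, dotProduct_comm]

lemma real_dotProduct_self_nonneg {ι : Type*} [Fintype ι] (v : ι → ℝ) : 0 ≤ v ⬝ᵥ v :=
  Finset.sum_nonneg fun i _ => mul_self_nonneg (v i)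

lemma IsPSDKernel.symm (hk : IsPSDKernel k) (x y : E) : k x y = k y x := by
  simpa [gram] using ((hk 2 ![x, y]).1.apply 0 1).symm

lemma IsPSDKernel.quad_nonneg (hk : IsPSDKernel k) (x : Fin n → E) (c : Fin n → ℝ) :
    0 ≤ c ⬝ᵥ gram k x *ᵥ c := by
  simpa using (hk n x).dotProduct_mulVec_nonneg c

lemma noisyGram_mulVec (x : Fin n → E) (v : Fin n → ℝ) :
    noisyGram k σ x *ᵥ v = gram k x *ᵥ v + σ ^ 2 • v := by
  simp [noisyGram, add_mulVec, smul_mulVec]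

lemma dotProduct_noisyGram_mulVec (x : Fin n → E) (v : Fin n → ℝ) :
    v ⬝ᵥ noisyGram k σ x *ᵥ v = v ⬝ᵥ gram k x *ᵥ v + σ ^ 2 * (v ⬝ᵥ v) := by
  rw [noisyGram_mulVec, dotProduct_add, dotProduct_smul, smul_eq_mul]

section PosDef

variable (hk : IsPSDKernel k) (hσ : 0 < σ) (x : Fin n → E)
include hk hσ

lemma noisyGram_posDef : (noisyGram k σ x).PosDef :=
  PosDef.posSemidef_add (hk n x) (PosDef.one.smul (by positivity))

lemma noisyGram_isSymm : (noisyGram k σ x).IsSymm :=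
  isHermitian_iff_isSymm.1 (noisyGram_posDef hk hσ x).1

lemma isUnit_noisyGram_det : IsUnit (noisyGram k σ x).det :=
  (noisyGram_posDef hk hσ x).det_pos.ne'.isUnit

lemma noisyGram_mulVec_inv_mulVec (v : Fin n → ℝ) :
    noisyGram k σ x *ᵥ ((noisyGram k σ x)⁻¹ *ᵥ v) = v := by
  rw [mulVec_mulVec, mul_nonsing_inv _ (isUnit_noisyGram_det hk hσ x), one_mulVec]

lemma noisyGram_inv_mulVec_eq {v w : Fin n → ℝ} (h : noisyGram k σ x *ᵥ w = v) :
    (noisyGram k σ x)⁻¹ *ᵥ v = w := by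
  rw [← h, mulVec_mulVec, nonsing_inv_mul _ (isUnit_noisyGram_det hk hσ x), one_mulVec]

lemma dotProduct_noisyGram_inv_comm (v w : Fin n → ℝ) :
    v ⬝ᵥ (noisyGram k σ x)⁻¹ *ᵥ w = w ⬝ᵥ (noisyGram k σ x)⁻¹ *ᵥ v :=
  dotProduct_mulVec_comm (isHermitian_iff_isSymm.1 (noisyGram_posDef hk hσ x).inv.1) v w

/-- Completing the square: `v ↦ vᵀ A⁻¹ v` is the Legendre transform of `w ↦ wᵀ A w`. -/
lemma two_mul_dotProduct_sub_quad_le (v w : Fin n → ℝ) :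
    2 * (w ⬝ᵥ v) - w ⬝ᵥ noisyGram k σ x *ᵥ w ≤ v ⬝ᵥ (noisyGram k σ x)⁻¹ *ᵥ v := by
  set A := noisyGram k σ x
  have hsq : 0 ≤ (w - A⁻¹ *ᵥ v) ⬝ᵥ A *ᵥ (w - A⁻¹ *ᵥ v) := by
    simpa using (noisyGram_posDef hk hσ x).posSemidef.dotProduct_mulVec_nonneg (w - A⁻¹ *ᵥ v)
  rw [mulVec_sub, noisyGram_mulVec_inv_mulVec hk hσ, sub_dotProduct, dotProduct_sub,
    dotProduct_sub, dotProduct_mulVec_comm (noisyGram_isSymm hk hσ x) (A⁻¹ *ᵥ v),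
    noisyGram_mulVec_inv_mulVec hk hσ, dotProduct_comm (A⁻¹ *ᵥ v) v] at hsq
  linarith

lemma postVar_le_residualSq (z : E) (α : Fin n → ℝ) :
    postVar k σ x z ≤ residualSq k x z α + σ ^ 2 * (α ⬝ᵥ α) := by
  have h := two_mul_dotProduct_sub_quad_le hk hσ x (kvec k x z) α
  rw [dotProduct_noisyGram_mulVec] at h
  change k z z - kvec k x z ⬝ᵥ (noisyGram k σ x)⁻¹ *ᵥ kvec k x z ≤ _
  rw [residualSq]
  linarith

lemma postVar_eq_residualSq (z : E) :
    postVar k σ x z = residualSq k x z (krigingWeights k σ x z)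
      + σ ^ 2 * (krigingWeights k σ x z ⬝ᵥ krigingWeights k σ x z) := by
  have h := dotProduct_noisyGram_mulVec (k := k) (σ := σ) x (krigingWeights k σ x z)
  rw [krigingWeights, noisyGram_mulVec_inv_mulVec hk hσ] at h
  change k z z - kvec k x z ⬝ᵥ (noisyGram k σ x)⁻¹ *ᵥ kvec k x z = _
  rw [residualSq, krigingWeights, dotProduct_comm (kvec k x z)]
  linarith

lemma residualSq_krigingWeights_le (z : E) :
    residualSq k x z (krigingWeights k σ x z) ≤ postVar k σ x z := by
  rw [postVar_eq_residualSq hk hσ]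
  exact le_add_of_nonneg_right (mul_nonneg (sq_nonneg σ) (real_dotProduct_self_nonneg _))

lemma postMean_eq_krigingWeights (y : Fin n → ℝ) (z : E) :
    postMean k σ x y z = krigingWeights k σ x z ⬝ᵥ y := by
  change kvec k x z ⬝ᵥ (noisyGram k σ x)⁻¹ *ᵥ y = _
  rw [dotProduct_noisyGram_inv_comm hk hσ, dotProduct_comm, krigingWeights]

end PosDef

lemma gram_snoc_quad (hs : ∀ x y, k x y = k y x) (x : Fin n → E) (z : E) (α : Fin n → ℝ) :
    (Fin.snoc (-α) 1 : Fin (n + 1) → ℝ) ⬝ᵥ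
        gram k (Fin.snoc x z : Fin (n + 1) → E) *ᵥ (Fin.snoc (-α) 1 : Fin (n + 1) → ℝ)
      = residualSq k x z α := by
  simp only [residualSq, dotProduct, mulVec, gram, kvec, of_apply, Fin.sum_univ_castSucc,
    Fin.snoc_castSucc, Fin.snoc_last, Pi.neg_apply, mul_add, hs z, mul_neg, neg_mul,
    mul_one, one_mul, Finset.sum_add_distrib, Finset.sum_neg_distrib]
  simp only [mul_comm (α _)]
  ring

lemma residualSq_nonneg (hk : IsPSDKernel k) (x : Fin n → E) (z : E) (α : Fin n → ℝ) :
    0 ≤ residualSq k x z α :=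
  gram_snoc_quad hk.symm x z α ▸ hk.quad_nonneg _ _

lemma residualSq_le_of_kernelLE {a : E → E → ℝ} {b : ℝ} (ha : ∀ x y, a x y = a y x)
    (hk : ∀ x y, k x y = k y x) (hak : KernelLE a k b) (x : Fin n → E) (z : E) (α : Fin n → ℝ) :
    residualSq a x z α ≤ b * residualSq k x z α := by
  rw [← gram_snoc_quad ha, ← gram_snoc_quad hk]
  exact hak _ _ _

lemma postVar_nonneg (hk : IsPSDKernel k) (hσ : 0 < σ) (x : Fin n → E) (z : E) :
    0 ≤ postVar k σ x z :=
  (residualSq_nonneg hk x z _).trans (residualSq_krigingWeights_le hk hσ x z)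

lemma postVar_le_diag (hk : IsPSDKernel k) (hσ : 0 < σ) (x : Fin n → E) (z : E) :
    postVar k σ x z ≤ k z z := by
  simpa [residualSq] using postVar_le_residualSq hk hσ x z 0

lemma postVar_le_of_kernelLE {a : E → E → ℝ} {b : ℝ} (ha : IsPSDKernel a) (hk : IsPSDKernel k)
    (hak : KernelLE a k b) (hb : 1 ≤ b) (hσ : 0 < σ) (x : Fin n → E) (z : E) :
    postVar a σ x z ≤ b * postVar k σ x z := by
  set α := krigingWeights k σ x z
  have hα : 0 ≤ σ ^ 2 * (α ⬝ᵥ α) := mul_nonneg (sq_nonneg σ) (real_dotProduct_self_nonneg α)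
  calc postVar a σ x z ≤ residualSq a x z α + σ ^ 2 * (α ⬝ᵥ α) := postVar_le_residualSq ha hσ x z α
    _ ≤ b * residualSq k x z α + b * (σ ^ 2 * (α ⬝ᵥ α)) :=
        add_le_add (residualSq_le_of_kernelLE ha.symm hk.symm hak x z α)
          (le_mul_of_one_le_left hα hb)
    _ = b * postVar k σ x z := by rw [postVar_eq_residualSq hk hσ, mul_add]

/-- The hypothesis on `f` is the finite-sample form of `f` having RKHS norm at most `B` on `X`. -/
lemma abs_sub_postMean_le (hk : IsPSDKernel k) (hσ : 0 < σ) {X : Set E} {f : E → ℝ} {B : ℝ}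
    (hB : 0 ≤ B)
    (hf : ∀ (n : ℕ) (x : Fin n → E), (∀ i, x i ∈ X) → ∀ c : Fin n → ℝ,
      (c ⬝ᵥ fun i => f (x i)) ^ 2 ≤ B ^ 2 * (c ⬝ᵥ gram k x *ᵥ c))
    (x : Fin n → E) (hx : ∀ i, x i ∈ X) {z : E} (hz : z ∈ X) :
    |f z - postMean k σ x (fun i => f (x i)) z| ≤ B * postStd k σ x z := by
  have hxz : ∀ i, (Fin.snoc x z : Fin (n + 1) → E) i ∈ X :=
    Fin.lastCases (by simpa using hz) (by simpa using hx)
  have hsq := hf (n + 1) (Fin.snoc x z) hxz (Fin.snoc (-krigingWeights k σ x z) 1)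
  have herr : ((Fin.snoc (-krigingWeights k σ x z) 1 : Fin (n + 1) → ℝ) ⬝ᵥ
      fun i => f ((Fin.snoc x z : Fin (n + 1) → E) i))
      = f z - postMean k σ x (fun i => f (x i)) z := by
    rw [postMean_eq_krigingWeights hk hσ]
    simp only [dotProduct, Fin.sum_univ_castSucc, Fin.snoc_castSucc, Fin.snoc_last, Pi.neg_apply,
      neg_mul, Finset.sum_neg_distrib]
    ring
  rw [herr, gram_snoc_quad hk.symm] at hsq
  rw [postStd, ← Real.sqrt_sq hB, ← Real.sqrt_mul (sq_nonneg B)]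
  refine Real.abs_le_sqrt (hsq.trans ?_)
  gcongr
  exact residualSq_krigingWeights_le hk hσ x z

/-! ### Adding one data point -/

variable (hk : IsPSDKernel k) (hσ : 0 < σ) (x : Fin (n + 1) → E)

lemma gram_mulVec_snoc_castSucc (w : Fin n → ℝ) (l : ℝ) (j : Fin n) :
    (gram k x *ᵥ (Fin.snoc w l : Fin (n + 1) → ℝ)) j.castSucc
      = (gram k (Fin.init x) *ᵥ w) j + kvec k (Fin.init x) (x (Fin.last n)) j * l := by
  simp [mulVec, dotProduct, gram, kvec, Fin.sum_univ_castSucc, Fin.init]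

lemma gram_mulVec_snoc_last (hs : ∀ x y, k x y = k y x) (w : Fin n → ℝ) (l : ℝ) :
    (gram k x *ᵥ (Fin.snoc w l : Fin (n + 1) → ℝ)) (Fin.last n)
      = kvec k (Fin.init x) (x (Fin.last n)) ⬝ᵥ w
        + k (x (Fin.last n)) (x (Fin.last n)) * l := by
  simp [mulVec, dotProduct, gram, kvec, Fin.sum_univ_castSucc, Fin.init, hs (x (Fin.last n))]

lemma noisyGram_submatrix_eq_fromBlocks (hs : ∀ x y, k x y = k y x) :
    (noisyGram k σ x).submatrix (finSumFinEquiv : Fin n ⊕ Fin 1 ≃ Fin (n + 1)) finSumFinEquiv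
      = fromBlocks (noisyGram k σ (Fin.init x))
          (replicateCol (Fin 1) (kvec k (Fin.init x) (x (Fin.last n))))
          (replicateRow (Fin 1) (kvec k (Fin.init x) (x (Fin.last n))))
          (of fun _ _ => k (x (Fin.last n)) (x (Fin.last n)) + σ ^ 2) := by
  have hcast (i : Fin n) : Fin.castAdd 1 i = i.castSucc := rfl
  have hlast (i : Fin 1) : Fin.natAdd n i = Fin.last n := by rw [Subsingleton.elim i 0]; rfl
  ext i j
  rcases i with i | i <;> rcases j with j | j <;>
    simp [noisyGram, gram, kvec, Fin.init, hcast, hlast, one_apply, hs (x (Fin.last n)),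
      (Fin.castSucc_lt_last _).ne, (Fin.castSucc_lt_last _).ne']

include hk hσ

/-- Block elimination: the last entry of the solution is the normalized innovation. -/
lemma noisyGram_inv_mulVec_succ (v : Fin (n + 1) → ℝ) {l : ℝ}
    (hl : (postVar k σ (Fin.init x) (x (Fin.last n)) + σ ^ 2) * l
      = v (Fin.last n) - postMean k σ (Fin.init x) (Fin.init v) (x (Fin.last n))) :
    (noisyGram k σ x)⁻¹ *ᵥ v
      = (Fin.snoc ((noisyGram k σ (Fin.init x))⁻¹ *ᵥ Fin.init v
          - l • krigingWeights k σ (Fin.init x) (x (Fin.last n))) l : Fin (n + 1) → ℝ) := by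
  refine noisyGram_inv_mulVec_eq hk hσ x ?_
  set z := x (Fin.last n)
  set w := (noisyGram k σ (Fin.init x))⁻¹ *ᵥ Fin.init v - l • krigingWeights k σ (Fin.init x) z
    with hw
  have hsolve : noisyGram k σ (Fin.init x) *ᵥ w = Fin.init v - l • kvec k (Fin.init x) z := by
    rw [hw, mulVec_sub, mulVec_smul, krigingWeights, noisyGram_mulVec_inv_mulVec hk hσ,
      noisyGram_mulVec_inv_mulVec hk hσ]
  have hdot : kvec k (Fin.init x) z ⬝ᵥ w
      = postMean k σ (Fin.init x) (Fin.init v) z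
        - l * (k z z - postVar k σ (Fin.init x) z) := by
    rw [hw, dotProduct_sub, dotProduct_smul, smul_eq_mul, postVar, sub_sub_cancel]
    rfl
  rw [noisyGram_mulVec]
  funext i
  induction i using Fin.lastCases with
  | last =>
    rw [Pi.add_apply, gram_mulVec_snoc_last x hk.symm, hdot, Pi.smul_apply, Fin.snoc_last,
      smul_eq_mul]
    linarith
  | cast j =>
    have h := congrFun hsolve j
    simp only [noisyGram_mulVec, Pi.add_apply, Pi.smul_apply, smul_eq_mul, Pi.sub_apply] at h
    rw [Pi.add_apply, gram_mulVec_snoc_castSucc, Pi.smul_apply, Fin.snoc_castSucc, smul_eq_mul]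
    linarith [show Fin.init v j = v j.castSucc from rfl]

lemma dotProduct_noisyGram_inv_succ (v : Fin (n + 1) → ℝ) :
    v ⬝ᵥ (noisyGram k σ x)⁻¹ *ᵥ v
      = Fin.init v ⬝ᵥ (noisyGram k σ (Fin.init x))⁻¹ *ᵥ Fin.init v
        + (v (Fin.last n) - postMean k σ (Fin.init x) (Fin.init v) (x (Fin.last n))) ^ 2
          / (postVar k σ (Fin.init x) (x (Fin.last n)) + σ ^ 2) := by
  set z := x (Fin.last n)
  set s := postVar k σ (Fin.init x) z + σ ^ 2 with hs
  have hs0 : 0 < s := add_pos_of_nonneg_of_pos (postVar_nonneg hk hσ _ z) (by positivity)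
  set μ := postMean k σ (Fin.init x) (Fin.init v) z with hμ
  have hsplit (w : Fin n → ℝ) (l : ℝ) :
      v ⬝ᵥ (Fin.snoc w l : Fin (n + 1) → ℝ) = Fin.init v ⬝ᵥ w + v (Fin.last n) * l := by
    simp [dotProduct, Fin.sum_univ_castSucc, Fin.init]
  rw [noisyGram_inv_mulVec_succ hk hσ x v (mul_div_cancel₀ (v (Fin.last n) - μ) hs0.ne'), hsplit,
    dotProduct_sub, dotProduct_smul, smul_eq_mul,
    dotProduct_comm (Fin.init v) (krigingWeights _ _ _ _),
    ← postMean_eq_krigingWeights hk hσ, ← hs, ← hμ]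
  ring

lemma noisyGram_det_succ :
    (noisyGram k σ x).det = (noisyGram k σ (Fin.init x)).det
      * (postVar k σ (Fin.init x) (x (Fin.last n)) + σ ^ 2) := by
  set A := noisyGram k σ (Fin.init x)
  set b := kvec k (Fin.init x) (x (Fin.last n))
  let _ : Invertible A := A.invertibleOfIsUnitDet (isUnit_noisyGram_det hk hσ _)
  rw [← det_submatrix_equiv_self (finSumFinEquiv : Fin n ⊕ Fin 1 ≃ Fin (n + 1)),
    noisyGram_submatrix_eq_fromBlocks x hk.symm, det_fromBlocks₁₁, det_fin_one,
    invOf_eq_nonsing_inv]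
  rw [Matrix.sub_apply, Matrix.mul_assoc, ← replicateCol_mulVec,
    replicateRow_mul_replicateCol_apply, of_apply, add_sub_right_comm]
  rfl

end Posterior

/-! ### The explained part of a data vector -/

section Explained

open Matrix

variable {E : Type} {n : ℕ} {k : E → E → ℝ} {σ : ℝ}

/-- The part `|v|² - σ² vᵀ (K + σ² I)⁻¹ v` of `|v|²` explained by the posterior: the exponent of
the self-normalized supermartingale when `v` is the noise vector. -/
def explained (k : E → E → ℝ) (σ : ℝ) (x : Fin n → E) (v : Fin n → ℝ) : ℝ :=
  v ⬝ᵥ v - σ ^ 2 * (v ⬝ᵥ (noisyGram k σ x)⁻¹ *ᵥ v)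

lemma explained_nonneg (hk : IsPSDKernel k) (hσ : 0 < σ) (x : Fin n → E) (v : Fin n → ℝ) :
    0 ≤ explained k σ x v := by
  set w := (noisyGram k σ x)⁻¹ *ᵥ v with hw
  have hv : v = gram k x *ᵥ w + σ ^ 2 • w := by
    rw [← noisyGram_mulVec, noisyGram_mulVec_inv_mulVec hk hσ]
  have hKw : 0 ≤ gram k x *ᵥ w ⬝ᵥ gram k x *ᵥ w := real_dotProduct_self_nonneg _
  have hquad : 0 ≤ w ⬝ᵥ gram k x *ᵥ w := hk.quad_nonneg x w
  calc 0 ≤ gram k x *ᵥ w ⬝ᵥ gram k x *ᵥ w + σ ^ 2 * (w ⬝ᵥ gram k x *ᵥ w) := by positivity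
    _ = explained k σ x v := by
      rw [explained, ← hw]
      conv_rhs => rw [hv]
      simp only [dotProduct_add, add_dotProduct, dotProduct_smul, smul_dotProduct, smul_eq_mul]
      ring

lemma noisyGram_inv_mulVec_dotProduct_self_le (hk : IsPSDKernel k) (hσ : 0 < σ) (x : Fin n → E)
    (v : Fin n → ℝ) :
    σ ^ 4 * ((noisyGram k σ x)⁻¹ *ᵥ v ⬝ᵥ (noisyGram k σ x)⁻¹ *ᵥ v) ≤ v ⬝ᵥ v := by
  set w := (noisyGram k σ x)⁻¹ *ᵥ v
  have hv : v = gram k x *ᵥ w + σ ^ 2 • w := by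
    rw [← noisyGram_mulVec, noisyGram_mulVec_inv_mulVec hk hσ]
  have hKw : 0 ≤ gram k x *ᵥ w ⬝ᵥ gram k x *ᵥ w := real_dotProduct_self_nonneg _
  have hquad : 0 ≤ w ⬝ᵥ gram k x *ᵥ w := hk.quad_nonneg x w
  have hexpand : v ⬝ᵥ v = gram k x *ᵥ w ⬝ᵥ gram k x *ᵥ w
      + 2 * σ ^ 2 * (w ⬝ᵥ gram k x *ᵥ w) + σ ^ 4 * (w ⬝ᵥ w) := by
    conv_lhs => rw [hv]
    simp only [dotProduct_add, add_dotProduct, dotProduct_smul, smul_dotProduct, smul_eq_mul,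
      dotProduct_comm (gram k x *ᵥ w) w]
    ring
  rw [hexpand]
  exact le_add_of_nonneg_left (by positivity)

lemma explained_succ (hk : IsPSDKernel k) (hσ : 0 < σ) (x : Fin (n + 1) → E)
    (v : Fin (n + 1) → ℝ) :
    explained k σ x v
      = explained k σ (Fin.init x) (Fin.init v)
        + (v (Fin.last n) ^ 2 - σ ^ 2 * (v (Fin.last n)
            - postMean k σ (Fin.init x) (Fin.init v) (x (Fin.last n))) ^ 2
          / (postVar k σ (Fin.init x) (x (Fin.last n)) + σ ^ 2)) := by
  have hsplit : v ⬝ᵥ v = Fin.init v ⬝ᵥ Fin.init v + v (Fin.last n) ^ 2 := by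
    simp only [dotProduct, Fin.sum_univ_castSucc, Fin.init, sq]
  rw [explained, explained, dotProduct_noisyGram_inv_succ hk hσ x v, hsplit]
  ring

/-- The left side minus the right side is, up to a factor `4`, the discriminant in `t` of the
explained part of `v` extended by the value `t` at `z`, which is nonnegative. -/
lemma sq_mul_postMean_sq_le (hk : IsPSDKernel k) (hσ : 0 < σ) (x : Fin n → E) (v : Fin n → ℝ)
    (z : E) : σ ^ 2 * postMean k σ x v z ^ 2 ≤ postVar k σ x z * explained k σ x v := by
  set μ := postMean k σ x v z with hμ
  set s := postVar k σ x z with hs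
  set q := explained k σ x v with hq
  have hsσ : 0 < s + σ ^ 2 := add_pos_of_nonneg_of_pos (postVar_nonneg hk hσ x z) (by positivity)
  have hquad (t : ℝ) :
      0 ≤ s * (t * t) + 2 * σ ^ 2 * μ * t + (q * (s + σ ^ 2) - σ ^ 2 * μ ^ 2) := by
    have h := explained_nonneg hk hσ (Fin.snoc x z : Fin (n + 1) → E) (Fin.snoc v t)
    rw [explained_succ hk hσ] at h
    simp only [Fin.init_snoc, Fin.snoc_last] at h
    rw [← hμ, ← hs, ← hq] at h
    refine (mul_nonneg h hsσ.le).trans_eq ?_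
    field_simp
    ring
  have hdiscrim := discrim_le_zero hquad
  rw [discrim] at hdiscrim
  refine le_of_mul_le_mul_left ?_ hsσ
  linarith

lemma abs_postMean_le (hk : IsPSDKernel k) (hσ : 0 < σ) (x : Fin n → E) (v : Fin n → ℝ) (z : E) :
    |postMean k σ x v z| ≤ postStd k σ x z / σ * √(explained k σ x v) := by
  rw [postStd, div_mul_eq_mul_div, le_div_iff₀ hσ, ← Real.sqrt_mul (postVar_nonneg hk hσ x z),
    ← abs_of_pos hσ, ← abs_mul, abs_of_pos hσ]
  exact Real.abs_le_sqrt (by linarith [sq_mul_postMean_sq_le hk hσ x v z])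

lemma explained_le_of_gram_le {a : E → E → ℝ} (ha : IsPSDKernel a) (hk : IsPSDKernel k)
    (hσ : 0 < σ) (x : Fin n → E) {η : ℝ} (hη : 0 ≤ η)
    (h : ∀ c : Fin n → ℝ, c ⬝ᵥ gram a x *ᵥ c ≤ c ⬝ᵥ gram k x *ᵥ c + η * (c ⬝ᵥ c))
    (v : Fin n → ℝ) :
    explained a σ x v ≤ explained k σ x v + η / σ ^ 2 * (v ⬝ᵥ v) := by
  set w := (noisyGram k σ x)⁻¹ *ᵥ v with hw
  have hlegendre := two_mul_dotProduct_sub_quad_le ha hσ x v w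
  have hquad := dotProduct_noisyGram_mulVec (k := k) (σ := σ) x w
  rw [hw, noisyGram_mulVec_inv_mulVec hk hσ, ← hw] at hquad
  have hinv : v ⬝ᵥ w - v ⬝ᵥ (noisyGram a σ x)⁻¹ *ᵥ v ≤ η * (w ⬝ᵥ w) := by
    rw [dotProduct_noisyGram_mulVec] at hlegendre
    rw [dotProduct_comm v w]
    linarith [h w]
  have hnorm : σ ^ 2 * (w ⬝ᵥ w) ≤ (v ⬝ᵥ v) / σ ^ 2 := by
    rw [le_div_iff₀ (by positivity)]
    linarith [noisyGram_inv_mulVec_dotProduct_self_le hk hσ x v]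
  calc explained a σ x v
      = explained k σ x v + σ ^ 2 * (v ⬝ᵥ w - v ⬝ᵥ (noisyGram a σ x)⁻¹ *ᵥ v) := by
        rw [explained, explained, ← hw]; ring
    _ ≤ explained k σ x v + σ ^ 2 * (η * (w ⬝ᵥ w)) := by gcongr
    _ = explained k σ x v + η * (σ ^ 2 * (w ⬝ᵥ w)) := by ring
    _ ≤ explained k σ x v + η * ((v ⬝ᵥ v) / σ ^ 2) := by gcongr
    _ = explained k σ x v + η / σ ^ 2 * (v ⬝ᵥ v) := by ring

end Explained

/-! ### Information gain -/

section InformationGain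

open Matrix

variable {E : Type} {n : ℕ} {k : E → E → ℝ} {σ : ℝ}

lemma le_two_mul_log_one_add {u : ℝ} (h0 : 0 ≤ u) (h1 : u ≤ 1) : u ≤ 2 * Real.log (1 + u) := by
  have h := Real.le_log_one_add_of_nonneg h0
  have hu : u / 2 ≤ 2 * u / (u + 2) := by
    rw [div_le_div_iff₀ two_pos (by linarith)]
    nlinarith
  linarith

lemma infoGain_eq_log_noisyGram_det (hσ : 0 < σ) (x : Fin n → E) :
    infoGain k σ x = 1 / 2 * Real.log ((σ ^ 2)⁻¹ ^ n * (noisyGram k σ x).det) := by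
  have hscale : 1 + (σ ^ 2)⁻¹ • gram k x = (σ ^ 2)⁻¹ • noisyGram k σ x := by
    rw [noisyGram, smul_add, smul_smul, inv_mul_cancel₀ (by positivity), one_smul, add_comm]
  rw [infoGain, hscale, det_smul, Fintype.card_fin]

section

variable (hk : IsPSDKernel k) (hσ : 0 < σ)
include hk hσ

lemma log_one_add_postVar_nonneg (x : Fin n → E) (z : E) :
    0 ≤ Real.log (1 + postVar k σ x z / σ ^ 2) :=
  Real.log_nonneg <| le_add_of_nonneg_right <| div_nonneg (postVar_nonneg hk hσ x z) (sq_nonneg σ)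

lemma infoGain_succ (x : Fin (n + 1) → E) :
    infoGain k σ x = infoGain k σ (Fin.init x)
      + 1 / 2 * Real.log (1 + postVar k σ (Fin.init x) (x (Fin.last n)) / σ ^ 2) := by
  have hs := postVar_nonneg hk hσ (Fin.init x) (x (Fin.last n))
  have hdet := (noisyGram_posDef hk hσ (Fin.init x)).det_pos
  rw [infoGain_eq_log_noisyGram_det hσ, infoGain_eq_log_noisyGram_det hσ,
    noisyGram_det_succ hk hσ, ← mul_add, ← Real.log_mul (by positivity) (by positivity)]
  have hfactor : 1 + postVar k σ (Fin.init x) (x (Fin.last n)) / σ ^ 2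
      = (σ ^ 2)⁻¹ * (postVar k σ (Fin.init x) (x (Fin.last n)) + σ ^ 2) := by
    field_simp
    ring
  rw [hfactor, pow_succ]
  congr 2
  ring

lemma infoGain_eq_sum_log (x : ℕ → E) (n : ℕ) :
    infoGain k σ (fun i : Fin n => x i)
      = 1 / 2 * ∑ j ∈ Finset.range n,
          Real.log (1 + postVar k σ (fun i : Fin j => x i) (x j) / σ ^ 2) := by
  induction n with
  | zero => simp [infoGain]
  | succ n ih =>
    rw [infoGain_succ hk hσ, Finset.sum_range_succ, mul_add, ← ih]
    rfl

lemma infoGain_nonneg (x : Fin n → E) : 0 ≤ infoGain k σ x := by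
  induction n with
  | zero => simp [infoGain]
  | succ n ih =>
    rw [infoGain_succ hk hσ]
    linarith [ih (Fin.init x), log_one_add_postVar_nonneg hk hσ (Fin.init x) (x (Fin.last n))]

lemma maxInfoGain_nonneg (X : Set E) (n : ℕ) : 0 ≤ maxInfoGain k σ X n :=
  Real.iSup_nonneg fun _ => infoGain_nonneg hk hσ _

variable (hdiag : ∀ z, k z z ≤ σ ^ 2)
include hdiag

lemma postVar_div_sq_mem_Icc (x : Fin n → E) (z : E) :
    postVar k σ x z / σ ^ 2 ∈ Set.Icc (0 : ℝ) 1 :=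
  ⟨div_nonneg (postVar_nonneg hk hσ x z) (sq_nonneg σ),
    (div_le_one (by positivity)).2 ((postVar_le_diag hk hσ x z).trans (hdiag z))⟩

lemma infoGain_le (x : Fin n → E) : infoGain k σ x ≤ n / 2 := by
  induction n with
  | zero => simp [infoGain]
  | succ n ih =>
    obtain ⟨hu0, hu1⟩ := postVar_div_sq_mem_Icc hk hσ hdiag (Fin.init x) (x (Fin.last n))
    have hlog := Real.log_le_sub_one_of_pos
      (x := 1 + postVar k σ (Fin.init x) (x (Fin.last n)) / σ ^ 2) (by linarith)
    rw [infoGain_succ hk hσ]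
    push_cast
    linarith [ih (Fin.init x)]

lemma maxInfoGain_le (X : Set E) (n : ℕ) : maxInfoGain k σ X n ≤ n / 2 :=
  Real.iSup_le (fun _ => infoGain_le hk hσ hdiag _) (by positivity)

lemma infoGain_le_maxInfoGain {X : Set E} (x : Fin n → E) (hx : ∀ i, x i ∈ X) :
    infoGain k σ x ≤ maxInfoGain k σ X n :=
  le_ciSup (f := fun x : Fin n → X => infoGain k σ fun i => (x i : E))
    ⟨n / 2, Set.forall_mem_range.2 fun _ => infoGain_le hk hσ hdiag _⟩ fun i => ⟨x i, hx i⟩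

lemma maxInfoGain_mono {X : Set E} (hX : X.Nonempty) : Monotone (maxInfoGain k σ X) := by
  obtain ⟨z, hz⟩ := hX
  refine monotone_nat_of_le_succ fun n => Real.iSup_le (fun x => ?_) (maxInfoGain_nonneg hk hσ X _)
  set xz : Fin (n + 1) → E := Fin.snoc (fun i => (x i : E)) z
  have hxz : ∀ i, xz i ∈ X := Fin.lastCases (by simpa [xz] using hz) (by simp [xz])
  calc infoGain k σ (fun i => (x i : E)) = infoGain k σ (Fin.init xz) := by rw [Fin.init_snoc]
    _ ≤ infoGain k σ xz := by
      rw [infoGain_succ hk hσ xz]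
      linarith [log_one_add_postVar_nonneg hk hσ (Fin.init xz) (xz (Fin.last n))]
    _ ≤ maxInfoGain k σ X (n + 1) := infoGain_le_maxInfoGain hk hσ hdiag xz hxz

lemma sum_postVar_le (x : ℕ → E) (n : ℕ) :
    ∑ j ∈ Finset.range n, postVar k σ (fun i : Fin j => x i) (x j)
      ≤ 4 * σ ^ 2 * infoGain k σ (fun i : Fin n => x i) := by
  rw [infoGain_eq_sum_log hk hσ, ← mul_assoc, Finset.mul_sum]
  refine Finset.sum_le_sum fun j _ => ?_
  set s := postVar k σ (fun i : Fin j => x i) (x j)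
  obtain ⟨hu0, hu1⟩ := postVar_div_sq_mem_Icc hk hσ hdiag (fun i : Fin j => x i) (x j)
  calc s = σ ^ 2 * (s / σ ^ 2) := by field_simp
    _ ≤ σ ^ 2 * (2 * Real.log (1 + s / σ ^ 2)) := by
      gcongr
      exact le_two_mul_log_one_add hu0 hu1
    _ = 4 * σ ^ 2 * (1 / 2) * Real.log (1 + s / σ ^ 2) := by ring

end

end InformationGain

/-! ### Gaussian kernels -/

section Gaussian

variable {ι κ : Type*} [Fintype ι] [Fintype κ]

/-- The quadratic form at `c` of the Gram matrix of the Gaussian kernel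
`exp (-∑ i, a i (y i - y' i)²)` at the points `y`. -/
def gaussQuad (a : ι → ℝ) (y : κ → ι → ℝ) (c : κ → ℝ) : ℝ :=
  ∑ j, ∑ l, c j * c l * Real.exp (-∑ i, a i * (y j i - y l i) ^ 2)

open Complex in
lemma integral_prod_cexp_mul_gaussian {a : ι → ℝ} (ha : ∀ i, 0 < a i) (t : ι → ℝ) :
    ∫ w : ι → ℝ, ∏ i, (cexp (I * t i * w i) * cexp (-((4 * a i)⁻¹ : ℝ) * (w i : ℂ) ^ 2))
      = ((∏ i, √(4 * Real.pi * a i)) * Real.exp (-∑ i, a i * t i ^ 2) : ℝ) := by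
  rw [integral_fintype_prod_volume_eq_prod
    (fun i (w : ℝ) => cexp (I * t i * w) * cexp (-((4 * a i)⁻¹ : ℝ) * (w : ℂ) ^ 2)),
    ← Finset.sum_neg_distrib, Real.exp_sum, ← Finset.prod_mul_distrib, Complex.ofReal_prod]
  refine Finset.prod_congr rfl fun i _ => ?_
  have hai := ha i
  have hai' : (a i : ℂ) ≠ 0 := by exact_mod_cast hai.ne'
  rw [fourierIntegral_gaussian (by rw [Complex.ofReal_re]; positivity)]
  have hscale : (Real.pi : ℂ) / ((4 * a i)⁻¹ : ℝ) = ((4 * Real.pi * a i : ℝ) : ℂ) := by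
    push_cast; field_simp
  have hexponent : -(t i : ℂ) ^ 2 / (4 * ((4 * a i)⁻¹ : ℝ)) = ((-(a i * t i ^ 2) : ℝ) : ℂ) := by
    push_cast; field_simp
  have hsqrt : ((√(4 * Real.pi * a i) : ℝ) : ℂ) = ((4 * Real.pi * a i : ℝ) : ℂ) ^ (1 / 2 : ℂ) := by
    rw [Real.sqrt_eq_rpow, Complex.ofReal_cpow (by positivity)]
    norm_num
  rw [hscale, hexponent, ← hsqrt, ← Complex.ofReal_exp, ← Complex.ofReal_mul]

open Complex in
lemma integrable_prod_cexp_mul_gaussian {a : ι → ℝ} (ha : ∀ i, 0 < a i) (t : ι → ℝ) :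
    Integrable fun w : ι → ℝ =>
      ∏ i, (cexp (I * t i * w i) * cexp (-((4 * a i)⁻¹ : ℝ) * (w i : ℂ) ^ 2)) := by
  refine Integrable.fintype_prod
    (f := fun i (w : ℝ) => cexp (I * t i * w) * cexp (-((4 * a i)⁻¹ : ℝ) * (w : ℂ) ^ 2)) fun i => ?_
  have hai := ha i
  refine (integrable_cexp_quadratic (b := ((4 * a i)⁻¹ : ℝ))
    (by rw [Complex.ofReal_re]; positivity) (I * t i) 0).congr (Eventually.of_forall fun w => ?_)
  simp only [← Complex.exp_add]
  ring_nf

open Complex in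
lemma sq_norm_sum_mul_cexp (c φ : κ → ℝ) :
    ((‖∑ j, (c j : ℂ) * cexp (I * φ j)‖ ^ 2 : ℝ) : ℂ)
      = ∑ j, ∑ l, (c j * c l : ℂ) * cexp (I * (φ j - φ l : ℝ)) := by
  rw [Complex.ofReal_pow, ← Complex.mul_conj', map_sum, Finset.sum_mul_sum]
  refine Finset.sum_congr rfl fun j _ => Finset.sum_congr rfl fun l _ => ?_
  rw [map_mul, Complex.conj_ofReal, ← Complex.exp_conj, map_mul, Complex.conj_I,
    Complex.conj_ofReal, mul_mul_mul_comm, ← Complex.exp_add]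
  congr 2
  push_cast
  ring

open Complex in
lemma sq_norm_sum_mul_exp_eq_sum_prod (a : ι → ℝ) (y : κ → ι → ℝ) (c : κ → ℝ) (w : ι → ℝ) :
    ((‖∑ j, (c j : ℂ) * cexp (I * (∑ i, w i * y j i : ℝ))‖ ^ 2
        * Real.exp (-∑ i, (4 * a i)⁻¹ * w i ^ 2) : ℝ) : ℂ)
      = ∑ j, ∑ l, (c j * c l : ℂ) * ∏ i, (cexp (I * ((y j i - y l i : ℝ) : ℂ) * w i)
          * cexp (-((4 * a i)⁻¹ : ℝ) * (w i : ℂ) ^ 2)) := by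
  rw [Complex.ofReal_mul, sq_norm_sum_mul_cexp, Finset.sum_mul]
  refine Finset.sum_congr rfl fun j _ => ?_
  rw [Finset.sum_mul]
  refine Finset.sum_congr rfl fun l _ => ?_
  rw [Finset.prod_mul_distrib, ← Complex.exp_sum, ← Complex.exp_sum, Complex.ofReal_exp, mul_assoc]
  congr 3
  · rw [← Finset.sum_sub_distrib, Complex.ofReal_sum, Finset.mul_sum]
    refine Finset.sum_congr rfl fun i _ => ?_
    push_cast
    ring
  · simp [Finset.sum_neg_distrib]

section

variable {a : ι → ℝ} (ha : ∀ i, 0 < a i) (y : κ → ι → ℝ) (c : κ → ℝ)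
include ha

open Complex in
lemma integrable_sum_prod_cexp_mul_gaussian :
    Integrable fun w : ι → ℝ => ∑ j, ∑ l, (c j * c l : ℂ) *
      ∏ i, (cexp (I * ((y j i - y l i : ℝ) : ℂ) * w i)
        * cexp (-((4 * a i)⁻¹ : ℝ) * (w i : ℂ) ^ 2)) :=
  integrable_finsetSum _ fun j _ => integrable_finsetSum _ fun l _ =>
    (integrable_prod_cexp_mul_gaussian ha fun i => y j i - y l i).const_mul _

open Complex in
lemma integrable_sq_norm_mul_exp :
    Integrable fun w : ι → ℝ => ‖∑ j, (c j : ℂ) * cexp (I * (∑ i, w i * y j i : ℝ))‖ ^ 2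
      * Real.exp (-∑ i, (4 * a i)⁻¹ * w i ^ 2) :=
  ((integrable_sum_prod_cexp_mul_gaussian ha y c).congr (Eventually.of_forall fun w =>
    (sq_norm_sum_mul_exp_eq_sum_prod a y c w).symm)).re

open Complex in
lemma gaussQuad_eq_integral :
    (∏ i, √(4 * Real.pi * a i)) * gaussQuad a y c
      = ∫ w : ι → ℝ, ‖∑ j, (c j : ℂ) * cexp (I * (∑ i, w i * y j i : ℝ))‖ ^ 2
          * Real.exp (-∑ i, (4 * a i)⁻¹ * w i ^ 2) := by
  have hint := fun j l => (integrable_prod_cexp_mul_gaussian ha fun i => y j i - y l i).const_mul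
    (c j * c l : ℂ)
  apply Complex.ofReal_injective
  rw [← integral_complex_ofReal]
  simp_rw [sq_norm_sum_mul_exp_eq_sum_prod]
  rw [integral_finsetSum _ fun j _ => integrable_finsetSum _ fun l _ => hint j l]
  simp_rw [integral_finsetSum _ fun l _ => hint _ l, integral_const_mul,
    integral_prod_cexp_mul_gaussian ha]
  rw [gaussQuad, Complex.ofReal_mul, Complex.ofReal_sum, Finset.mul_sum]
  refine Finset.sum_congr rfl fun j _ => ?_
  rw [Complex.ofReal_sum, Finset.mul_sum]
  refine Finset.sum_congr rfl fun l _ => ?_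
  push_cast
  ring

lemma prod_sqrt_four_pi_mul_pos : 0 < ∏ i, √(4 * Real.pi * a i) :=
  Finset.prod_pos fun i _ => Real.sqrt_pos.2 (mul_pos (by positivity) (ha i))

lemma gaussQuad_nonneg : 0 ≤ gaussQuad a y c := by
  refine nonneg_of_mul_nonneg_right ?_ (prod_sqrt_four_pi_mul_pos ha)
  rw [gaussQuad_eq_integral ha]
  exact integral_nonneg fun w => by positivity

/-- The spectral density of a Gaussian kernel, multiplied by its normalization, increases with the
rates `a`. -/
lemma prod_sqrt_mul_gaussQuad_mono {b : ι → ℝ} (hab : ∀ i, a i ≤ b i) :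
    (∏ i, √(4 * Real.pi * a i)) * gaussQuad a y c
      ≤ (∏ i, √(4 * Real.pi * b i)) * gaussQuad b y c := by
  have hb : ∀ i, 0 < b i := fun i => (ha i).trans_le (hab i)
  rw [gaussQuad_eq_integral ha, gaussQuad_eq_integral hb]
  refine integral_mono (integrable_sq_norm_mul_exp ha y c) (integrable_sq_norm_mul_exp hb y c)
    fun w => ?_
  dsimp only
  gcongr with i
  · have := ha i
    positivity
  · exact hab i

lemma gaussQuad_div_sq_le {r : ι → ℝ} (hr : ∀ i, 1 ≤ r i) :
    gaussQuad (fun i => a i / r i ^ 2) y c ≤ (∏ i, r i) * gaussQuad a y c := by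
  have hr0 : ∀ i, 0 < r i := fun i => zero_lt_one.trans_le (hr i)
  have hpos : ∀ i, 0 < a i / r i ^ 2 := fun i => div_pos (ha i) (pow_pos (hr0 i) 2)
  have hprod : ∏ i, √(4 * Real.pi * a i)
      = (∏ i, r i) * ∏ i, √(4 * Real.pi * (a i / r i ^ 2)) := by
    rw [← Finset.prod_mul_distrib]
    refine Finset.prod_congr rfl fun i _ => ?_
    rw [← mul_div_assoc, Real.sqrt_div' _ (sq_nonneg _), Real.sqrt_sq (hr0 i).le,
      mul_div_cancel₀ _ (hr0 i).ne']
  refine le_of_mul_le_mul_left ?_ (prod_sqrt_four_pi_mul_pos hpos)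
  calc _ ≤ (∏ i, √(4 * Real.pi * a i)) * gaussQuad a y c :=
        prod_sqrt_mul_gaussQuad_mono hpos y c fun i =>
          div_le_self (ha i).le (one_le_pow₀ (hr i))
    _ = _ := by rw [hprod]; ring

end

end Gaussian

/-! ### The Matérn kernel as a mixture of Gaussian kernels -/

section Matern

/-- The unnormalized density of the Gamma distribution of shape `ν`. The Matérn kernel is the
mixture over `u` with this density of the Gaussian kernels `exp (-ν r² / (2 u))`. -/
def mixDensity (ν u : ℝ) : ℝ := Real.exp (-u) * u ^ (ν - 1)

/-- The Matérn kernel of smoothness `ν`, up to normalization, as a function of the squared scaled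
distance `q`. -/
def maternProfile (ν q : ℝ) : ℝ :=
  ∫ u in Set.Ioi (0 : ℝ), mixDensity ν u * Real.exp (-(ν / (2 * u) * q))

variable {ν : ℝ}

lemma mixDensity_nonneg {u : ℝ} (hu : 0 < u) : 0 ≤ mixDensity ν u := by
  unfold mixDensity
  positivity

lemma integrableOn_mixDensity (hν : 0 < ν) : IntegrableOn (mixDensity ν) (Set.Ioi 0) :=
  Real.GammaIntegral_convergent hν

lemma integral_mixDensity (hν : 0 < ν) : ∫ u in Set.Ioi 0, mixDensity ν u = Real.Gamma ν :=
  (Real.Gamma_eq_integral hν).symm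

lemma mixDensity_mul_exp_le (hν : 0 < ν) {q u : ℝ} (hq : 0 ≤ q) (hu : 0 < u) :
    mixDensity ν u * Real.exp (-(ν / (2 * u) * q)) ≤ mixDensity ν u :=
  mul_le_of_le_one_right (mixDensity_nonneg hu)
    (Real.exp_le_one_iff.2 (neg_nonpos.2 (by positivity)))

lemma integrableOn_maternProfile (hν : 0 < ν) {q : ℝ} (hq : 0 ≤ q) :
    IntegrableOn (fun u => mixDensity ν u * Real.exp (-(ν / (2 * u) * q))) (Set.Ioi 0) := by
  refine Integrable.mono' (integrableOn_mixDensity hν) ?_ ?_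
  · refine AEStronglyMeasurable.mul (integrableOn_mixDensity hν).aestronglyMeasurable ?_
    exact (by fun_prop : Measurable fun u : ℝ => Real.exp (-(ν / (2 * u) * q))).aestronglyMeasurable
  · refine (ae_restrict_mem measurableSet_Ioi).mono fun u hu => ?_
    rw [Real.norm_of_nonneg (mul_nonneg (mixDensity_nonneg hu) (Real.exp_pos _).le)]
    exact mixDensity_mul_exp_le hν hq hu

lemma maternProfile_zero (hν : 0 < ν) : maternProfile ν 0 = Real.Gamma ν := by
  simp [maternProfile, integral_mixDensity hν]

lemma maternProfile_nonneg (q : ℝ) : 0 ≤ maternProfile ν q :=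
  setIntegral_nonneg measurableSet_Ioi fun _ hu =>
    mul_nonneg (mixDensity_nonneg hu) (Real.exp_pos _).le

lemma maternProfile_le (hν : 0 < ν) {q : ℝ} (hq : 0 ≤ q) : maternProfile ν q ≤ Real.Gamma ν := by
  rw [← integral_mixDensity hν]
  exact setIntegral_mono_on (integrableOn_maternProfile hν hq) (integrableOn_mixDensity hν)
    measurableSet_Ioi fun u hu => mixDensity_mul_exp_le hν hq hu

lemma measurable_maternProfile : Measurable (maternProfile ν) := by
  have h : StronglyMeasurable (Function.uncurry fun q u : ℝ =>
      mixDensity ν u * Real.exp (-(ν / (2 * u) * q))) := by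
    refine Measurable.stronglyMeasurable ?_
    unfold mixDensity Function.uncurry
    fun_prop
  exact (h.integral_prod_right (ν := volume.restrict (Set.Ioi (0 : ℝ)))).measurable

lemma exp_neg_sub_exp_neg_le {A A' τ : ℝ} (hτ : 0 ≤ τ) (h : A' ≤ (1 + τ) * A) :
    Real.exp (-A) - Real.exp (-A') ≤ τ := by
  have hle_one : Real.exp (-A) * A ≤ 1 := by
    rw [Real.exp_neg, inv_mul_le_iff₀ (Real.exp_pos _)]
    linarith [Real.add_one_le_exp A]
  have hfactor : Real.exp (-A') = Real.exp (-A) * Real.exp (-(A' - A)) := by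
    rw [← Real.exp_add]
    ring_nf
  calc Real.exp (-A) - Real.exp (-A')
      = Real.exp (-A) * (1 - Real.exp (-(A' - A))) := by rw [hfactor]; ring
    _ ≤ Real.exp (-A) * (τ * A) := by
        gcongr
        linarith [Real.add_one_le_exp (-(A' - A))]
    _ = τ * (Real.exp (-A) * A) := by ring
    _ ≤ τ := mul_le_of_le_one_right hτ hle_one

lemma abs_exp_neg_sub_exp_neg_le {A A' τ : ℝ} (hτ : 0 ≤ τ) (h : A ≤ (1 + τ) * A')
    (h' : A' ≤ (1 + τ) * A) :
    |Real.exp (-A) - Real.exp (-A')| ≤ τ :=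
  abs_sub_le_iff.2 ⟨exp_neg_sub_exp_neg_le hτ h', exp_neg_sub_exp_neg_le hτ h⟩

lemma abs_maternProfile_sub_le (hν : 0 < ν) {q q' τ : ℝ} (hq : 0 ≤ q) (hq' : 0 ≤ q') (hτ : 0 ≤ τ)
    (h1 : q ≤ (1 + τ) * q') (h2 : q' ≤ (1 + τ) * q) :
    |maternProfile ν q - maternProfile ν q'| ≤ τ * Real.Gamma ν := by
  rw [maternProfile, maternProfile,
    ← integral_sub (integrableOn_maternProfile hν hq) (integrableOn_maternProfile hν hq'),
    ← integral_mixDensity hν, ← integral_const_mul, ← Real.norm_eq_abs]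
  refine norm_integral_le_of_norm_le ((integrableOn_mixDensity hν).const_mul τ) ?_
  refine (ae_restrict_mem measurableSet_Ioi).mono fun u (hu : 0 < u) => ?_
  rw [← mul_sub, norm_mul, Real.norm_of_nonneg (mixDensity_nonneg hu), mul_comm]
  refine mul_le_mul_of_nonneg_right
    (abs_exp_neg_sub_exp_neg_le hτ ?_ ?_) (mixDensity_nonneg hu)
  · rw [mul_left_comm]
    gcongr
  · rw [mul_left_comm]
    gcongr

variable {d m : ℕ}

lemma scaledDist_sq (grp : Fin d → Fin m) (θ : Fin m → ℝ) (x x' : EuclideanSpace ℝ (Fin d)) :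
    scaledDist grp θ x x' ^ 2 = ∑ i, ((x i - x' i) / θ (grp i)) ^ 2 :=
  Real.sq_sqrt (Finset.sum_nonneg fun _ _ => sq_nonneg _)

lemma besselK_sqrt_two_mul (hν : 0 < ν) (r : ℝ) :
    besselK ν (√(2 * ν) * r)
      = 1 / 2 * (√(2 * ν) * r / 2) ^ (-ν) * maternProfile ν (r ^ 2) := by
  rw [besselK, maternProfile]
  congr 1
  refine setIntegral_congr_fun measurableSet_Ioi fun u (hu : 0 < u) => ?_
  have hexponent : (√(2 * ν) * r) ^ 2 / (4 * u) = ν / (2 * u) * r ^ 2 := by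
    rw [mul_pow, Real.sq_sqrt (by positivity)]
    field_simp
    ring
  simp only [mixDensity]
  rw [hexponent, sub_eq_add_neg, Real.exp_add]
  ring

lemma matern_eq (hν : 0 < ν) (var : ℝ) (grp : Fin d → Fin m) (θ : Fin m → ℝ)
    (x x' : EuclideanSpace ℝ (Fin d)) :
    matern ν var grp θ x x'
      = var / Real.Gamma ν * maternProfile ν (∑ i, ((x i - x' i) / θ (grp i)) ^ 2) := by
  have := Real.Gamma_pos_of_pos hν
  rw [← scaledDist_sq]
  unfold matern
  split_ifs with h
  · rw [h, zero_pow two_ne_zero, maternProfile_zero hν]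
    field_simp
  · have hr : 0 < scaledDist grp θ x x' := lt_of_le_of_ne (Real.sqrt_nonneg _) (Ne.symm h)
    have hz : 0 < √(2 * ν) * scaledDist grp θ x x' := by positivity
    have := Real.rpow_pos_of_pos hz ν
    rw [besselK_sqrt_two_mul hν, Real.div_rpow hz.le zero_le_two, Real.rpow_neg hz.le,
      Real.rpow_neg zero_le_two, Real.rpow_sub zero_lt_two, Real.rpow_one]
    field_simp

lemma measurable_matern (hν : 0 < ν) (var : ℝ) (grp : Fin d → Fin m) (θ : Fin m → ℝ) :
    Measurable fun p : EuclideanSpace ℝ (Fin d) × EuclideanSpace ℝ (Fin d) =>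
      matern ν var grp θ p.1 p.2 := by
  simp_rw [matern_eq hν]
  refine Measurable.const_mul (measurable_maternProfile.comp ?_) _
  refine Finset.measurable_sum _ fun i _ => ?_
  have hi : Measurable fun y : EuclideanSpace ℝ (Fin d) => y i := by fun_prop
  exact (((hi.comp measurable_fst).sub (hi.comp measurable_snd)).div_const _).pow_const _

lemma gram_quad {E : Type} {n : ℕ} (k : E → E → ℝ) (x : Fin n → E) (c : Fin n → ℝ) :
    c ⬝ᵥ (gram k x).mulVec c = ∑ j, ∑ l, c j * c l * k (x j) (x l) := by
  simp only [dotProduct, Matrix.mulVec, gram, Matrix.of_apply, Finset.mul_sum]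
  exact Finset.sum_congr rfl fun j _ => Finset.sum_congr rfl fun l _ => by ring

/-- The quadratic form at `c` of the Gaussian component `u` of the Matérn kernel. -/
def mixQuad (ν : ℝ) (grp : Fin d → Fin m) (θ : Fin m → ℝ) {n : ℕ}
    (x : Fin n → EuclideanSpace ℝ (Fin d)) (c : Fin n → ℝ) (u : ℝ) : ℝ :=
  gaussQuad (fun i => ν / (2 * u) / θ (grp i) ^ 2) (fun j i => x j i) c

section MixQuad

variable {n : ℕ} (grp : Fin d → Fin m)

lemma mixDensity_mul_mixQuad (θ : Fin m → ℝ) (x : Fin n → EuclideanSpace ℝ (Fin d))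
    (c : Fin n → ℝ) (u : ℝ) :
    mixDensity ν u * mixQuad ν grp θ x c u = ∑ j, ∑ l, c j * c l * (mixDensity ν u *
      Real.exp (-(ν / (2 * u) * ∑ i, ((x j i - x l i) / θ (grp i)) ^ 2))) := by
  simp only [mixQuad, gaussQuad, Finset.mul_sum, mul_left_comm (mixDensity ν u)]
  refine Finset.sum_congr rfl fun j _ => Finset.sum_congr rfl fun l _ => ?_
  simp only [div_pow, mul_div_assoc', div_mul_eq_mul_div]

lemma mixQuad_div (θ : Fin m → ℝ) (x : Fin n → EuclideanSpace ℝ (Fin d)) (c : Fin n → ℝ)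
    {L : ℝ} (hL : L ≠ 0) (u : ℝ) :
    mixQuad ν grp (fun i => θ i / L) x c (L ^ 2 * u) = mixQuad ν grp θ x c u := by
  unfold mixQuad
  congr 1
  funext i
  rw [div_pow]
  field_simp

lemma mixQuad_nonneg (hν : 0 < ν) {θ : Fin m → ℝ} (hθ : ∀ i, 0 < θ i)
    (x : Fin n → EuclideanSpace ℝ (Fin d)) (c : Fin n → ℝ) {u : ℝ} (hu : 0 < u) :
    0 ≤ mixQuad ν grp θ x c u :=
  gaussQuad_nonneg (fun i => by have := hθ (grp i); positivity) _ c

lemma mixQuad_le_of_le (hν : 0 < ν) {θ θ' : Fin m → ℝ} (hθ : ∀ i, 0 < θ i)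
    (hle : ∀ i, θ i ≤ θ' i) (x : Fin n → EuclideanSpace ℝ (Fin d)) (c : Fin n → ℝ) {u : ℝ}
    (hu : 0 < u) :
    mixQuad ν grp θ' x c u ≤ (∏ i, θ' (grp i) / θ (grp i)) * mixQuad ν grp θ x c u := by
  have hθ' : ∀ i, 0 < θ' i := fun i => (hθ i).trans_le (hle i)
  have hrate : (fun i => ν / (2 * u) / θ' (grp i) ^ 2)
      = fun i => ν / (2 * u) / θ (grp i) ^ 2 / (θ' (grp i) / θ (grp i)) ^ 2 := by
    funext i
    have := hθ (grp i)
    have := hθ' (grp i)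
    field_simp
  rw [mixQuad, hrate]
  exact gaussQuad_div_sq_le (fun i => by have := hθ (grp i); positivity) _ c
    fun i => (one_le_div (hθ (grp i))).2 (hle (grp i))

variable (hν : 0 < ν)
include hν

lemma integrableOn_mixDensity_mul_mixQuad (θ : Fin m → ℝ)
    (x : Fin n → EuclideanSpace ℝ (Fin d)) (c : Fin n → ℝ) :
    IntegrableOn (fun u => mixDensity ν u * mixQuad ν grp θ x c u) (Set.Ioi 0) := by
  simp_rw [mixDensity_mul_mixQuad]
  exact integrable_finsetSum _ fun j _ => integrable_finsetSum _ fun l _ =>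
    (integrableOn_maternProfile hν (Finset.sum_nonneg fun _ _ => sq_nonneg _)).const_mul _

lemma matern_quad (var : ℝ) (θ : Fin m → ℝ) (x : Fin n → EuclideanSpace ℝ (Fin d))
    (c : Fin n → ℝ) :
    c ⬝ᵥ (gram (matern ν var grp θ) x).mulVec c = var / Real.Gamma ν *
      ∫ u in Set.Ioi (0 : ℝ), mixDensity ν u * mixQuad ν grp θ x c u := by
  have hint : ∀ j l, IntegrableOn (fun u => c j * c l * (mixDensity ν u *
      Real.exp (-(ν / (2 * u) * ∑ i, ((x j i - x l i) / θ (grp i)) ^ 2)))) (Set.Ioi 0) :=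
    fun j l =>
      (integrableOn_maternProfile hν (Finset.sum_nonneg fun _ _ => sq_nonneg _)).const_mul _
  simp_rw [gram_quad, mixDensity_mul_mixQuad]
  rw [integral_finsetSum _ fun j _ => integrable_finsetSum _ fun l _ => hint j l]
  simp_rw [integral_finsetSum _ fun l _ => hint _ l, integral_const_mul, matern_eq hν]
  simp only [maternProfile, Finset.mul_sum (a := var / Real.Gamma ν), mul_left_comm]

end MixQuad

lemma matern_psd (hν : 0 < ν) {var : ℝ} (hvar : 0 ≤ var) (grp : Fin d → Fin m) {θ : Fin m → ℝ}
    (hθ : ∀ i, 0 < θ i) : IsPSDKernel (matern ν var grp θ) := by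
  have := Real.Gamma_pos_of_pos hν
  intro n x
  refine Matrix.PosSemidef.of_dotProduct_mulVec_nonneg ?_ fun c => ?_
  · ext i j
    simp only [Matrix.conjTranspose_apply, gram, Matrix.of_apply, star_trivial, matern_eq hν]
    congr 2
    exact Finset.sum_congr rfl fun l _ => by ring
  · rw [star_trivial, matern_quad grp hν]
    refine mul_nonneg (by positivity) (setIntegral_nonneg measurableSet_Ioi fun u hu => ?_)
    exact mul_nonneg (mixDensity_nonneg hu) (mixQuad_nonneg grp hν hθ x c hu)

lemma KernelLE.trans {E : Type} {k₁ k₂ k₃ : E → E → ℝ} {b b' : ℝ} (h : KernelLE k₁ k₂ b)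
    (h' : KernelLE k₂ k₃ b') (hb : 0 ≤ b) : KernelLE k₁ k₃ (b * b') := fun n x c =>
  (h n x c).trans ((mul_le_mul_of_nonneg_left (h' n x c) hb).trans_eq (mul_assoc _ _ _).symm)

lemma KernelLE.mono {E : Type} {a k : E → E → ℝ} {b b' : ℝ} (h : KernelLE a k b)
    (hk : IsPSDKernel k) (hb : b ≤ b') : KernelLE a k b' := fun n x c =>
  (h n x c).trans (mul_le_mul_of_nonneg_right hb (hk.quad_nonneg x c))

section KernelLE

variable (hν : 0 < ν) {var : ℝ} (hvar : 0 ≤ var) (grp : Fin d → Fin m) {θ θ' : Fin m → ℝ}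
  (hθ : ∀ i, 0 < θ i)
include hν hvar hθ

lemma matern_kernelLE_of_le (hle : ∀ i, θ i ≤ θ' i) :
    KernelLE (matern ν var grp θ') (matern ν var grp θ) (∏ i, θ' (grp i) / θ (grp i)) := by
  intro n x c
  have := Real.Gamma_pos_of_pos hν
  rw [matern_quad grp hν, matern_quad grp hν, mul_left_comm,
    ← integral_const_mul (∏ i, θ' (grp i) / θ (grp i))]
  refine mul_le_mul_of_nonneg_left ?_ (by positivity)
  refine setIntegral_mono_on (integrableOn_mixDensity_mul_mixQuad grp hν θ' x c)
    ((integrableOn_mixDensity_mul_mixQuad grp hν θ x c).const_mul _) measurableSet_Ioi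
    fun u hu => ?_
  rw [mul_left_comm]
  exact mul_le_mul_of_nonneg_left (mixQuad_le_of_le grp hν hθ hle x c hu) (mixDensity_nonneg hu)

omit hν hvar hθ in
lemma mixDensity_mul_le {s v : ℝ} (hs : 1 ≤ s) (hv : 0 < v) :
    s * mixDensity ν (s * v) ≤ s ^ ν * mixDensity ν v := by
  have hs0 : 0 < s := zero_lt_one.trans_le hs
  have hpow : s * (s * v) ^ (ν - 1) = s ^ ν * v ^ (ν - 1) := by
    rw [Real.mul_rpow hs0.le hv.le, Real.rpow_sub_one hs0.ne']
    field_simp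
  calc s * mixDensity ν (s * v) = Real.exp (-(s * v)) * (s ^ ν * v ^ (ν - 1)) := by
        rw [mixDensity, mul_left_comm, hpow]
    _ ≤ Real.exp (-v) * (s ^ ν * v ^ (ν - 1)) := by
        gcongr
        exact le_mul_of_one_le_left hv.le hs
    _ = s ^ ν * mixDensity ν v := by rw [mixDensity, mul_left_comm]

/-- Dividing the lengthscales by `L` rescales the mixing variable by `L²`. -/
lemma matern_kernelLE_div {L : ℝ} (hL : 1 ≤ L) :
    KernelLE (matern ν var grp fun i => θ i / L) (matern ν var grp θ) ((L ^ 2) ^ ν) := by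
  intro n x c
  have := Real.Gamma_pos_of_pos hν
  have hL0 : 0 < L := zero_lt_one.trans_le hL
  have hsubst := integral_comp_mul_left_Ioi
    (fun u => mixDensity ν u * mixQuad ν grp (fun i => θ i / L) x c u) 0 (b := L ^ 2)
    (by positivity)
  rw [mul_zero, smul_eq_mul, eq_inv_mul_iff_mul_eq₀ (by positivity)] at hsubst
  simp_rw [mixQuad_div grp θ x c hL0.ne'] at hsubst
  rw [matern_quad grp hν, matern_quad grp hν, mul_left_comm, ← hsubst, ← integral_const_mul (L ^ 2),
    ← integral_const_mul ((L ^ 2) ^ ν)]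
  refine mul_le_mul_of_nonneg_left (integral_mono_of_nonneg ?_
    ((integrableOn_mixDensity_mul_mixQuad grp hν θ x c).const_mul _) ?_) (by positivity)
  · refine (ae_restrict_mem measurableSet_Ioi).mono fun v (hv : 0 < v) => ?_
    exact mul_nonneg (by positivity) (mul_nonneg (mixDensity_nonneg (by positivity))
      (mixQuad_nonneg grp hν hθ x c hv))
  · refine (ae_restrict_mem measurableSet_Ioi).mono fun v hv => ?_
    simp only [← mul_assoc]
    exact mul_le_mul_of_nonneg_right (mixDensity_mul_le (one_le_pow₀ hL) hv)
      (mixQuad_nonneg grp hν hθ x c hv)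

lemma matern_kernelLE {L : ℝ} (hL : 1 ≤ L) (h1 : ∀ i, θ i ≤ L * θ' i)
    (h2 : ∀ i, θ' i ≤ L * θ i) :
    KernelLE (matern ν var grp θ') (matern ν var grp θ) ((L ^ 2) ^ d * (L ^ 2) ^ ν) := by
  have hL0 : 0 < L := zero_lt_one.trans_le hL
  have hdiv : ∀ i, 0 < θ i / L := fun i => div_pos (hθ i) hL0
  have hle : ∀ i, θ i / L ≤ θ' i := fun i => (div_le_iff₀' hL0).2 (h1 i)
  have hratio : ∀ i, 0 ≤ θ' (grp i) / (θ (grp i) / L) := fun i =>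
    div_nonneg ((hdiv _).le.trans (hle _)) (hdiv _).le
  refine ((matern_kernelLE_of_le hν hvar grp hdiv hle).trans
    (matern_kernelLE_div hν hvar grp hθ hL) (Finset.prod_nonneg fun i _ => hratio i)).mono
    (matern_psd hν hvar grp hθ) (mul_le_mul_of_nonneg_right ?_ (by positivity))
  calc ∏ i, θ' (grp i) / (θ (grp i) / L) ≤ ∏ _i : Fin d, L ^ 2 := by
        refine Finset.prod_le_prod (fun i _ => hratio i) fun i _ => ?_
        rw [div_le_iff₀ (hdiv _)]
        calc θ' (grp i) ≤ L * θ (grp i) := h2 _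
          _ = L ^ 2 * (θ (grp i) / L) := by field_simp
    _ = (L ^ 2) ^ d := by simp

end KernelLE

end Matern

/-! ### The kernel family -/

section Grid

variable {ι : Type*} [Fintype ι]

lemma abs_sub_le_of_natFloor_div_eq {u v h : ℝ} (hu : 0 ≤ u) (hv : 0 ≤ v) (hh : 0 < h)
    (huv : ⌊u / h⌋₊ = ⌊v / h⌋₊) : |u - v| ≤ h := by
  have hu_floor := Nat.floor_le (div_nonneg hu hh.le)
  have hv_floor := Nat.floor_le (div_nonneg hv hh.le)
  have hu_lt := Nat.lt_floor_add_one (u / h)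
  have hv_lt := Nat.lt_floor_add_one (v / h)
  rw [huv] at hu_floor hu_lt
  have hdiv : |u / h - v / h| ≤ 1 := abs_le.2 ⟨by linarith, by linarith⟩
  rwa [← sub_div, abs_div, abs_of_pos hh, div_le_one hh] at hdiv

/-- One point is kept in each cell of a grid of mesh `h` that meets `S`. -/
lemma exists_finset_subset_forall_abs_sub_le {S : Set (ι → ℝ)} {r h : ℝ} (hr : 0 ≤ r)
    (hS : ∀ θ ∈ S, ∀ i, 0 ≤ θ i ∧ θ i ≤ r) (hh : 0 < h) :
    ∃ s : Finset (ι → ℝ), ↑s ⊆ S ∧ (∀ θ ∈ S, ∃ θ' ∈ s, ∀ i, |θ i - θ' i| ≤ h) ∧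
      (s.card : ℝ) ≤ (r / h + 1) ^ Fintype.card ι := by
  classical
  let cell : (ι → ℝ) → ι → ℕ := fun θ i => ⌊θ i / h⌋₊
  let cells := Fintype.piFinset fun _ : ι => Finset.range (⌊r / h⌋₊ + 1)
  have hcell : cell '' S ⊆ cells := by
    rintro _ ⟨θ, hθ, rfl⟩
    simp only [cells, Finset.mem_coe, Fintype.mem_piFinset, Finset.mem_range]
    intro i
    exact Nat.lt_succ_of_le (Nat.floor_mono (div_le_div_of_nonneg_right (hS θ hθ i).2 hh.le))
  obtain ⟨s, hsS, hs⟩ := Set.exists_subset_bijOn S cell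
  have hfin : s.Finite := (Set.finite_image_iff hs.injOn).1
    (hs.image_eq ▸ cells.finite_toSet.subset hcell)
  refine ⟨hfin.toFinset, by simpa using hsS, fun θ hθ => ?_, ?_⟩
  · obtain ⟨θ', hθ', heq⟩ := hs.surjOn ⟨θ, hθ, rfl⟩
    exact ⟨θ', hfin.mem_toFinset.2 hθ', fun i => abs_sub_le_of_natFloor_div_eq (hS θ hθ i).1
      (hS θ' (hsS hθ') i).1 hh (congrFun heq i).symm⟩
  · have hcard : hfin.toFinset.card ≤ cells.card := by
      refine Finset.card_le_card_of_injOn cell (fun θ hθ => ?_) (by simpa using hs.injOn)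
      exact hcell ⟨θ, hsS (by simpa using hθ), rfl⟩
    have hcells : cells.card = (⌊r / h⌋₊ + 1) ^ Fintype.card ι := by simp [cells]
    rw [hcells] at hcard
    calc (hfin.toFinset.card : ℝ) ≤ ((⌊r / h⌋₊ : ℝ) + 1) ^ Fintype.card ι := by
          exact_mod_cast hcard
      _ ≤ (r / h + 1) ^ Fintype.card ι := by
          gcongr
          exact Nat.floor_le (div_nonneg hr hh.le)

end Grid

section Family

variable {d m : ℕ} {P : Problem d m} {σ : ℝ}

variable (P) in
lemma Problem.exists_bounds :
    ∃ lo hi : ℝ, 0 < lo ∧ lo ≤ hi ∧ ∀ θ ∈ P.Θ, ∀ i, lo ≤ θ i ∧ θ i ≤ hi := by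
  have hcoord : ∀ i : Fin m, ∃ lo hi : ℝ, 0 < lo ∧ ∀ θ ∈ P.Θ, lo ≤ θ i ∧ θ i ≤ hi := by
    intro i
    have hc : ContinuousOn (fun θ : Fin m → ℝ => θ i) P.Θ := (continuous_apply i).continuousOn
    obtain ⟨a, ha, hmin⟩ := P.Θ_compact.exists_isMinOn P.Θ_nonempty hc
    obtain ⟨b, -, hmax⟩ := P.Θ_compact.exists_isMaxOn P.Θ_nonempty hc
    exact ⟨a i, b i, P.Θ_pos a ha i, fun θ hθ => ⟨hmin hθ, hmax hθ⟩⟩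
  choose lo hi hlo hbounds using hcoord
  obtain ⟨l, hl0, hl⟩ : ∃ l : ℝ, 0 < l ∧ ∀ i, l ≤ lo i := by
    rcases isEmpty_or_nonempty (Fin m) with hempty | _
    · exact ⟨1, one_pos, fun i => hempty.elim i⟩
    · obtain ⟨i, hi⟩ := Finite.exists_min lo
      exact ⟨lo i, hlo i, hi⟩
  obtain ⟨u, hu⟩ := (Set.finite_range hi).bddAbove
  exact ⟨l, max l u, hl0, le_max_left _ _, fun θ hθ i => ⟨(hl i).trans (hbounds i θ hθ).1,
    ((hbounds i θ hθ).2.trans (hu ⟨i, rfl⟩)).trans (le_max_right _ _)⟩⟩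

lemma Problem.ker_psd {θ : Fin m → ℝ} (hθ : θ ∈ P.Θ) : IsPSDKernel (P.ker θ) :=
  matern_psd P.ν_pos P.var_pos.le P.grp (P.Θ_pos θ hθ)

lemma Problem.ker_nonneg (θ : Fin m → ℝ) (x x' : EuclideanSpace ℝ (Fin d)) :
    0 ≤ P.ker θ x x' := by
  have := Real.Gamma_pos_of_pos P.ν_pos
  have := P.var_pos
  rw [Problem.ker, matern_eq P.ν_pos]
  exact mul_nonneg (by positivity) (maternProfile_nonneg _)

lemma Problem.ker_le_one (θ : Fin m → ℝ) (x x' : EuclideanSpace ℝ (Fin d)) :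
    P.ker θ x x' ≤ 1 := by
  have hΓ := Real.Gamma_pos_of_pos P.ν_pos
  rw [Problem.ker, matern_eq P.ν_pos]
  calc _ ≤ P.var / Real.Gamma P.ν * Real.Gamma P.ν :=
        mul_le_mul_of_nonneg_left (maternProfile_le P.ν_pos
          (Finset.sum_nonneg fun _ _ => sq_nonneg _)) (div_nonneg P.var_pos.le hΓ.le)
    _ = P.var := div_mul_cancel₀ _ hΓ.ne'
    _ ≤ 1 := P.var_le_one

lemma Problem.ker_self_le_sq (hσ : 1 ≤ σ) (θ : Fin m → ℝ) (x : EuclideanSpace ℝ (Fin d)) :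
    P.ker θ x x ≤ σ ^ 2 :=
  (P.ker_le_one θ x x).trans (one_le_pow₀ hσ)

lemma Problem.measurable_ker (θ : Fin m → ℝ) :
    Measurable fun p : EuclideanSpace ℝ (Fin d) × EuclideanSpace ℝ (Fin d) => P.ker θ p.1 p.2 :=
  measurable_matern P.ν_pos P.var P.grp θ

variable (P) in
lemma Problem.exists_kernelLE :
    ∃ b : ℝ, 1 ≤ b ∧ ∀ θ ∈ P.Θ, ∀ θ' ∈ P.Θ, KernelLE (P.ker θ') (P.ker θ) b := by
  obtain ⟨lo, hi, hlo, hle, hbounds⟩ := P.exists_bounds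
  have hL : 1 ≤ hi / lo := (one_le_div hlo).2 hle
  have hcmp : ∀ θ ∈ P.Θ, ∀ θ' ∈ P.Θ, ∀ i, θ i ≤ hi / lo * θ' i := by
    intro θ hθ θ' hθ' i
    calc θ i ≤ hi := (hbounds θ hθ i).2
      _ = hi / lo * lo := by field_simp
      _ ≤ hi / lo * θ' i :=
          mul_le_mul_of_nonneg_left (hbounds θ' hθ' i).1 (zero_le_one.trans hL)
  refine ⟨((hi / lo) ^ 2) ^ d * ((hi / lo) ^ 2) ^ P.ν, ?_, fun θ hθ θ' hθ' => ?_⟩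
  · have hL2 : 1 ≤ (hi / lo) ^ 2 := one_le_pow₀ hL
    exact one_le_mul_of_one_le_of_one_le (one_le_pow₀ hL2) (Real.one_le_rpow hL2 P.ν_pos.le)
  · exact matern_kernelLE P.ν_pos P.var_pos.le P.grp (P.Θ_pos θ hθ) hL
      (hcmp θ hθ θ' hθ') (hcmp θ' hθ' θ hθ)

lemma abs_matern_sub_le {ν : ℝ} (hν : 0 < ν) {var : ℝ} (hvar : 0 ≤ var) (grp : Fin d → Fin m)
    {θ θ' : Fin m → ℝ} (x x' : EuclideanSpace ℝ (Fin d)) {τ : ℝ} (hτ : 0 ≤ τ)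
    (h : ∀ i, ((x i - x' i) / θ (grp i)) ^ 2 ≤ (1 + τ) * ((x i - x' i) / θ' (grp i)) ^ 2)
    (h' : ∀ i, ((x i - x' i) / θ' (grp i)) ^ 2 ≤ (1 + τ) * ((x i - x' i) / θ (grp i)) ^ 2) :
    |matern ν var grp θ x x' - matern ν var grp θ' x x'| ≤ var * τ := by
  have := Real.Gamma_pos_of_pos hν
  have hsum : ∀ θ : Fin m → ℝ, 0 ≤ ∑ i, ((x i - x' i) / θ (grp i)) ^ 2 :=
    fun θ => Finset.sum_nonneg fun _ _ => sq_nonneg _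
  rw [matern_eq hν, matern_eq hν, ← mul_sub, abs_mul, abs_of_nonneg (by positivity)]
  calc _ ≤ var / Real.Gamma ν * (τ * Real.Gamma ν) := by
        gcongr
        refine abs_maternProfile_sub_le hν (hsum θ) (hsum θ') hτ ?_ ?_ <;> rw [Finset.mul_sum]
        exacts [Finset.sum_le_sum fun i _ => h i, Finset.sum_le_sum fun i _ => h' i]
    _ = var * τ := by field_simp

lemma div_sq_le_one_add_mul_div_sq {lo hi u v h : ℝ} (hlo : 0 < lo) (hu : lo ≤ u) (hu' : u ≤ hi)
    (hv : lo ≤ v) (hv' : v ≤ hi) (hh : 0 ≤ h) (hvu : v - u ≤ h) (t : ℝ) :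
    (t / u) ^ 2 ≤ (1 + 2 * hi / lo ^ 2 * h) * (t / v) ^ 2 := by
  have hu0 : 0 < u := hlo.trans_le hu
  have hv0 : 0 < v := hlo.trans_le hv
  have hhi : 0 < hi := hu0.trans_le hu'
  have hsq : v ^ 2 ≤ (1 + 2 * hi / lo ^ 2 * h) * u ^ 2 := by
    calc v ^ 2 = u ^ 2 + (v - u) * (v + u) := by ring
      _ ≤ u ^ 2 + h * (2 * hi) := by
          gcongr
          linarith
      _ = u ^ 2 + 2 * hi / lo ^ 2 * h * lo ^ 2 := by field_simp
      _ ≤ u ^ 2 + 2 * hi / lo ^ 2 * h * u ^ 2 := by gcongr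
      _ = _ := by ring
  rw [div_pow, div_pow, ← mul_div_assoc, div_le_div_iff₀ (by positivity) (by positivity)]
  calc t ^ 2 * v ^ 2 ≤ t ^ 2 * ((1 + 2 * hi / lo ^ 2 * h) * u ^ 2) := by gcongr
    _ = _ := by ring

variable (P) in
lemma Problem.exists_kdist_le :
    ∃ K : ℝ, 0 < K ∧ ∀ θ ∈ P.Θ, ∀ θ' ∈ P.Θ, ∀ h : ℝ, 0 ≤ h → (∀ i, |θ i - θ' i| ≤ h) →
      P.kdist θ θ' ≤ K * h := by
  obtain ⟨lo, hi, hlo, hle, hb⟩ := P.exists_bounds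
  have hhi : 0 < hi := hlo.trans_le hle
  refine ⟨2 * hi / lo ^ 2, by positivity, fun θ hθ θ' hθ' h hh hd => ?_⟩
  have hτ : 0 ≤ 2 * hi / lo ^ 2 * h := by positivity
  refine Real.iSup_le (fun q => ?_) hτ
  refine (abs_matern_sub_le P.ν_pos P.var_pos.le P.grp q.1.1 q.2.1 hτ (fun i => ?_)
    fun i => ?_).trans (mul_le_of_le_one_left hτ P.var_le_one)
  · exact div_sq_le_one_add_mul_div_sq hlo (hb θ hθ _).1 (hb θ hθ _).2 (hb θ' hθ' _).1
      (hb θ' hθ' _).2 hh (by linarith [(abs_le.1 (hd (P.grp i))).1]) _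
  · exact div_sq_le_one_add_mul_div_sq hlo (hb θ' hθ' _).1 (hb θ' hθ' _).2 (hb θ hθ _).1
      (hb θ hθ _).2 hh (abs_le.1 (hd (P.grp i))).2 _

lemma Problem.abs_ker_sub_le (θ θ' : Fin m → ℝ) {x x' : EuclideanSpace ℝ (Fin d)} (hx : x ∈ P.X)
    (hx' : x' ∈ P.X) : |P.ker θ x x' - P.ker θ' x x'| ≤ P.kdist θ θ' := by
  refine le_ciSup (f := fun q : P.X × P.X => |P.ker θ q.1 q.2 - P.ker θ' q.1 q.2|) ⟨1, ?_⟩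
    (⟨⟨x, hx⟩, ⟨x', hx'⟩⟩ : P.X × P.X)
  rintro _ ⟨q, rfl⟩
  exact abs_sub_le_iff.2
    ⟨by linarith [P.ker_nonneg θ' q.1 q.2, P.ker_le_one θ q.1 q.2],
      by linarith [P.ker_nonneg θ q.1 q.2, P.ker_le_one θ' q.1 q.2]⟩

variable (P) in
lemma Problem.exists_net :
    ∃ K : ℝ, 1 ≤ K ∧ ∀ ε : ℝ, 0 < ε → ε ≤ 1 →
      ∃ s : Finset (Fin m → ℝ), P.IsNet ε ↑s ∧ (s.card : ℝ) ≤ (K / ε) ^ m := by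
  obtain ⟨lo, hi, hlo, hle, hb⟩ := P.exists_bounds
  obtain ⟨K, hK, hlip⟩ := P.exists_kdist_le
  have hhi : 0 < hi := hlo.trans_le hle
  refine ⟨hi * K + 1, le_add_of_nonneg_left (by positivity), fun ε hε hε1 => ?_⟩
  obtain ⟨s, hsub, hcover, hcard⟩ := exists_finset_subset_forall_abs_sub_le hhi.le
    (fun θ hθ i => ⟨hlo.le.trans (hb θ hθ i).1, (hb θ hθ i).2⟩) (div_pos hε hK)
  refine ⟨s, ⟨hsub, fun θ hθ => ?_⟩, hcard.trans ?_⟩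
  · obtain ⟨θ', hθ', hclose⟩ := hcover θ hθ
    have hdist := hlip θ hθ θ' (hsub hθ') (ε / K) (div_pos hε hK).le hclose
    exact ⟨θ', hθ', hdist.trans_eq (mul_div_cancel₀ ε hK.ne')⟩
  · rw [Fintype.card_fin, div_div_eq_mul_div, add_div]
    have hone : 1 ≤ 1 / ε := (one_le_div hε).2 hε1
    gcongr

lemma Problem.exists_min_net {ε : ℝ} (hε : 0 < ε) (hε1 : ε ≤ 1) :
    ∃ s : Finset (Fin m → ℝ), P.IsNet ε ↑s ∧ s.card = P.covNum ε := by
  obtain ⟨K, -, h⟩ := P.exists_net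
  obtain ⟨s, hs, -⟩ := h ε hε hε1
  exact Nat.sInf_mem (s := {n : ℕ | ∃ s : Finset (Fin m → ℝ), P.IsNet ε ↑s ∧ s.card = n})
    ⟨s.card, s, hs, rfl⟩

lemma Problem.one_le_covNum {ε : ℝ} (hε : 0 < ε) (hε1 : ε ≤ 1) : 1 ≤ P.covNum ε := by
  obtain ⟨s, hs, hcard⟩ := P.exists_min_net hε hε1
  obtain ⟨θ, hθ⟩ := P.Θ_nonempty
  obtain ⟨θ', hθ', -⟩ := hs.2 θ hθ
  rw [← hcard]
  exact Finset.card_pos.2 ⟨θ', hθ'⟩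

variable (P) in
lemma Problem.exists_covNum_le :
    ∃ K : ℝ, 1 ≤ K ∧ ∀ ε : ℝ, 0 < ε → ε ≤ 1 → (P.covNum ε : ℝ) ≤ (K / ε) ^ m := by
  obtain ⟨K, hK, h⟩ := P.exists_net
  refine ⟨K, hK, fun ε hε hε1 => ?_⟩
  obtain ⟨s, hs, hcard⟩ := h ε hε hε1
  have hmin : P.covNum ε ≤ s.card := Nat.sInf_le ⟨s, hs, rfl⟩
  exact le_trans (by exact_mod_cast hmin) hcard

section Gain

lemma Problem.gain_nonneg (hσ : 0 < σ) (n : ℕ) {θ : Fin m → ℝ} (hθ : θ ∈ P.Θ) :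
    0 ≤ P.gain σ n θ :=
  maxInfoGain_nonneg (P.ker_psd hθ) hσ _ _

lemma Problem.supGain_nonneg (hσ : 0 < σ) (n : ℕ) : 0 ≤ P.supGain σ n :=
  Real.iSup_nonneg fun θ => P.gain_nonneg hσ n θ.2

variable (hσ : 1 ≤ σ)
include hσ

lemma Problem.gain_le (n : ℕ) {θ : Fin m → ℝ} (hθ : θ ∈ P.Θ) : P.gain σ n θ ≤ n / 2 :=
  maxInfoGain_le (P.ker_psd hθ) (zero_lt_one.trans_le hσ) (P.ker_self_le_sq hσ θ) _ _

lemma Problem.gain_le_supGain (n : ℕ) {θ : Fin m → ℝ} (hθ : θ ∈ P.Θ) :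
    P.gain σ n θ ≤ P.supGain σ n := by
  refine le_ciSup (f := fun θ : P.Θ => P.gain σ n θ) ⟨n / 2, ?_⟩ ⟨θ, hθ⟩
  rintro _ ⟨θ, rfl⟩
  exact P.gain_le hσ n θ.2

lemma Problem.infoGain_le_gain {n : ℕ} {θ : Fin m → ℝ} (hθ : θ ∈ P.Θ)
    (x : Fin n → EuclideanSpace ℝ (Fin d)) (hx : ∀ i, x i ∈ P.X) :
    infoGain (P.ker θ) σ x ≤ P.gain σ n θ :=
  infoGain_le_maxInfoGain (P.ker_psd hθ) (zero_lt_one.trans_le hσ) (P.ker_self_le_sq hσ θ) x hx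

lemma Problem.infoGain_le_supGain {n : ℕ} {θ : Fin m → ℝ} (hθ : θ ∈ P.Θ)
    (x : Fin n → EuclideanSpace ℝ (Fin d)) (hx : ∀ i, x i ∈ P.X) :
    infoGain (P.ker θ) σ x ≤ P.supGain σ n :=
  (P.infoGain_le_gain hσ hθ x hx).trans (P.gain_le_supGain hσ n hθ)

lemma Problem.supGain_mono : Monotone (P.supGain σ) := fun _ _ hnn' =>
  Real.iSup_le (fun θ => (maxInfoGain_mono (P.ker_psd θ.2) (zero_lt_one.trans_le hσ)
    (P.ker_self_le_sq hσ θ) P.X_nonempty hnn').trans (P.gain_le_supGain hσ _ θ.2))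
    (P.supGain_nonneg (zero_lt_one.trans_le hσ) _)

end Gain

end Family

open Matrix in
lemma InRKHSBall.sq_dotProduct_le {E : Type} {X : Set E} {k : E → E → ℝ} {B : ℝ} {f : E → ℝ}
    (hf : InRKHSBall X k B f) {n : ℕ} (x : Fin n → E) (hx : ∀ i, x i ∈ X) (c : Fin n → ℝ) :
    (c ⬝ᵥ fun i => f (x i)) ^ 2 ≤ B ^ 2 * (c ⬝ᵥ gram k x *ᵥ c) := by
  obtain ⟨H, _, _, _, _, hker, h, hh, hn⟩ := hf
  let g : H := ∑ j, c j • RKHS.kerFun H (⟨x j, hx j⟩ : X) (1 : ℝ)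
  have inner_g : inner ℝ g h = c ⬝ᵥ fun i => f (x i) := by
    simp only [g, sum_inner, real_inner_smul_left, RKHS.kerFun_inner, dotProduct]
    refine Finset.sum_congr rfl fun j _ => ?_
    rw [hh]
    simp
  have norm_g : ‖g‖ ^ 2 = c ⬝ᵥ gram k x *ᵥ c := by
    rw [← real_inner_self_eq_norm_sq, gram_quad]
    simp only [g, sum_inner, inner_sum, real_inner_smul_left, real_inner_smul_right,
      RKHS.kerFun_inner, RKHS.kerFun_apply]
    rw [Finset.sum_comm]
    refine Finset.sum_congr rfl fun j _ => Finset.sum_congr rfl fun l _ => ?_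
    rw [hker]
    simp
    ring
  rw [← inner_g, ← norm_g, ← sq_abs, ← mul_pow, mul_comm B]
  gcongr
  exact (abs_real_inner_le_norm g h).trans (by gcongr)

/-! ### Conditionally sub-Gaussian noise and the method of mixtures -/

section SubGaussian

open scoped ENNReal NNReal

variable {Ω : Type*} {m mΩ : MeasurableSpace Ω} {μ : Measure Ω} {e : Ω → ℝ} {R σ : ℝ}

/-- Conditional sub-Gaussianity of `e` given `m`, with variance proxy `R ^ 2`. It is stated through
conditional expectations because `ProbabilityTheory.HasCondSubgaussianMGF` is only available on
standard Borel spaces. -/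
structure CondSubgaussian (m : MeasurableSpace Ω) {mΩ : MeasurableSpace Ω} (μ : Measure Ω)
    (e : Ω → ℝ) (R : ℝ) : Prop where
  integrable_exp_mul : ∀ s : ℝ, Integrable (fun ω => Real.exp (s * e ω)) μ
  condExp_exp_le : ∀ s : ℝ,
    μ[fun ω => Real.exp (s * e ω) | m] ≤ᵐ[μ] fun _ => Real.exp (s ^ 2 * R ^ 2 / 2)

lemma CondSubgaussian.mono {R' : ℝ} (h : CondSubgaussian m μ e R) (hR : 0 ≤ R) (hRR' : R ≤ R') :
    CondSubgaussian m μ e R' where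
  integrable_exp_mul := h.integrable_exp_mul
  condExp_exp_le s := by
    filter_upwards [h.condExp_exp_le s] with ω hω
    exact hω.trans (Real.exp_le_exp.2 (by gcongr))

lemma CondSubgaussian.hasSubgaussianMGF [IsProbabilityMeasure μ] (h : CondSubgaussian m μ e R)
    (hm : m ≤ mΩ) : HasSubgaussianMGF e (R ^ 2).toNNReal μ where
  integrable_exp_mul := h.integrable_exp_mul
  mgf_le s := by
    rw [mgf, ← integral_condExp hm, Real.coe_toNNReal _ (sq_nonneg R), mul_comm (R ^ 2)]
    simpa using integral_mono_ae integrable_condExp (integrable_const _) (h.condExp_exp_le s)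

lemma measure_mul_sqrt_lt_abs_le [IsFiniteMeasure μ] (hR : 0 < R)
    (he : HasSubgaussianMGF e (R ^ 2).toNNReal μ) {l : ℝ} (hl : 0 ≤ l) :
    μ {ω | R * √(2 * l) < |e ω|} ≤ ENNReal.ofReal (2 * Real.exp (-l)) := by
  have upper_tail : ∀ {g : Ω → ℝ}, HasSubgaussianMGF g (R ^ 2).toNNReal μ →
      μ {ω | R * √(2 * l) ≤ g ω} ≤ ENNReal.ofReal (Real.exp (-l)) := by
    intro g hg
    rw [← ofReal_measureReal]
    refine ENNReal.ofReal_le_ofReal ((hg.measure_ge_le (by positivity)).trans_eq ?_)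
    rw [Real.coe_toNNReal _ (sq_nonneg R), mul_pow, Real.sq_sqrt (by positivity)]
    field_simp
  have hsub : {ω | R * √(2 * l) < |e ω|}
      ⊆ {ω | R * √(2 * l) ≤ e ω} ∪ {ω | R * √(2 * l) ≤ (-e) ω} := fun ω hω =>
    (lt_abs.1 (Set.mem_ofPred_eq ▸ hω)).imp (fun h => h.le) (fun h => h.le)
  calc μ {ω | R * √(2 * l) < |e ω|}
      ≤ μ {ω | R * √(2 * l) ≤ e ω} + μ {ω | R * √(2 * l) ≤ (-e) ω} :=
        (measure_mono hsub).trans (measure_union_le _ _)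
    _ ≤ ENNReal.ofReal (Real.exp (-l)) + ENNReal.ofReal (Real.exp (-l)) :=
        add_le_add (upper_tail he) (upper_tail he.neg)
    _ = ENNReal.ofReal (2 * Real.exp (-l)) := by
        rw [← ENNReal.ofReal_add (Real.exp_pos _).le (Real.exp_pos _).le, two_mul]

lemma withDensity_trim_le [IsFiniteMeasure μ] (hm : m ≤ mΩ) {g : Ω → ℝ} (hg0 : ∀ ω, 0 ≤ g ω)
    (hint : Integrable g μ) {b : ℝ} (hb : 0 ≤ b) (hle : μ[g | m] ≤ᵐ[μ] fun _ => b) :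
    (μ.withDensity fun ω => ENNReal.ofReal (g ω)).trim hm ≤ ENNReal.ofReal b • μ.trim hm := by
  refine Measure.le_iff.2 fun A hA => ?_
  have setIntegral_le : ∫ ω in A, (μ[g | m]) ω ∂μ ≤ ∫ _ in A, b ∂μ :=
    setIntegral_mono_ae integrable_condExp.integrableOn (integrable_const b).integrableOn hle
  rw [trim_measurableSet_eq hm hA, withDensity_apply _ (hm A hA), Measure.smul_apply,
    trim_measurableSet_eq hm hA, smul_eq_mul,
    ← ofReal_integral_eq_lintegral_ofReal hint.integrableOn (ae_of_all _ hg0),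
    ← setIntegral_condExp hm hint hA]
  refine (ENNReal.ofReal_le_ofReal setIntegral_le).trans_eq ?_
  rw [setIntegral_const, smul_eq_mul, mul_comm, ENNReal.ofReal_mul hb, measureReal_def,
    ENNReal.ofReal_toReal (measure_ne_top _ _)]

lemma lintegral_mul_ofReal_le_of_condExp_le [IsFiniteMeasure μ] (hm : m ≤ mΩ) {g : Ω → ℝ}
    (hg : Measurable g) (hg0 : ∀ ω, 0 ≤ g ω) (hint : Integrable g μ) {b : ℝ} (hb : 0 ≤ b)
    (hle : μ[g | m] ≤ᵐ[μ] fun _ => b) {W : Ω → ℝ≥0∞} (hW : Measurable[m] W) :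
    ∫⁻ ω, W ω * ENNReal.ofReal (g ω) ∂μ ≤ ENNReal.ofReal b * ∫⁻ ω, W ω ∂μ :=
  calc ∫⁻ ω, W ω * ENNReal.ofReal (g ω) ∂μ
      = ∫⁻ ω, W ω ∂(μ.withDensity fun ω => ENNReal.ofReal (g ω)) := by
        rw [lintegral_withDensity_eq_lintegral_mul _ hg.ennreal_ofReal (hW.mono hm le_rfl)]
        exact lintegral_congr fun ω => mul_comm _ _
    _ = ∫⁻ ω, W ω ∂((μ.withDensity fun ω => ENNReal.ofReal (g ω)).trim hm) :=
        (lintegral_trim hm hW).symm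
    _ ≤ ∫⁻ ω, W ω ∂(ENNReal.ofReal b • μ.trim hm) :=
        lintegral_mono' (withDensity_trim_le hm hg0 hint hb hle) le_rfl
    _ = ENNReal.ofReal b * ∫⁻ ω, W ω ∂μ := by
        rw [lintegral_smul_measure, lintegral_trim hm hW, smul_eq_mul]

/-- The exponential tilt of a sub-Gaussian variable `e` with variance proxy `R ^ 2` at the
parameter `s`, normalized so that its expectation is at most `1`. -/
def expTilt (R s e : ℝ) : ℝ≥0∞ := ENNReal.ofReal (Real.exp (s * e - s ^ 2 * R ^ 2 / 2))

lemma continuous_expTilt (e : ℝ) : Continuous fun s => expTilt R s e :=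
  ENNReal.continuous_ofReal.comp (by fun_prop)

lemma measurable_expTilt : Measurable fun p : ℝ × ℝ => expTilt R p.1 p.2 :=
  ENNReal.measurable_ofReal.comp (by fun_prop)

lemma expTilt_pos (s e : ℝ) : 0 < expTilt R s e := ENNReal.ofReal_pos.2 (Real.exp_pos _)

lemma CondSubgaussian.lintegral_mul_expTilt_const_le [IsFiniteMeasure μ]
    (h : CondSubgaussian m μ e R) (hm : m ≤ mΩ) (he : Measurable e) {W : Ω → ℝ≥0∞}
    (hW : Measurable[m] W) (s : ℝ) :
    ∫⁻ ω, W ω * expTilt R s (e ω) ∂μ ≤ ∫⁻ ω, W ω ∂μ := by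
  have factor : ∀ ω, W ω * expTilt R s (e ω) = ENNReal.ofReal (Real.exp (-(s ^ 2 * R ^ 2 / 2))) *
      (W ω * ENNReal.ofReal (Real.exp (s * e ω))) := by
    intro ω
    rw [expTilt, sub_eq_add_neg, Real.exp_add, ENNReal.ofReal_mul (Real.exp_pos _).le]
    ring
  simp_rw [factor]
  rw [lintegral_const_mul' _ _ ENNReal.ofReal_ne_top]
  calc ENNReal.ofReal (Real.exp (-(s ^ 2 * R ^ 2 / 2))) *
        ∫⁻ ω, W ω * ENNReal.ofReal (Real.exp (s * e ω)) ∂μ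
      ≤ ENNReal.ofReal (Real.exp (-(s ^ 2 * R ^ 2 / 2))) *
        (ENNReal.ofReal (Real.exp (s ^ 2 * R ^ 2 / 2)) * ∫⁻ ω, W ω ∂μ) := by
        gcongr
        exact lintegral_mul_ofReal_le_of_condExp_le hm (he.const_mul s).exp
          (fun ω => (Real.exp_pos _).le) (h.integrable_exp_mul s) (Real.exp_pos _).le
          (h.condExp_exp_le s) hW
    _ = ∫⁻ ω, W ω ∂μ := by
        rw [← mul_assoc, ← ENNReal.ofReal_mul (Real.exp_pos _).le, ← Real.exp_add]
        simp

lemma CondSubgaussian.lintegral_mul_expTilt_le_of_finite_range [IsFiniteMeasure μ]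
    (h : CondSubgaussian m μ e R) (hm : m ≤ mΩ) (he : Measurable e) {W : Ω → ℝ≥0∞}
    (hW : Measurable[m] W) {H : Ω → ℝ} (hH : Measurable[m] H) (hfin : (Set.range H).Finite) :
    ∫⁻ ω, W ω * expTilt R (H ω) (e ω) ∂μ ≤ ∫⁻ ω, W ω ∂μ := by
  let V : ℝ → Ω → ℝ≥0∞ := fun s => (H ⁻¹' {s}).indicator W
  have hV : ∀ s, Measurable[m] (V s) := fun s => hW.indicator (hH (measurableSet_singleton s))
  have sum_fibers : ∀ (F : ℝ → ℝ≥0∞) ω, W ω * F (H ω) = ∑ s ∈ hfin.toFinset, V s ω * F s := by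
    intro F ω
    rw [Finset.sum_eq_single_of_mem (H ω) (by simp)]
    · simp [V]
    · intro s _ hs
      simp [V, Set.indicator_of_notMem (s := H ⁻¹' {s}) (a := ω) fun hω => hs hω.symm]
  have hexp : ∀ s, Measurable fun ω => expTilt R s (e ω) := fun s =>
    measurable_expTilt.comp (measurable_const.prodMk he)
  calc ∫⁻ ω, W ω * expTilt R (H ω) (e ω) ∂μ
      = ∑ s ∈ hfin.toFinset, ∫⁻ ω, V s ω * expTilt R s (e ω) ∂μ := by
        rw [lintegral_congr fun ω => sum_fibers (fun s => expTilt R s (e ω)) ω]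
        exact lintegral_finsetSum _ fun s _ => ((hV s).mono hm le_rfl).mul (hexp s)
    _ ≤ ∑ s ∈ hfin.toFinset, ∫⁻ ω, V s ω ∂μ :=
        Finset.sum_le_sum fun s _ => h.lintegral_mul_expTilt_const_le hm he (hV s) s
    _ = ∫⁻ ω, W ω ∂μ := by
        rw [← lintegral_finsetSum _ fun s _ => (hV s).mono hm le_rfl]
        exact lintegral_congr fun ω => by simpa using (sum_fibers 1 ω).symm

lemma exists_finite_range_tendsto {Ω : Type*} {_ : MeasurableSpace Ω} {H : Ω → ℝ}
    (hH : Measurable H) : ∃ Hs : ℕ → Ω → ℝ, (∀ k, Measurable (Hs k)) ∧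
      (∀ k, (Set.range (Hs k)).Finite) ∧ ∀ ω, Tendsto (fun k => Hs k ω) atTop (𝓝 (H ω)) := by
  obtain ⟨Hs, hHs⟩ := hH.stronglyMeasurable
  exact ⟨fun k => Hs k, fun k => (Hs k).measurable, fun k => (Hs k).finite_range, hHs⟩

lemma CondSubgaussian.lintegral_mul_expTilt_le [IsFiniteMeasure μ] (h : CondSubgaussian m μ e R)
    (hm : m ≤ mΩ) (he : Measurable e) {W : Ω → ℝ≥0∞} (hW : Measurable[m] W) {H : Ω → ℝ}
    (hH : Measurable[m] H) :
    ∫⁻ ω, W ω * expTilt R (H ω) (e ω) ∂μ ≤ ∫⁻ ω, W ω ∂μ := by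
  obtain ⟨Hs, hHsm, hfin, hHs⟩ := exists_finite_range_tendsto hH
  have pointwise_limit : ∀ ω, Tendsto (fun k => W ω * expTilt R (Hs k ω) (e ω)) atTop
      (𝓝 (W ω * expTilt R (H ω) (e ω))) := by
    intro ω
    have htilt : Tendsto (fun k => expTilt R (Hs k ω) (e ω)) atTop (𝓝 (expTilt R (H ω) (e ω))) :=
      ((continuous_expTilt (e ω)).tendsto (H ω)).comp (hHs ω)
    exact ENNReal.Tendsto.const_mul htilt (Or.inl (expTilt_pos _ _).ne')
  have hmeas : ∀ k, Measurable fun ω => W ω * expTilt R (Hs k ω) (e ω) := fun k =>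
    (hW.mono hm le_rfl).mul (measurable_expTilt.comp
      (((hHsm k).mono hm le_rfl).prodMk he))
  calc ∫⁻ ω, W ω * expTilt R (H ω) (e ω) ∂μ
      = ∫⁻ ω, liminf (fun k => W ω * expTilt R (Hs k ω) (e ω)) atTop ∂μ :=
        lintegral_congr fun ω => (pointwise_limit ω).liminf_eq.symm
    _ ≤ liminf (fun k => ∫⁻ ω, W ω * expTilt R (Hs k ω) (e ω) ∂μ) atTop :=
        lintegral_liminf_le hmeas
    _ ≤ ∫⁻ ω, W ω ∂μ := by
        refine liminf_le_of_le (by isBoundedDefault) fun b hb => ?_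
        obtain ⟨k, hk⟩ := hb.exists
        exact hk.trans (h.lintegral_mul_expTilt_le_of_finite_range hm he hW (hHsm k) (hfin k))

/-- The factor by which the mixture supermartingale
`exp (explained / (2 R²) - infoGain)` grows when an observation `e` arrives at a point with
posterior mean `a` and posterior variance `v`. -/
def mixFactor (σ R e a v : ℝ) : ℝ :=
  Real.exp ((e ^ 2 - σ ^ 2 * (e - a) ^ 2 / (v + σ ^ 2)) / (2 * R ^ 2)) * (√(1 + v / σ ^ 2))⁻¹

-- Completing the square turns the tilted standard normal density into another normal density.
lemma exp_mul_gaussianPDFReal_eq {R : ℝ} (hR : 0 < R) (e a τ z : ℝ) :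
    Real.exp ((a / R ^ 2 + τ / R * z) * e - (a / R ^ 2 + τ / R * z) ^ 2 * R ^ 2 / 2)
        * gaussianPDFReal 0 1 z
      = Real.exp ((e ^ 2 - (e - a) ^ 2 / (1 + τ ^ 2)) / (2 * R ^ 2)) * (√(1 + τ ^ 2))⁻¹
        * gaussianPDFReal (τ * (e - a) / (R * (1 + τ ^ 2))) (1 + τ ^ 2)⁻¹.toNNReal z := by
  have hs : 0 < 1 + τ ^ 2 := by positivity
  have exponents : ((a / R ^ 2 + τ / R * z) * e - (a / R ^ 2 + τ / R * z) ^ 2 * R ^ 2 / 2)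
      + -(z - 0) ^ 2 / 2 = (e ^ 2 - (e - a) ^ 2 / (1 + τ ^ 2)) / (2 * R ^ 2)
      + -(z - τ * (e - a) / (R * (1 + τ ^ 2))) ^ 2 / (2 * (1 + τ ^ 2)⁻¹) := by
    field_simp
    ring
  have normalization : √(2 * Real.pi * (1 + τ ^ 2)⁻¹) = √(2 * Real.pi) * (√(1 + τ ^ 2))⁻¹ := by
    rw [Real.sqrt_mul (by positivity), Real.sqrt_inv]
  simp only [gaussianPDFReal, Real.coe_toNNReal _ (inv_pos.2 hs).le, NNReal.coe_one, mul_one,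
    normalization]
  calc _ = (√(2 * Real.pi))⁻¹ * Real.exp (((a / R ^ 2 + τ / R * z) * e
          - (a / R ^ 2 + τ / R * z) ^ 2 * R ^ 2 / 2) + -(z - 0) ^ 2 / 2) := by
        rw [Real.exp_add]
        ring
    _ = _ := by
        rw [exponents, Real.exp_add]
        field_simp

lemma mixFactor_eq_lintegral (hσ : 0 < σ) (hR : 0 < R) (e a : ℝ) {v : ℝ} (hv : 0 ≤ v) :
    ENNReal.ofReal (mixFactor σ R e a v)
      = ∫⁻ z, expTilt R (a / R ^ 2 + √v / (σ * R) * z) e * gaussianPDF 0 1 z := by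
  set τ := √v / σ with hτ
  have hv' : v = σ ^ 2 * τ ^ 2 := by
    rw [hτ, div_pow, Real.sq_sqrt hv]
    field_simp
  have mixFactor_eq : mixFactor σ R e a v
      = Real.exp ((e ^ 2 - (e - a) ^ 2 / (1 + τ ^ 2)) / (2 * R ^ 2)) * (√(1 + τ ^ 2))⁻¹ := by
    rw [mixFactor, hv']
    congr 3
    · field_simp
      ring
    · congr 1
      field_simp
  have integrand_eq : ∀ z, expTilt R (a / R ^ 2 + √v / (σ * R) * z) e * gaussianPDF 0 1 z
      = ENNReal.ofReal (mixFactor σ R e a v)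
        * gaussianPDF (τ * (e - a) / (R * (1 + τ ^ 2))) (1 + τ ^ 2)⁻¹.toNNReal z := by
    intro z
    rw [expTilt, gaussianPDF, gaussianPDF, ← ENNReal.ofReal_mul (Real.exp_pos _).le,
      ← ENNReal.ofReal_mul (by unfold mixFactor; positivity), mixFactor_eq, ← div_div, ← hτ,
      exp_mul_gaussianPDFReal_eq hR]
  simp_rw [integrand_eq]
  rw [lintegral_const_mul _ (measurable_gaussianPDF _ _),
    lintegral_gaussianPDF_eq_one _ (Real.toNNReal_pos.2 (by positivity)).ne', mul_one]

lemma CondSubgaussian.lintegral_mul_mixFactor_le [IsFiniteMeasure μ]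
    (h : CondSubgaussian m μ e R) (hm : m ≤ mΩ) (he : Measurable e) (hR : 0 < R) (hσ : 0 < σ)
    {W : Ω → ℝ≥0∞} (hW : Measurable[m] W) {a v : Ω → ℝ} (ha : Measurable[m] a)
    (hv : Measurable[m] v) (hv0 : ∀ ω, 0 ≤ v ω) :
    ∫⁻ ω, W ω * ENNReal.ofReal (mixFactor σ R (e ω) (a ω) (v ω)) ∂μ ≤ ∫⁻ ω, W ω ∂μ := by
  let s : Ω → ℝ → ℝ := fun ω z => a ω / R ^ 2 + √(v ω) / (σ * R) * z
  have hs : Measurable fun p : Ω × ℝ => s p.1 p.2 :=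
    (((ha.mono hm le_rfl).comp measurable_fst).div_const _).add
      (((((hv.mono hm le_rfl).comp measurable_fst).sqrt).div_const _).mul measurable_snd)
  have hE : Measurable fun p : Ω × ℝ => expTilt R (s p.1 p.2) (e p.1) * gaussianPDF 0 1 p.2 :=
    (measurable_expTilt.comp (hs.prodMk (he.comp measurable_fst))).mul
      ((measurable_gaussianPDF 0 1).comp measurable_snd)
  calc ∫⁻ ω, W ω * ENNReal.ofReal (mixFactor σ R (e ω) (a ω) (v ω)) ∂μ
      = ∫⁻ ω, ∫⁻ z, W ω * (expTilt R (s ω z) (e ω) * gaussianPDF 0 1 z) ∂volume ∂μ := by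
        refine lintegral_congr fun ω => ?_
        rw [mixFactor_eq_lintegral hσ hR _ _ (hv0 ω)]
        exact (lintegral_const_mul _ (hE.comp measurable_prodMk_left)).symm
    _ = ∫⁻ z, ∫⁻ ω, W ω * (expTilt R (s ω z) (e ω) * gaussianPDF 0 1 z) ∂μ ∂volume :=
        lintegral_lintegral_swap (((hW.mono hm le_rfl).comp measurable_fst).mul hE).aemeasurable
    _ ≤ ∫⁻ z, gaussianPDF 0 1 z * ∫⁻ ω, W ω ∂μ ∂volume := by
        refine lintegral_mono fun z => ?_
        simp_rw [← mul_assoc, mul_comm _ (gaussianPDF 0 1 z)]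
        rw [lintegral_const_mul' _ _ gaussianPDF_ne_top]
        exact mul_le_mul' le_rfl (h.lintegral_mul_expTilt_le hm he hW
          ((ha.div_const _).add (((hv.sqrt).div_const _).mul_const _)))
    _ = ∫⁻ ω, W ω ∂μ := by
        rw [lintegral_mul_const _ (measurable_gaussianPDF 0 1),
          lintegral_gaussianPDF_eq_one _ one_ne_zero, one_mul]

lemma mul_measure_add_setLIntegral_compl_le {A A' : Set Ω} (hA : MeasurableSet A)
    (hA' : MeasurableSet A') (hAA' : A ⊆ A') {M : Ω → ℝ≥0∞} {b : ℝ≥0∞}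
    (hb : ∀ ω ∈ A' \ A, b ≤ M ω) :
    b * μ A' + ∫⁻ ω in A'ᶜ, M ω ∂μ ≤ b * μ A + ∫⁻ ω in Aᶜ, M ω ∂μ := by
  have setLIntegral_split :
      ∫⁻ ω in Aᶜ, M ω ∂μ = ∫⁻ ω in A' \ A, M ω ∂μ + ∫⁻ ω in A'ᶜ, M ω ∂μ := by
    rw [← lintegral_union hA'.compl (Set.disjoint_left.2 fun ω h h' => h' h.1)]
    congr 2
    ext ω
    have := @hAA' ω
    simp only [Set.mem_compl_iff, Set.mem_union, Set.mem_sdiff]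
    tauto
  calc b * μ A' + ∫⁻ ω in A'ᶜ, M ω ∂μ
      = b * μ A + (b * μ (A' \ A) + ∫⁻ ω in A'ᶜ, M ω ∂μ) := by
        rw [← add_assoc, ← mul_add, measure_add_sdiff hA.nullMeasurableSet,
          Set.union_eq_self_of_subset_left hAA']
    _ ≤ b * μ A + ∫⁻ ω in Aᶜ, M ω ∂μ := by
        rw [setLIntegral_split]
        gcongr
        exact (setLIntegral_const _ _).symm.trans_le (setLIntegral_mono' (hA'.diff hA) hb)

lemma mul_measure_exists_le_le_one {ℱ : Filtration ℕ mΩ} {M : ℕ → Ω → ℝ≥0∞} {T : ℕ}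
    (hM : ∀ n ≤ T, Measurable[ℱ n] (M n)) (h0 : ∫⁻ ω, M 0 ω ∂μ ≤ 1)
    (hstep : ∀ n < T, ∀ A, MeasurableSet[ℱ n] A →
      ∫⁻ ω in A, M (n + 1) ω ∂μ ≤ ∫⁻ ω in A, M n ω ∂μ) (b : ℝ≥0∞) :
    b * μ {ω | ∃ n ≤ T, b ≤ M n ω} ≤ 1 := by
  let A : ℕ → Set Ω := fun n => {ω | ∃ j ≤ n, b ≤ M j ω}
  have hA : ∀ n ≤ T, MeasurableSet[ℱ n] (A n) := by
    intro n hn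
    have : A n = ⋃ j ∈ Finset.range (n + 1), {ω | b ≤ M j ω} := by
      ext ω
      simp [A]
    rw [this]
    refine Finset.measurableSet_biUnion _ fun j hj => ?_
    have hjn : j ≤ n := Finset.mem_range_succ_iff.1 hj
    exact (hM j (hjn.trans hn)).mono (ℱ.mono hjn) le_rfl measurableSet_Ici
  have hA' : ∀ n ≤ T, MeasurableSet (A n) := fun n hn => ℱ.le n _ (hA n hn)
  have potential_le : ∀ n ≤ T, b * μ (A n) + ∫⁻ ω in (A n)ᶜ, M n ω ∂μ ≤ 1 := by
    intro n
    induction n with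
    | zero =>
      intro hT
      refine (mul_measure_add_setLIntegral_compl_le .empty (hA' 0 hT) (Set.empty_subset _)
        fun ω hω => ?_).trans (by simpa using h0)
      simpa [A] using hω
    | succ n ih =>
      intro hn
      refine (mul_measure_add_setLIntegral_compl_le (hA' n (by omega)) (hA' _ hn)
        (fun ω ⟨j, hj, h⟩ => ⟨j, by omega, h⟩) ?_).trans
        ((add_le_add le_rfl (hstep n hn _ (hA n (by omega)).compl)).trans (ih (by omega)))
      rintro ω ⟨⟨j, hj, h⟩, hnot⟩
      obtain rfl | hj := hj.eq_or_lt
      · exact h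
      · exact absurd ⟨j, Nat.lt_succ_iff.1 hj, h⟩ hnot
  exact le_self_add.trans (potential_le T le_rfl)

end SubGaussian

/-! ### Measurability of the posterior -/

section Measurability

open Matrix

variable {Ω : Type*} {mΩ : MeasurableSpace Ω}

lemma measurable_det {ι : Type*} [Fintype ι] [DecidableEq ι] {A : Ω → Matrix ι ι ℝ}
    (hA : ∀ i j, Measurable fun ω => A ω i j) : Measurable fun ω => (A ω).det := by
  simp_rw [Matrix.det_apply]
  exact Finset.measurable_sum _ fun p _ =>
    (Finset.measurable_prod _ fun i _ => hA _ _).const_smul _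

lemma measurable_inv_apply {ι : Type*} [Fintype ι] [DecidableEq ι] {A : Ω → Matrix ι ι ℝ}
    (hA : ∀ i j, Measurable fun ω => A ω i j) (i j : ι) : Measurable fun ω => (A ω)⁻¹ i j := by
  simp_rw [Matrix.inv_def, Matrix.smul_apply, Ring.inverse_eq_inv', smul_eq_mul,
    Matrix.adjugate_apply]
  refine (measurable_det hA).inv.mul (measurable_det fun k l => ?_)
  obtain rfl | hk := eq_or_ne k j
  · simp
  · simpa only [Matrix.updateRow_ne hk] using hA k l

variable {E : Type} [MeasurableSpace E] {n : ℕ} {k : E → E → ℝ} {σ : ℝ} {x : Fin n → Ω → E}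

lemma measurable_gram_apply (hk : Measurable fun p : E × E => k p.1 p.2)
    (hx : ∀ i, Measurable (x i)) (i j : Fin n) :
    Measurable fun ω => gram k (fun l => x l ω) i j :=
  hk.comp ((hx i).prodMk (hx j))

lemma measurable_noisyGram_inv (hk : Measurable fun p : E × E => k p.1 p.2)
    (hx : ∀ i, Measurable (x i)) (i j : Fin n) :
    Measurable fun ω => (noisyGram k σ fun l => x l ω)⁻¹ i j :=
  measurable_inv_apply (fun i j => (measurable_gram_apply hk hx i j).add_const _) i j

lemma measurable_dotProduct {ι : Type*} [Fintype ι] {v w : ι → Ω → ℝ}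
    (hv : ∀ i, Measurable (v i)) (hw : ∀ i, Measurable (w i)) :
    Measurable fun ω => (fun i => v i ω) ⬝ᵥ fun i => w i ω :=
  Finset.measurable_sum _ fun i _ => (hv i).mul (hw i)

lemma measurable_noisyGram_inv_mulVec (hk : Measurable fun p : E × E => k p.1 p.2)
    (hx : ∀ i, Measurable (x i)) {v : Fin n → Ω → ℝ} (hv : ∀ i, Measurable (v i)) (i : Fin n) :
    Measurable fun ω => ((noisyGram k σ fun l => x l ω)⁻¹ *ᵥ fun l => v l ω) i :=
  measurable_dotProduct (measurable_noisyGram_inv hk hx i) hv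

lemma measurable_postMean (hk : Measurable fun p : E × E => k p.1 p.2)
    (hx : ∀ i, Measurable (x i)) {y : Fin n → Ω → ℝ} (hy : ∀ i, Measurable (y i)) {z : Ω → E}
    (hz : Measurable z) :
    Measurable fun ω => postMean k σ (fun i => x i ω) (fun i => y i ω) (z ω) :=
  measurable_dotProduct (fun i => hk.comp ((hx i).prodMk hz))
    (measurable_noisyGram_inv_mulVec hk hx hy)

lemma measurable_postVar (hk : Measurable fun p : E × E => k p.1 p.2)
    (hx : ∀ i, Measurable (x i)) {z : Ω → E} (hz : Measurable z) :
    Measurable fun ω => postVar k σ (fun i => x i ω) (z ω) :=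
  (hk.comp (hz.prodMk hz)).sub
    (measurable_postMean hk hx (fun i => hk.comp ((hx i).prodMk hz)) hz)

lemma measurable_explained (hk : Measurable fun p : E × E => k p.1 p.2)
    (hx : ∀ i, Measurable (x i)) {v : Fin n → Ω → ℝ} (hv : ∀ i, Measurable (v i)) :
    Measurable fun ω => explained k σ (fun i => x i ω) (fun i => v i ω) :=
  (measurable_dotProduct hv hv).sub
    ((measurable_dotProduct hv (measurable_noisyGram_inv_mulVec hk hx hv)).const_mul _)

lemma measurable_infoGain (hk : Measurable fun p : E × E => k p.1 p.2)
    (hx : ∀ i, Measurable (x i)) : Measurable fun ω => infoGain k σ (fun i => x i ω) :=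
  (measurable_det fun i j =>
    ((measurable_gram_apply hk hx i j).const_mul _).const_add _).log.const_mul _

end Measurability

/-! ### Self-normalized concentration -/

section Concentration

open scoped ENNReal

variable {E : Type} {k : E → E → ℝ} {σ R : ℝ}

/-- The supermartingale of the method of mixtures along the queries `x` with noise `e`: the
average of the exponential supermartingales `exp (∑ i, g (x i) e i - …)` over Gaussian `g`. -/
def mixMartingale (k : E → E → ℝ) (σ R : ℝ) (x : ℕ → E) (e : ℕ → ℝ) (n : ℕ) : ℝ≥0∞ :=
  ENNReal.ofReal (Real.exp
    (explained k σ (fun i : Fin n => x i) (fun i : Fin n => e i) / (2 * R ^ 2)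
      - infoGain k σ fun i : Fin n => x i))

lemma mixMartingale_zero (x : ℕ → E) (e : ℕ → ℝ) : mixMartingale k σ R x e 0 = 1 := by
  simp [mixMartingale, explained, infoGain]

lemma mixMartingale_succ (hk : IsPSDKernel k) (hσ : 0 < σ) (x : ℕ → E) (e : ℕ → ℝ) (n : ℕ) :
    mixMartingale k σ R x e (n + 1)
      = mixMartingale k σ R x e n * ENNReal.ofReal (mixFactor σ R (e n)
          (postMean k σ (fun i : Fin n => x i) (fun i : Fin n => e i) (x n))
          (postVar k σ (fun i : Fin n => x i) (x n))) := by
  have : 0 < 1 + postVar k σ (fun i : Fin n => x i) (x n) / σ ^ 2 := by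
    have := postVar_nonneg hk hσ (fun i : Fin n => x i) (x n)
    positivity
  have inv_sqrt_eq := Real.exp_neg (1 / 2 * Real.log
    (1 + postVar k σ (fun i : Fin n => x i) (x n) / σ ^ 2))
  rw [mul_comm, ← Real.rpow_def_of_pos this, ← Real.sqrt_eq_rpow] at inv_sqrt_eq
  rw [mixMartingale, mixMartingale, mixFactor, ← inv_sqrt_eq,
    explained_succ hk hσ (fun i : Fin (n + 1) => x i) (fun i : Fin (n + 1) => e i),
    infoGain_succ hk hσ (fun i : Fin (n + 1) => x i), ← Real.exp_add,
    ← ENNReal.ofReal_mul (Real.exp_pos _).le, ← Real.exp_add]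
  congr 2
  simp only [Fin.init_def, Fin.val_castSucc, Fin.val_last]
  ring

variable {Ω : Type*} {mΩ : MeasurableSpace Ω} [MeasurableSpace E] {μ : Measure Ω}
  {ℱ : Filtration ℕ mΩ} {T : ℕ} {x : ℕ → Ω → E} {e : ℕ → Ω → ℝ}

lemma measurable_mixMartingale (hkm : Measurable fun p : E × E => k p.1 p.2)
    (hx : ∀ n < T, Measurable[ℱ n] (x n)) (he : ∀ n < T, Measurable[ℱ (n + 1)] (e n))
    {n : ℕ} (hn : n ≤ T) :
    Measurable[ℱ n] fun ω => mixMartingale k σ R (fun i => x i ω) (fun i => e i ω) n := by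
  have hx' : ∀ i : Fin n, Measurable[ℱ n] (x i) := fun i =>
    (hx i (i.2.trans_le hn)).mono (ℱ.mono i.2.le) le_rfl
  have he' : ∀ i : Fin n, Measurable[ℱ n] (e i) := fun i =>
    (he i (i.2.trans_le hn)).mono (ℱ.mono i.2) le_rfl
  exact (((measurable_explained hkm hx' he').div_const _).sub
    (measurable_infoGain hkm hx')).exp.ennreal_ofReal

lemma setLIntegral_mixMartingale_succ_le [IsFiniteMeasure μ] (hk : IsPSDKernel k)
    (hkm : Measurable fun p : E × E => k p.1 p.2) (hσ : 0 < σ) (hR : 0 < R)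
    (hx : ∀ n < T, Measurable[ℱ n] (x n)) (he : ∀ n < T, Measurable[ℱ (n + 1)] (e n))
    (hsub : ∀ n < T, CondSubgaussian (ℱ n) μ (e n) R) {n : ℕ} (hn : n < T) {A : Set Ω}
    (hA : MeasurableSet[ℱ n] A) :
    ∫⁻ ω in A, mixMartingale k σ R (fun i => x i ω) (fun i => e i ω) (n + 1) ∂μ
      ≤ ∫⁻ ω in A, mixMartingale k σ R (fun i => x i ω) (fun i => e i ω) n ∂μ := by
  have hx' : ∀ i : Fin n, Measurable[ℱ n] (x i) := fun i =>
    (hx i (i.2.trans hn)).mono (ℱ.mono i.2.le) le_rfl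
  have he' : ∀ i : Fin n, Measurable[ℱ n] (e i) := fun i =>
    (he i (i.2.trans hn)).mono (ℱ.mono i.2) le_rfl
  rw [← lintegral_indicator (ℱ.le n A hA), ← lintegral_indicator (ℱ.le n A hA)]
  refine (lintegral_congr fun ω => ?_).trans_le ((hsub n hn).lintegral_mul_mixFactor_le (ℱ.le n)
    ((he n hn).mono (ℱ.le _) le_rfl) hR hσ
    ((measurable_mixMartingale hkm hx he hn.le).indicator hA)
    (measurable_postMean (σ := σ) hkm hx' he' (hx n hn)) (measurable_postVar hkm hx' (hx n hn))
    fun ω => postVar_nonneg hk hσ _ _)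
  by_cases hω : ω ∈ A <;> simp [hω, mixMartingale_succ hk hσ]

lemma measure_lt_explained_le [IsProbabilityMeasure μ] (hk : IsPSDKernel k)
    (hkm : Measurable fun p : E × E => k p.1 p.2) (hσ : 0 < σ) (hR : 0 < R)
    (hx : ∀ n < T, Measurable[ℱ n] (x n)) (he : ∀ n < T, Measurable[ℱ (n + 1)] (e n))
    (hsub : ∀ n < T, CondSubgaussian (ℱ n) μ (e n) R) {b : ℝ} (hb : 0 < b) :
    μ {ω | ∃ n ≤ T, 2 * R ^ 2 * (infoGain k σ (fun i : Fin n => x i ω) + Real.log b)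
      < explained k σ (fun i : Fin n => x i ω) (fun i : Fin n => e i ω)}
      ≤ ENNReal.ofReal b⁻¹ := by
  have ville := mul_measure_exists_le_le_one
    (fun n hn => measurable_mixMartingale (k := k) (σ := σ) (R := R) hkm hx he hn)
    (by simp [mixMartingale_zero] : ∫⁻ ω, mixMartingale k σ R (fun i => x i ω)
      (fun i => e i ω) 0 ∂μ ≤ 1)
    (fun n hn A hA => setLIntegral_mixMartingale_succ_le hk hkm hσ hR hx he hsub hn hA)
    (ENNReal.ofReal b)
  rw [ENNReal.ofReal_inv_of_pos hb, ← one_div, ENNReal.le_div_iff_mul_le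
    (Or.inl (by simpa using hb)) (Or.inl ENNReal.ofReal_ne_top), mul_comm]
  refine (mul_le_mul_right (measure_mono ?_) _).trans ville
  rintro ω ⟨n, hn, h⟩
  refine ⟨n, hn, ENNReal.ofReal_le_ofReal ?_⟩
  rw [← Real.log_le_iff_le_exp hb, le_sub_iff_add_le, le_div_iff₀ (by positivity)]
  linarith

variable {d m : ℕ}

/-- The good event of the regret analysis: the noise is bounded in the self-normalized sense for
all hyperparameters in the net `s`, and in absolute value. -/
def GoodNoise (P : Problem d m) (σ R δ : ℝ) (T : ℕ) (s : Finset (Fin m → ℝ))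
    (x : ℕ → EuclideanSpace ℝ (Fin d)) (e : ℕ → ℝ) : Prop :=
  (∀ θ ∈ s, ∀ n ≤ T, explained (P.ker θ) σ (fun i : Fin n => x i) (fun i : Fin n => e i)
    ≤ 2 * R ^ 2 * (infoGain (P.ker θ) σ (fun i : Fin n => x i) + Real.log (6 * s.card / δ))) ∧
  ∀ n < T, |e n| ≤ R * √(2 * Real.log (4 * T / δ))

lemma measure_biUnion_finset_le_ofReal {ι : Type*} {s : Finset ι} {A : ι → Set Ω} {p q : ℝ}
    (hA : ∀ i ∈ s, μ (A i) ≤ ENNReal.ofReal p) (h : s.card * p ≤ q) :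
    μ (⋃ i ∈ s, A i) ≤ ENNReal.ofReal q := by
  refine (measure_biUnion_finset_le s A).trans ((Finset.sum_le_sum hA).trans ?_)
  rw [Finset.sum_const, nsmul_eq_mul, ← ENNReal.ofReal_natCast,
    ← ENNReal.ofReal_mul (Nat.cast_nonneg _)]
  exact ENNReal.ofReal_le_ofReal h

variable {P : Problem d m} {x : ℕ → Ω → EuclideanSpace ℝ (Fin d)} {δ : ℝ}

lemma measure_biUnion_lt_abs_le [IsProbabilityMeasure μ] (hR : 0 < R) (hδ : 0 < δ) (hδ1 : δ ≤ 1)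
    (hsub : ∀ n < T, CondSubgaussian (ℱ n) μ (e n) R) :
    μ (⋃ n ∈ Finset.range T, {ω | R * √(2 * Real.log (4 * T / δ)) < |e n ω|})
      ≤ ENNReal.ofReal (δ / 2) := by
  refine measure_biUnion_finset_le_ofReal (p := 2 * (4 * T / δ)⁻¹) (fun n hn => ?_) ?_
  · have hn' := Finset.mem_range.1 hn
    have hT : (1 : ℝ) ≤ T := mod_cast (Nat.zero_le n).trans_lt hn'
    have hl : 1 ≤ 4 * T / δ := by rw [le_div_iff₀ hδ]; linarith
    have := measure_mul_sqrt_lt_abs_le hR ((hsub n hn').hasSubgaussianMGF (ℱ.le n))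
      (Real.log_nonneg hl)
    rwa [Real.exp_neg, Real.exp_log (by linarith)] at this
  · rw [Finset.card_range]
    obtain h | h := eq_or_ne (T : ℝ) 0
    · rw [h, zero_mul]; positivity
    · exact le_of_eq (by field_simp; norm_num)

lemma measure_goodNoise_ge [IsProbabilityMeasure μ] (hσ : 0 < σ) (hR : 0 < R)
    (hδ : 0 < δ) (hδ1 : δ ≤ 1) (hx : ∀ n < T, Measurable[ℱ n] (x n))
    (he : ∀ n < T, Measurable[ℱ (n + 1)] (e n))
    (hsub : ∀ n < T, CondSubgaussian (ℱ n) μ (e n) R)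
    {s : Finset (Fin m → ℝ)} (hs : ∀ θ ∈ s, θ ∈ P.Θ) :
    ENNReal.ofReal (1 - δ)
      ≤ μ {ω | GoodNoise P σ R δ T s (fun n => x n ω) (fun n => e n ω)} := by
  set G := {ω | GoodNoise P σ R δ T s (fun n => x n ω) (fun n => e n ω)}
  let A : (Fin m → ℝ) → Set Ω := fun θ => {ω | ∃ n ≤ T,
    2 * R ^ 2 * (infoGain (P.ker θ) σ (fun i : Fin n => x i ω) + Real.log (6 * s.card / δ))
      < explained (P.ker θ) σ (fun i : Fin n => x i ω) (fun i : Fin n => e i ω)}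
  let D : ℕ → Set Ω := fun n => {ω | R * √(2 * Real.log (4 * T / δ)) < |e n ω|}
  have measure_A : μ (⋃ θ ∈ s, A θ) ≤ ENNReal.ofReal (δ / 6) := by
    refine measure_biUnion_finset_le_ofReal (p := (6 * s.card / δ)⁻¹) (fun θ hθ => ?_) ?_
    · have : (0 : ℝ) < s.card := mod_cast Finset.card_pos.2 ⟨θ, hθ⟩
      exact measure_lt_explained_le (P.ker_psd (hs θ hθ)) (P.measurable_ker θ) hσ hR hx he hsub
        (by positivity)
    · obtain h | h := eq_or_ne (s.card : ℝ) 0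
      · rw [h, zero_mul]; positivity
      · exact le_of_eq (by field_simp)
  have compl_subset : Gᶜ ⊆ (⋃ θ ∈ s, A θ) ∪ ⋃ n ∈ Finset.range T, D n := by
    intro ω hω
    by_contra h
    simp only [Set.mem_union, Set.mem_iUnion, not_or, not_exists] at h
    refine hω ⟨fun θ hθ n hn => not_lt.1 fun hlt => h.1 θ hθ ⟨n, hn, hlt⟩, fun n hn => ?_⟩
    exact not_lt.1 (h.2 n (Finset.mem_range.2 hn))
  have measure_compl : μ Gᶜ ≤ ENNReal.ofReal δ := by
    refine (measure_mono compl_subset).trans ((measure_union_le _ _).trans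
      ((add_le_add measure_A (measure_biUnion_lt_abs_le hR hδ hδ1 hsub)).trans ?_))
    rw [← ENNReal.ofReal_add (by positivity) (by positivity)]
    exact ENNReal.ofReal_le_ofReal (by linarith)
  rw [ENNReal.ofReal_sub _ hδ.le, ENNReal.ofReal_one, tsub_le_iff_right,
    ← measure_univ (μ := μ), ← Set.union_compl_self G]
  exact (measure_union_le _ _).trans (add_le_add le_rfl measure_compl)

end Concentration

/-! ### Confidence bounds on the good event -/

section Confidence

open Matrix

variable {d m : ℕ} {P : Problem d m}

lemma postMean_add {E : Type} {n : ℕ} (k : E → E → ℝ) (σ : ℝ) (x : Fin n → E) (y y' : Fin n → ℝ)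
    (z : E) : postMean k σ x (y + y') z = postMean k σ x y z + postMean k σ x y' z := by
  rw [postMean, mulVec_add, dotProduct_add, ← postMean, ← postMean]

lemma Problem.gram_quad_le {θ θ' : Fin m → ℝ} {ε : ℝ} (h : P.kdist θ θ' ≤ ε) {n : ℕ}
    {x : Fin n → EuclideanSpace ℝ (Fin d)} (hx : ∀ i, x i ∈ P.X) (c : Fin n → ℝ) :
    c ⬝ᵥ gram (P.ker θ) x *ᵥ c ≤ c ⬝ᵥ gram (P.ker θ') x *ᵥ c + n * ε * (c ⬝ᵥ c) := by
  have hε : 0 ≤ ε := (Real.iSup_nonneg fun _ => abs_nonneg _).trans h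
  have term_le : ∀ j l, c j * c l * P.ker θ (x j) (x l)
      ≤ c j * c l * P.ker θ' (x j) (x l) + ε * (|c j| * |c l|) := by
    intro j l
    rw [← sub_le_iff_le_add', ← mul_sub, mul_comm ε]
    refine (le_abs_self _).trans ?_
    rw [abs_mul, abs_mul]
    gcongr
    exact (P.abs_ker_sub_le θ θ' (hx j) (hx l)).trans h
  have sq_sum_le : (∑ j, |c j|) ^ 2 ≤ n * (c ⬝ᵥ c) := by
    simpa [dotProduct, ← sq] using
      sq_sum_le_card_mul_sum_sq (s := Finset.univ) (f := fun j => |c j|)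
  rw [gram_quad, gram_quad]
  calc ∑ j, ∑ l, c j * c l * P.ker θ (x j) (x l)
      ≤ ∑ j, ∑ l, (c j * c l * P.ker θ' (x j) (x l) + ε * (|c j| * |c l|)) :=
        Finset.sum_le_sum fun j _ => Finset.sum_le_sum fun l _ => term_le j l
    _ = ∑ j, ∑ l, c j * c l * P.ker θ' (x j) (x l) + ε * (∑ j, |c j|) ^ 2 := by
        simp_rw [Finset.sum_add_distrib, ← Finset.mul_sum]
        rw [sq, Finset.sum_mul]
    _ ≤ ∑ j, ∑ l, c j * c l * P.ker θ' (x j) (x l) + n * ε * (c ⬝ᵥ c) := by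
        rw [mul_comm (n : ℝ), mul_assoc]
        gcongr

lemma log_four_mul_div_nonneg {T : ℕ} {δ : ℝ} (hT : 1 ≤ T) (hδ : 0 < δ) (hδ1 : δ ≤ 1) :
    0 ≤ Real.log (4 * T / δ) := by
  have : (1 : ℝ) ≤ T := mod_cast hT
  exact Real.log_nonneg (by rw [le_div_iff₀ hδ]; linarith)

lemma one_le_log_six_mul_div {N : ℕ} {δ : ℝ} (hN : 1 ≤ N) (hδ : 0 < δ) (hδ1 : δ ≤ 1) :
    1 ≤ Real.log (6 * N / δ) := by
  have hN' : (1 : ℝ) ≤ N := mod_cast hN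
  rw [Real.le_log_iff_exp_le (by positivity), le_div_iff₀ hδ]
  nlinarith [Real.exp_one_lt_d9, Real.exp_one_gt_d9]

lemma epsT_pos {T : ℕ} (hT : 1 ≤ T) : 0 < epsT T := by
  have : (0 : ℝ) < T := mod_cast hT
  unfold epsT
  positivity

lemma epsT_le_one {T : ℕ} (hT : 1 ≤ T) : epsT T ≤ 1 :=
  inv_le_one_of_one_le₀ (one_le_pow₀ (mod_cast hT))

/-- The width of the part of the confidence interval due to the noise, in units of the noise scale,
when the net of hyperparameters has `N` elements. The second summand is the price of passing from
the net to all of `Θ`. -/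
def noiseWidth (P : Problem d m) (σ δ : ℝ) (T N n : ℕ) : ℝ :=
  √(2 * (P.supGain σ n + Real.log (6 * N / δ))) + (T : ℝ)⁻¹ * √(2 * Real.log (4 * T / δ))

lemma noiseWidth_nonneg (P : Problem d m) (σ δ : ℝ) (T N n : ℕ) : 0 ≤ noiseWidth P σ δ T N n := by
  unfold noiseWidth
  positivity

lemma le_noiseWidth_sq {σ δ : ℝ} {T N n : ℕ} (hσ : 0 < σ) (hT : 1 ≤ T) (hN : 1 ≤ N) (hδ : 0 < δ)
    (hδ1 : δ ≤ 1) :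
    2 * (P.supGain σ n + Real.log (6 * N / δ) + ((T : ℝ) ^ 2)⁻¹ * Real.log (4 * T / δ))
      ≤ noiseWidth P σ δ T N n ^ 2 := by
  have hΓ := P.supGain_nonneg hσ n
  have hN' := one_le_log_six_mul_div hN hδ hδ1
  have hT' := log_four_mul_div_nonneg hT hδ hδ1
  calc 2 * (P.supGain σ n + Real.log (6 * N / δ) + ((T : ℝ) ^ 2)⁻¹ * Real.log (4 * T / δ))
      = √(2 * (P.supGain σ n + Real.log (6 * N / δ))) ^ 2
        + ((T : ℝ)⁻¹ * √(2 * Real.log (4 * T / δ))) ^ 2 := by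
        rw [mul_pow, Real.sq_sqrt (by positivity), Real.sq_sqrt (by positivity), inv_pow]
        ring
    _ ≤ noiseWidth P σ δ T N n ^ 2 :=
        pow_add_pow_le (by positivity) (by positivity) two_ne_zero

variable {σ R δ : ℝ} {T : ℕ} {s : Finset (Fin m → ℝ)} {x : ℕ → EuclideanSpace ℝ (Fin d)}
  {e : ℕ → ℝ}

lemma GoodNoise.dotProduct_self_le (hg : GoodNoise P σ R δ T s x e) (hT : 1 ≤ T) (hδ : 0 < δ)
    (hδ1 : δ ≤ 1) {n : ℕ} (hn : n ≤ T) :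
    (fun i : Fin n => e i) ⬝ᵥ (fun i : Fin n => e i)
      ≤ n * (R ^ 2 * (2 * Real.log (4 * T / δ))) := by
  have := log_four_mul_div_nonneg hT hδ hδ1
  have mul_self_le : ∀ i : Fin n, e i * e i ≤ R ^ 2 * (2 * Real.log (4 * T / δ)) := by
    intro i
    have h := pow_le_pow_left₀ (abs_nonneg _) (hg.2 i (i.2.trans_le hn)) 2
    rwa [sq_abs, mul_pow, Real.sq_sqrt (by positivity), sq (e i)] at h
  simpa [dotProduct] using Finset.sum_le_card_nsmul Finset.univ _ _ fun i _ => mul_self_le i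

lemma GoodNoise.explained_le (hg : GoodNoise P σ R δ T s x e) (hσ : 1 ≤ σ) (hT : 1 ≤ T)
    (hδ : 0 < δ) (hδ1 : δ ≤ 1) (hs : P.IsNet (epsT T) ↑s) {n : ℕ} (hn : n ≤ T)
    (hx : ∀ i < n, x i ∈ P.X) {θ : Fin m → ℝ} (hθ : θ ∈ P.Θ) :
    explained (P.ker θ) σ (fun i : Fin n => x i) (fun i : Fin n => e i)
      ≤ 2 * R ^ 2 * (P.supGain σ n + Real.log (6 * s.card / δ)
          + ((T : ℝ) ^ 2)⁻¹ * Real.log (4 * T / δ)) := by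
  obtain ⟨θ', hθ', hd⟩ := hs.2 θ hθ
  have hσ0 : 0 < σ := zero_lt_one.trans_le hσ
  have : (0 : ℝ) < T := mod_cast hT
  have hε := epsT_pos hT
  have hl := log_four_mul_div_nonneg hT hδ hδ1
  have hx' : ∀ i : Fin n, x i ∈ P.X := fun i => hx i i.2
  have transfer_le : n * epsT T / σ ^ 2 * ((fun i : Fin n => e i) ⬝ᵥ fun i : Fin n => e i)
      ≤ ((T : ℝ) ^ 2)⁻¹ * (R ^ 2 * (2 * Real.log (4 * T / δ))) := by
    calc n * epsT T / σ ^ 2 * ((fun i : Fin n => e i) ⬝ᵥ fun i : Fin n => e i)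
        ≤ T * epsT T / 1 * (T * (R ^ 2 * (2 * Real.log (4 * T / δ)))) := by
          gcongr
          · exact real_dotProduct_self_nonneg _
          · exact one_le_pow₀ hσ
          · exact (hg.dotProduct_self_le hT hδ hδ1 hn).trans (by gcongr)
      _ = ((T : ℝ) ^ 2)⁻¹ * (R ^ 2 * (2 * Real.log (4 * T / δ))) := by
          unfold epsT
          field_simp
  calc explained (P.ker θ) σ (fun i : Fin n => x i) (fun i : Fin n => e i)
      ≤ explained (P.ker θ') σ (fun i : Fin n => x i) (fun i : Fin n => e i)
        + n * epsT T / σ ^ 2 * ((fun i : Fin n => e i) ⬝ᵥ fun i : Fin n => e i) :=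
        explained_le_of_gram_le (P.ker_psd hθ) (P.ker_psd (hs.1 hθ')) hσ0 _ (by positivity)
          (P.gram_quad_le hd hx') _
    _ ≤ 2 * R ^ 2 * (P.supGain σ n + Real.log (6 * s.card / δ))
        + ((T : ℝ) ^ 2)⁻¹ * (R ^ 2 * (2 * Real.log (4 * T / δ))) := by
        refine add_le_add ((hg.1 θ' hθ' n hn).trans ?_) transfer_le
        gcongr
        exact P.infoGain_le_supGain hσ (hs.1 hθ') _ hx'
    _ = _ := by ring

lemma GoodNoise.abs_sub_postMean_le (hg : GoodNoise P σ R δ T s x e) (hR : 0 ≤ R) (hσ : 1 ≤ σ)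
    (hT : 1 ≤ T) (hδ : 0 < δ) (hδ1 : δ ≤ 1) (hs : P.IsNet (epsT T) ↑s) (hs1 : 1 ≤ s.card) {n : ℕ}
    (hn : n ≤ T) (hx : ∀ i < n, x i ∈ P.X) {θ : Fin m → ℝ} (hθ : θ ∈ P.Θ)
    {f : EuclideanSpace ℝ (Fin d) → ℝ} {B : ℝ} (hB : 0 ≤ B) (hf : InRKHSBall P.X (P.ker θ) B f)
    {z : EuclideanSpace ℝ (Fin d)} (hz : z ∈ P.X) :
    |f z - postMean (P.ker θ) σ (fun i : Fin n => x i) (fun i : Fin n => f (x i) + e i) z|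
      ≤ (B + R * noiseWidth P σ δ T s.card n) * postStd (P.ker θ) σ (fun i : Fin n => x i) z := by
  have hσ0 : 0 < σ := zero_lt_one.trans_le hσ
  have hk := P.ker_psd hθ
  have sqrt_explained_le : √(explained (P.ker θ) σ (fun i : Fin n => x i) fun i : Fin n => e i)
      ≤ R * noiseWidth P σ δ T s.card n := by
    refine Real.sqrt_le_iff.2 ⟨mul_nonneg hR (noiseWidth_nonneg ..),
      (hg.explained_le hσ hT hδ hδ1 hs hn hx hθ).trans ?_⟩
    rw [mul_pow, mul_comm 2, mul_assoc]
    gcongr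
    exact le_noiseWidth_sq hσ0 hT hs1 hδ hδ1
  change |f z - postMean _ _ _ ((fun i : Fin n => f (x i)) + fun i : Fin n => e i) z| ≤ _
  rw [postMean_add, ← sub_sub]
  set S := postStd (P.ker θ) σ (fun i : Fin n => x i) z
  have hS : 0 ≤ S := Real.sqrt_nonneg _
  calc _ ≤ |f z - postMean (P.ker θ) σ (fun i : Fin n => x i) (fun i : Fin n => f (x i)) z|
        + |postMean (P.ker θ) σ (fun i : Fin n => x i) (fun i : Fin n => e i) z| := abs_sub _ _
    _ ≤ B * S + S / σ * √(explained (P.ker θ) σ (fun i : Fin n => x i) fun i : Fin n => e i) :=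
        add_le_add (OSCBO.abs_sub_postMean_le hk hσ0 hB (fun _ y hy => hf.sq_dotProduct_le y hy) _
          (fun i => hx i i.2) hz) (abs_postMean_le hk hσ0 _ _ z)
    _ ≤ B * S + S * (R * noiseWidth P σ δ T s.card n) := by
        gcongr
        exact div_le_self hS hσ
    _ = _ := by ring

end Confidence

/-! ### Regret on the good event -/

section Regret

variable {d m : ℕ} {P : Problem d m} {c : Config}

/-- The amount by which the confidence width may exceed `betaSqrt`, the noise scale being `1 / T`
larger than `R` so that it is positive. -/
def slack (P : Problem d m) (c : Config) : ℝ :=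
  (c.T : ℝ)⁻¹ * (√(2 * (P.supGain c.σ (c.T - 1) + Real.log (6 * P.covNum (epsT c.T) / c.δ)))
    + (c.R + 1) * √(2 * Real.log (4 * c.T / c.δ)))

lemma slack_nonneg (hR : 0 ≤ c.R) : 0 ≤ slack P c := by
  unfold slack
  positivity

lemma add_mul_noiseWidth_le (hR : 0 ≤ c.R) (hσ : 1 ≤ c.σ) {n : ℕ} (hn : n < c.T) :
    c.B + (c.R + (c.T : ℝ)⁻¹) * noiseWidth P c.σ c.δ c.T (P.covNum (epsT c.T)) n
      ≤ betaSqrt P c n + slack P c := by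
  have hΓ := P.supGain_mono hσ (Nat.le_sub_one_of_lt hn)
  have hT : (c.T : ℝ)⁻¹ ≤ 1 := inv_le_one_of_one_le₀ (mod_cast (Nat.zero_le n).trans_lt hn)
  rw [betaSqrt, slack, noiseWidth]
  set l := Real.log (6 * P.covNum (epsT c.T) / c.δ)
  set v := √(2 * Real.log (4 * c.T / c.δ))
  calc c.B + (c.R + (c.T : ℝ)⁻¹) * (√(2 * (P.supGain c.σ n + l)) + (c.T : ℝ)⁻¹ * v)
      = c.B + c.R * √(2 * (P.supGain c.σ n + l)) + (c.T : ℝ)⁻¹ * √(2 * (P.supGain c.σ n + l))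
        + (c.R + (c.T : ℝ)⁻¹) * ((c.T : ℝ)⁻¹ * v) := by ring
    _ ≤ c.B + c.R * √(2 * (P.supGain c.σ n + 1 + l))
        + (c.T : ℝ)⁻¹ * √(2 * (P.supGain c.σ (c.T - 1) + l))
        + (c.R + 1) * ((c.T : ℝ)⁻¹ * v) := by
        gcongr
        linarith
    _ = _ := by ring

lemma one_le_rpow_three_quarters {T : ℕ} (hT : 1 ≤ T) : 1 ≤ (T : ℝ) ^ (3 / 4 : ℝ) :=
  Real.one_le_rpow (mod_cast hT) (by norm_num)

lemma log_four_mul_div_le {N T : ℕ} {δ : ℝ} (hN : 1 ≤ N) (hT : 1 ≤ T) (hδ : 0 < δ) (hδ1 : δ ≤ 1) :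
    Real.log (4 * T / δ) ≤ Real.log (6 * N / δ) * T := by
  have hN' : (1 : ℝ) ≤ N := mod_cast hN
  have hT' : (1 : ℝ) ≤ T := mod_cast hT
  have hl := one_le_log_six_mul_div hN hδ hδ1
  calc Real.log (4 * T / δ) = Real.log (4 / δ) + Real.log T := by
        rw [← Real.log_mul (by positivity) (by positivity), div_mul_eq_mul_div]
    _ ≤ Real.log (6 * N / δ) + (T - 1) := by
        gcongr
        · linarith
        · exact Real.log_le_sub_one_of_pos (by linarith)
    _ ≤ Real.log (6 * N / δ) * T := by nlinarith

lemma mul_slack_le (hR : 0 ≤ c.R) (hσ : 1 ≤ c.σ) (hδ : 0 < c.δ) (hδ1 : c.δ ≤ 1) (hT : 1 ≤ c.T) :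
    c.T * slack P c ≤ 2 * (c.R + 2) *
      √(P.supGain c.σ (c.T - 1) + Real.log (6 * P.covNum (epsT c.T) / c.δ))
        * (c.T : ℝ) ^ (3 / 4 : ℝ) := by
  have hTr : (1 : ℝ) ≤ c.T := mod_cast hT
  have hT0 : (0 : ℝ) < c.T := mod_cast hT
  have hN := P.one_le_covNum (epsT_pos hT) (epsT_le_one hT)
  have hl := one_le_log_six_mul_div hN hδ hδ1
  have hlT := log_four_mul_div_le hN hT hδ hδ1
  have hΓ := P.supGain_nonneg (zero_lt_one.trans_le hσ) (c.T - 1)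
  rw [slack, ← mul_assoc, mul_inv_cancel₀ hT0.ne', one_mul]
  set l := Real.log (6 * P.covNum (epsT c.T) / c.δ)
  set S := √(P.supGain c.σ (c.T - 1) + l)
  set U := (c.T : ℝ) ^ (3 / 4 : ℝ) with hU
  have one_le_U : 1 ≤ U := one_le_rpow_three_quarters hT
  have sq_S : S ^ 2 = P.supGain c.σ (c.T - 1) + l := Real.sq_sqrt (by positivity)
  have T_le_sq_U : (c.T : ℝ) ≤ U ^ 2 := by
    rw [hU, ← Real.rpow_natCast, ← Real.rpow_mul hT0.le]
    exact Real.self_le_rpow_of_one_le hTr (by norm_num)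
  have sqrt_log_le : √(2 * Real.log (4 * c.T / c.δ)) ≤ 2 * S * U := by
    refine Real.sqrt_le_iff.2 ⟨by positivity, ?_⟩
    calc 2 * Real.log (4 * c.T / c.δ) ≤ 4 * (S ^ 2 * c.T) := by rw [sq_S]; nlinarith
      _ ≤ 4 * (S ^ 2 * U ^ 2) := by gcongr
      _ = (2 * S * U) ^ 2 := by ring
  have sqrt_two_mul_le : √(2 * (P.supGain c.σ (c.T - 1) + l)) ≤ 2 * S := by
    refine Real.sqrt_le_iff.2 ⟨by positivity, ?_⟩
    rw [mul_pow, sq_S]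
    linarith
  calc _ ≤ 2 * S * U + (c.R + 1) * (2 * S * U) := by
        gcongr
        exact sqrt_two_mul_le.trans (le_mul_of_one_le_right (by positivity) one_le_U)
    _ = _ := by ring

lemma betaSqrt_le (hR : 0 ≤ c.R) (hσ : 1 ≤ c.σ) (hB : 0 ≤ c.B) (hδ : 0 < c.δ) (hδ1 : c.δ ≤ 1)
    {n : ℕ} (hn : n < c.T) :
    betaSqrt P c n ≤ (1 + 2 * c.R) *
      (c.B + √(P.supGain c.σ (c.T - 1) + Real.log (6 * P.covNum (epsT c.T) / c.δ))) := by
  have hT : 1 ≤ c.T := (Nat.zero_le n).trans_lt hn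
  have hl := one_le_log_six_mul_div (P.one_le_covNum (epsT_pos hT) (epsT_le_one hT)) hδ hδ1
  have hΓ := P.supGain_mono hσ (Nat.le_sub_one_of_lt hn)
  have hΓ0 := P.supGain_nonneg (zero_lt_one.trans_le hσ) (c.T - 1)
  rw [betaSqrt]
  set l := Real.log (6 * P.covNum (epsT c.T) / c.δ)
  set S := √(P.supGain c.σ (c.T - 1) + l) with hS
  have sqrt_le : √(2 * (P.supGain c.σ n + 1 + l)) ≤ 2 * S := by
    refine Real.sqrt_le_iff.2 ⟨by positivity, ?_⟩
    rw [mul_pow, hS, Real.sq_sqrt (by positivity)]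
    linarith
  calc c.B + c.R * √(2 * (P.supGain c.σ n + 1 + l)) ≤ c.B + c.R * (2 * S) := by gcongr
    _ ≤ c.B + c.R * (2 * S) + (S + 2 * c.R * c.B) := le_add_of_nonneg_right (by positivity)
    _ = (1 + 2 * c.R) * (c.B + S) := by ring

lemma sub_le_of_isMaxOn_ucb {α : Type*} {X : Set α} {f μ s : α → ℝ} {β η : ℝ} (hη : 0 ≤ η)
    (hconf : ∀ z ∈ X, |f z - μ z| ≤ (β + η) * s z) (hs : ∀ z ∈ X, s z ≤ 1) {x z : α}
    (hx : x ∈ X) (hz : z ∈ X) (hmax : IsMaxOn (fun z => μ z + β * s z) X x) :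
    f z - f x ≤ 2 * β * s x + 2 * η := by
  have upper := (abs_le.1 (hconf z hz)).2
  have lower := (abs_le.1 (hconf x hx)).1
  have hzx : μ z + β * s z ≤ μ x + β * s x := hmax hz
  nlinarith [mul_le_mul_of_nonneg_left (hs z hz) hη, mul_le_mul_of_nonneg_left (hs x hx) hη]

/-- A run of the UCB rule in which the hyperparameters `th n` used in round `n + 1` are arbitrary
elements of `Θ`: no assumption is made on how they are chosen, not even measurability. The
`σ`-algebra `ℱ n` is the information available when the noise of round `n + 1` is observed. -/
structure UCBRun {Ω : Type*} [mΩ : MeasurableSpace Ω] (μ : Measure Ω) (P : Problem d m)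
    (c : Config) (f : EuclideanSpace ℝ (Fin d) → ℝ) where
  x : ℕ → Ω → EuclideanSpace ℝ (Fin d)
  y : ℕ → Ω → ℝ
  noise : ℕ → Ω → ℝ
  th : ℕ → Ω → Fin m → ℝ
  ℱ : Filtration ℕ mΩ
  x_meas : ∀ n < c.T, Measurable[ℱ n] (x n)
  noise_meas : ∀ n < c.T, Measurable[ℱ (n + 1)] (noise n)
  obs : ∀ n < c.T, ∀ ω, y n ω = f (x n ω) + noise n ω
  noise_subG : ∀ n < c.T, CondSubgaussian (ℱ n) μ (noise n) c.R
  th_mem : ∀ n < c.T, ∀ ω, th n ω ∈ P.Θ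
  x_mem : ∀ n < c.T, ∀ ω, x n ω ∈ P.X
  x_max : ∀ n < c.T, ∀ ω, IsMaxOn (fun z =>
    postMean (P.ker (th n ω)) c.σ (fun i : Fin n => x i ω) (fun i : Fin n => y i ω) z
      + betaSqrt P c n * postStd (P.ker (th n ω)) c.σ (fun i : Fin n => x i ω) z) P.X (x n ω)

variable {Ω : Type*} [MeasurableSpace Ω] {μ : Measure Ω} {f : EuclideanSpace ℝ (Fin d) → ℝ}

/-- Cumulative regret of a UCB run after `c.T` rounds, relative to the point `z`. -/
def UCBRun.regret (r : UCBRun μ P c f) (z : EuclideanSpace ℝ (Fin d)) (ω : Ω) : ℝ :=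
  ∑ n ∈ Finset.range c.T, (f z - f (r.x n ω))

/-- Posterior standard deviation at the query of round `n + 1`, under the hyperparameters used in
that round. -/
def UCBRun.std (r : UCBRun μ P c f) (n : ℕ) (ω : Ω) : ℝ :=
  postStd (P.ker (r.th n ω)) c.σ (fun i : Fin n => r.x i ω) (r.x n ω)

lemma UCBRun.instant_regret_le (r : UCBRun μ P c f) (hR : 0 ≤ c.R) (hσ : 1 ≤ c.σ) (hB : 0 ≤ c.B)
    (hδ : 0 < c.δ) (hδ1 : c.δ ≤ 1) (hf : ∀ θ ∈ P.Θ, InRKHSBall P.X (P.ker θ) c.B f)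
    {z : EuclideanSpace ℝ (Fin d)} (hz : z ∈ P.X) {s : Finset (Fin m → ℝ)}
    (hs : P.IsNet (epsT c.T) ↑s) (hcard : s.card = P.covNum (epsT c.T)) {ω : Ω}
    (hg : GoodNoise P c.σ (c.R + (c.T : ℝ)⁻¹) c.δ c.T s (fun n => r.x n ω) (fun n => r.noise n ω))
    {n : ℕ} (hn : n < c.T) :
    f z - f (r.x n ω) ≤ 2 * betaSqrt P c n * r.std n ω + 2 * slack P c := by
  have hT : 1 ≤ c.T := (Nat.zero_le n).trans_lt hn
  have hθ := r.th_mem n hn ω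
  have hs1 : 1 ≤ s.card := hcard ▸ P.one_le_covNum (epsT_pos hT) (epsT_le_one hT)
  have observations : (fun i : Fin n => r.y i ω) = fun i : Fin n => f (r.x i ω) + r.noise i ω :=
    funext fun i => r.obs i (i.2.trans hn) ω
  refine sub_le_of_isMaxOn_ucb (slack_nonneg hR) (fun w hw => ?_) (fun w _ => ?_)
    (r.x_mem n hn ω) hz (r.x_max n hn ω)
  · rw [observations]
    refine (hg.abs_sub_postMean_le (by positivity) hσ hT hδ hδ1 hs hs1 hn.le
      (fun i hi => r.x_mem i (hi.trans hn) ω) hθ hB (hf _ hθ) hw).trans ?_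
    rw [hcard]
    exact mul_le_mul_of_nonneg_right (add_mul_noiseWidth_le hR hσ hn) (Real.sqrt_nonneg _)
  · exact Real.sqrt_le_one.2 ((postVar_le_diag (P.ker_psd hθ) (zero_lt_one.trans_le hσ) _ w).trans
      (P.ker_le_one _ _ _))

-- Comparability of the kernels lets one hyperparameter account for the variances under all others.
lemma UCBRun.sum_sq_std_le (r : UCBRun μ P c f) (hσ : 1 ≤ c.σ) {b : ℝ} (hb : 1 ≤ b)
    (hcmp : ∀ θ ∈ P.Θ, ∀ θ' ∈ P.Θ, KernelLE (P.ker θ') (P.ker θ) b) {θ : Fin m → ℝ}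
    (hθ : θ ∈ P.Θ) (ω : Ω) :
    ∑ n ∈ Finset.range c.T, r.std n ω ^ 2 ≤ b * (4 * c.σ ^ 2 * P.gain c.σ c.T θ) := by
  have hσ0 : 0 < c.σ := zero_lt_one.trans_le hσ
  have hk := P.ker_psd hθ
  calc ∑ n ∈ Finset.range c.T, r.std n ω ^ 2
      ≤ ∑ n ∈ Finset.range c.T,
          b * postVar (P.ker θ) c.σ (fun i : Fin n => r.x i ω) (r.x n ω) := by
        refine Finset.sum_le_sum fun n hn => ?_
        have hθn := r.th_mem n (Finset.mem_range.1 hn) ω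
        rw [UCBRun.std, postStd, Real.sq_sqrt (postVar_nonneg (P.ker_psd hθn) hσ0 _ _)]
        exact postVar_le_of_kernelLE (P.ker_psd hθn) hk (hcmp θ hθ _ hθn) hb hσ0 _ _
    _ ≤ b * (4 * c.σ ^ 2 * P.gain c.σ c.T θ) := by
        rw [← Finset.mul_sum]
        gcongr
        refine (sum_postVar_le hk hσ0 (P.ker_self_le_sq hσ θ) (fun n => r.x n ω) c.T).trans ?_
        gcongr
        exact P.infoGain_le_gain hσ hθ _ fun i => r.x_mem i i.2 ω

lemma UCBRun.sum_std_le (r : UCBRun μ P c f) (hσ : 1 ≤ c.σ) {b : ℝ} (hb : 1 ≤ b)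
    (hcmp : ∀ θ ∈ P.Θ, ∀ θ' ∈ P.Θ, KernelLE (P.ker θ') (P.ker θ) b) {θ : Fin m → ℝ}
    (hθ : θ ∈ P.Θ) (ω : Ω) :
    ∑ n ∈ Finset.range c.T, r.std n ω ≤ 2 * (√b * c.σ) * √(c.T * P.gain c.σ c.T θ) := by
  have cauchy_schwarz := sq_sum_le_card_mul_sum_sq (s := Finset.range c.T) (f := (r.std · ω))
  rw [Finset.card_range] at cauchy_schwarz
  calc ∑ n ∈ Finset.range c.T, r.std n ω
      ≤ √(c.T * (b * (4 * c.σ ^ 2 * P.gain c.σ c.T θ))) :=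
        Real.le_sqrt_of_sq_le (cauchy_schwarz.trans
          (mul_le_mul_of_nonneg_left (r.sum_sq_std_le hσ hb hcmp hθ ω) (Nat.cast_nonneg _)))
    _ = √((2 * (√b * c.σ)) ^ 2 * (c.T * P.gain c.σ c.T θ)) := by
        congr 1
        rw [mul_pow, mul_pow, Real.sq_sqrt (by linarith)]
        ring
    _ = 2 * (√b * c.σ) * √(c.T * P.gain c.σ c.T θ) := by
        rw [Real.sqrt_mul (sq_nonneg _), Real.sqrt_sq (by positivity)]

lemma UCBRun.regret_le (r : UCBRun μ P c f) (hR : 0 ≤ c.R) (hσ : 1 ≤ c.σ) (hB : 0 ≤ c.B)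
    (hδ : 0 < c.δ) (hδ1 : c.δ ≤ 1) (hT : 1 ≤ c.T)
    (hf : ∀ θ ∈ P.Θ, InRKHSBall P.X (P.ker θ) c.B f) {z : EuclideanSpace ℝ (Fin d)} (hz : z ∈ P.X)
    {b : ℝ} (hb : 1 ≤ b) (hcmp : ∀ θ ∈ P.Θ, ∀ θ' ∈ P.Θ, KernelLE (P.ker θ') (P.ker θ) b)
    {θ : Fin m → ℝ} (hθ : θ ∈ P.Θ) {s : Finset (Fin m → ℝ)} (hs : P.IsNet (epsT c.T) ↑s)
    (hcard : s.card = P.covNum (epsT c.T)) {ω : Ω}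
    (hg : GoodNoise P c.σ (c.R + (c.T : ℝ)⁻¹) c.δ c.T s (fun n => r.x n ω)
      (fun n => r.noise n ω)) :
    r.regret z ω ≤ (4 * (1 + 2 * c.R) * (√b * c.σ) + 4 * (c.R + 2)) *
      regretRate P c.σ c.B c.δ c.T θ := by
  have hslack := mul_slack_le (P := P) hR hσ hδ hδ1 hT
  rw [regretRate]
  set S := √(P.supGain c.σ (c.T - 1) + Real.log (6 * P.covNum (epsT c.T) / c.δ))
  set Q := √(c.T * P.gain c.σ c.T θ)
  set U := (c.T : ℝ) ^ (3 / 4 : ℝ)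
  have instant_le : ∀ n ∈ Finset.range c.T, f z - f (r.x n ω)
      ≤ 2 * ((1 + 2 * c.R) * (c.B + S)) * r.std n ω + 2 * slack P c := by
    intro n hn
    have hn' := Finset.mem_range.1 hn
    refine (r.instant_regret_le hR hσ hB hδ hδ1 hf hz hs hcard hg hn').trans ?_
    gcongr
    · exact Real.sqrt_nonneg _
    · exact betaSqrt_le hR hσ hB hδ hδ1 hn'
  calc r.regret z ω
      ≤ ∑ n ∈ Finset.range c.T,
          (2 * ((1 + 2 * c.R) * (c.B + S)) * r.std n ω + 2 * slack P c) :=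
        Finset.sum_le_sum instant_le
    _ = 2 * ((1 + 2 * c.R) * (c.B + S)) * ∑ n ∈ Finset.range c.T, r.std n ω
        + 2 * (c.T * slack P c) := by
        rw [Finset.sum_add_distrib, ← Finset.mul_sum, Finset.sum_const, Finset.card_range,
          nsmul_eq_mul]
        ring
    _ ≤ 2 * ((1 + 2 * c.R) * (c.B + S)) * (2 * (√b * c.σ) * Q) + 2 * (2 * (c.R + 2) * S * U) := by
        gcongr
        exact r.sum_std_le hσ hb hcmp hθ ω
    _ = 4 * (1 + 2 * c.R) * (√b * c.σ) * ((c.B + S) * Q) + 4 * (c.R + 2) * (S * U) := by ring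
    _ ≤ 4 * (1 + 2 * c.R) * (√b * c.σ) * ((c.B + S) * (U + Q))
        + 4 * (c.R + 2) * ((c.B + S) * (U + Q)) := by
        gcongr
        · exact le_add_of_nonneg_left (by positivity)
        · exact le_add_of_nonneg_left hB
        · exact le_add_of_nonneg_right (by positivity)
    _ = _ := by ring

lemma UCBRun.measure_goodNoise_ge [IsProbabilityMeasure μ] (r : UCBRun μ P c f) (hR : 0 ≤ c.R)
    (hσ : 0 < c.σ) (hδ : 0 < c.δ) (hδ1 : c.δ ≤ 1) (hT : 1 ≤ c.T) {s : Finset (Fin m → ℝ)}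
    (hs : ∀ θ ∈ s, θ ∈ P.Θ) :
    ENNReal.ofReal (1 - c.δ) ≤ μ {ω | GoodNoise P c.σ (c.R + (c.T : ℝ)⁻¹) c.δ c.T s
      (fun n => r.x n ω) (fun n => r.noise n ω)} := by
  have : (0 : ℝ) < c.T := mod_cast hT
  exact OSCBO.measure_goodNoise_ge hσ (by positivity) hδ hδ1 r.x_meas r.noise_meas
    (fun n hn => (r.noise_subG n hn).mono hR (le_add_of_nonneg_right (by positivity))) hs

lemma UCBRun.measure_regret_le_ge [IsProbabilityMeasure μ] (r : UCBRun μ P c f) (hR : 0 ≤ c.R)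
    (hσ : 1 ≤ c.σ) (hB : 0 ≤ c.B) (hδ : 0 < c.δ) (hδ1 : c.δ ≤ 1) (hT : 1 ≤ c.T)
    (hf : ∀ θ ∈ P.Θ, InRKHSBall P.X (P.ker θ) c.B f) {z : EuclideanSpace ℝ (Fin d)} (hz : z ∈ P.X)
    {b : ℝ} (hb : 1 ≤ b) (hcmp : ∀ θ ∈ P.Θ, ∀ θ' ∈ P.Θ, KernelLE (P.ker θ') (P.ker θ) b)
    {θ : Fin m → ℝ} (hθ : θ ∈ P.Θ) :
    ENNReal.ofReal (1 - c.δ) ≤ μ {ω | r.regret z ω ≤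
      (4 * (1 + 2 * c.R) * (√b * c.σ) + 4 * (c.R + 2)) * regretRate P c.σ c.B c.δ c.T θ} := by
  obtain ⟨s, hs, hcard⟩ := P.exists_min_net (epsT_pos hT) (epsT_le_one hT)
  exact (r.measure_goodNoise_ge hR (by linarith) hδ hδ1 hT fun θ hθ => hs.1 hθ).trans
    (measure_mono fun ω hω => r.regret_le hR hσ hB hδ hδ1 hT hf hz hb hcmp hθ hs hcard hω)

/-- Forgetting how the learners arrive at their hyperparameters turns a run of OSCBO into a run of
the UCB rule. -/
def Run.toUCBRun {a : Tuning} (r : Run μ P c a f) : UCBRun μ P c f where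
  x := r.x
  y := r.y
  noise := r.noise
  th := r.th
  ℱ := r.ℱ
  x_meas := r.x_meas
  noise_meas := r.noise_meas
  obs := r.obs
  noise_subG n hn := ⟨r.noise_integrable n hn, r.noise_subG n hn⟩
  th_mem n hn ω := r.act_net.1 (r.th_mem n hn ω)
  x_mem := r.x_mem
  x_max := r.x_max

end Regret

/-! ### Determinants of perturbed low-rank matrices -/

section LogDet

open Matrix

variable {κ : Type*} [Fintype κ]

lemma prod_one_add_le_pow {l : κ → ℝ} {t : ℝ} (hl : ∀ i, 0 ≤ l i) (ht : ∀ i, l i ≤ t) :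
    ∏ i, (1 + l i) ≤ (1 + t) ^ Fintype.card {i // l i ≠ 0} := by
  classical
  rw [Fintype.card_subtype, ← Finset.prod_const, Finset.prod_filter]
  refine Finset.prod_le_prod (fun i _ => add_nonneg zero_le_one (hl i)) fun i _ => ?_
  split_ifs with h
  · exact add_le_add_right (ht i) 1
  · rw [not_not.1 h, add_zero]

open scoped MatrixOrder in
lemma exists_eq_conjTranspose_mul_self {M : Matrix κ κ ℝ} (hM : M.PosSemidef) :
    ∃ Y : Matrix κ κ ℝ, M = Yᴴ * Y := by
  classical
  exact CStarAlgebra.nonneg_iff_eq_star_mul_self.mp hM.nonneg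

lemma trace_mul_nonneg {M Z : Matrix κ κ ℝ} (hM : M.PosSemidef) (hZ : Z.PosSemidef) :
    0 ≤ (M * Z).trace := by
  obtain ⟨Y, rfl⟩ := exists_eq_conjTranspose_mul_self hM
  rw [Matrix.mul_assoc, trace_mul_comm]
  exact (hZ.mul_mul_conjTranspose_same Y).trace_nonneg

variable [DecidableEq κ]

lemma det_one_add_eq_prod {M : Matrix κ κ ℝ} (hM : M.IsHermitian) :
    (1 + M).det = ∏ i, (1 + hM.eigenvalues i) := by
  have h := congrArg (Polynomial.eval (-1)) hM.charpoly_eq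
  have scalar_sub : scalar κ (-1 : ℝ) - M = -(1 + M) := by
    rw [map_neg, map_one, neg_add, sub_eq_add_neg]
  have sub_eigenvalue : ∀ i, -1 - hM.eigenvalues i = -(1 + hM.eigenvalues i) := fun i => by ring
  simp only [eval_charpoly, Polynomial.eval_prod, Polynomial.eval_sub, Polynomial.eval_X,
    Polynomial.eval_C, RCLike.ofReal_real_eq_id, id, scalar_sub, sub_eigenvalue, det_neg,
    Finset.prod_neg, Finset.card_univ] at h
  exact mul_left_cancel₀ (pow_ne_zero _ (by norm_num)) h

lemma det_one_add_le_pow {M : Matrix κ κ ℝ} (hM : M.PosSemidef) {D : ℕ} (hD : M.rank ≤ D) :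
    (1 + M).det ≤ (1 + M.trace) ^ D := by
  have hl := hM.eigenvalues_nonneg
  have eigenvalue_le : ∀ i, hM.1.eigenvalues i ≤ M.trace := by
    intro i
    rw [show M.trace = ∑ i, hM.1.eigenvalues i by simpa using hM.1.trace_eq_sum_eigenvalues]
    exact Finset.single_le_sum (fun j _ => hl j) (Finset.mem_univ i)
  rw [det_one_add_eq_prod hM.1]
  exact (prod_one_add_le_pow hl eigenvalue_le).trans
    (pow_le_pow_right₀ (le_add_of_nonneg_right hM.trace_nonneg)
      (hM.1.rank_eq_card_non_zero_eigs ▸ hD))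

lemma log_det_le_trace_sub {M : Matrix κ κ ℝ} (hM : M.PosDef) :
    Real.log M.det ≤ M.trace - Fintype.card κ := by
  have hdet : M.det = ∏ i, hM.1.eigenvalues i := by simpa using hM.1.det_eq_prod_eigenvalues
  have htrace : M.trace = ∑ i, hM.1.eigenvalues i := by simpa using hM.1.trace_eq_sum_eigenvalues
  rw [hdet, htrace, Real.log_prod fun i _ => (hM.eigenvalues_pos i).ne']
  calc ∑ i, Real.log (hM.1.eigenvalues i) ≤ ∑ i, (hM.1.eigenvalues i - 1) :=
        Finset.sum_le_sum fun i _ => Real.log_le_sub_one_of_pos (hM.eigenvalues_pos i)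
    _ = _ := by simp

lemma log_det_le_log_det_add {X S : Matrix κ κ ℝ} (hX : X.PosDef) (hS : S.PosDef) :
    Real.log X.det ≤ Real.log S.det + ((S⁻¹ * X).trace - Fintype.card κ) := by
  obtain ⟨Y, hY⟩ := exists_eq_conjTranspose_mul_self hS.inv.posSemidef
  have hdetS := hS.det_pos
  have hdetX := hX.det_pos
  have hdet : (Y * X * Yᴴ).det = S.det⁻¹ * X.det := by
    rw [det_mul, det_mul, mul_comm, ← mul_assoc, ← det_mul, ← hY, det_nonsing_inv,
      Ring.inverse_eq_inv']
  have htrace : (Y * X * Yᴴ).trace = (S⁻¹ * X).trace := by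
    rw [trace_mul_comm, ← Matrix.mul_assoc, ← hY]
  have hpd : (Y * X * Yᴴ).PosDef :=
    (hX.posSemidef.mul_mul_conjTranspose_same Y).posDef_iff_det_ne_zero.2
      (by rw [hdet]; positivity)
  have h := log_det_le_trace_sub hpd
  rw [hdet, htrace, Real.log_mul (inv_pos.2 hdetS).ne' hdetX.ne', Real.log_inv] at h
  linarith

lemma one_sub_inv_posSemidef {M : Matrix κ κ ℝ} (hM : M.PosSemidef) :
    (1 - (1 + M)⁻¹).PosSemidef := by
  have hS : (1 + M).PosDef := PosDef.one.add_posSemidef hM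
  have hu : IsUnit (1 + M).det := hS.det_pos.ne'.isUnit
  have sq_psd : (M * M).PosSemidef := by
    simpa only [hM.1.eq] using posSemidef_conjTranspose_mul_self M
  have conj_psd := (hM.add sq_psd).conjTranspose_mul_mul_same (1 + M)⁻¹
  have hconj : (1 + M)⁻¹ * (M + M * M) * (1 + M)⁻¹ = 1 - (1 + M)⁻¹ := by
    rw [show M + M * M = (1 + M) * ((1 + M) - 1) by noncomm_ring, ← Matrix.mul_assoc,
      nonsing_inv_mul _ hu, Matrix.one_mul, Matrix.sub_mul, mul_nonsing_inv _ hu, Matrix.one_mul]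
  rwa [hS.inv.1.eq, hconj] at conj_psd

lemma log_det_one_add_le {A M Q : Matrix κ κ ℝ} (hA : A.PosSemidef) (hM : M.PosSemidef)
    (hQ : Q.PosSemidef) (h : (M + Q - A).PosSemidef) :
    Real.log (1 + A).det ≤ Real.log (1 + M).det + Q.trace := by
  have hS : (1 + M).PosDef := PosDef.one.add_posSemidef hM
  have hu : IsUnit (1 + M).det := hS.det_pos.ne'.isUnit
  have hlog := log_det_le_log_det_add (PosDef.one.add_posSemidef hA) hS
  have hgap := trace_mul_nonneg hS.inv.posSemidef h
  have hQ_le := trace_mul_nonneg (one_sub_inv_posSemidef hM) hQ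
  have hsplit : (1 + M)⁻¹ * (1 + A) = 1 + (1 + M)⁻¹ * Q - (1 + M)⁻¹ * (M + Q - A) := by
    rw [show 1 + A = (1 + M) + Q - (M + Q - A) by abel, Matrix.mul_sub, Matrix.mul_add,
      nonsing_inv_mul _ hu]
  rw [hsplit, trace_sub, trace_add, trace_one] at hlog
  rw [Matrix.sub_mul, Matrix.one_mul, trace_sub] at hQ_le
  linarith

end LogDet

section Gram

open Matrix

variable {κ ι H : Type*} [Fintype κ] [NormedAddCommGroup H] [InnerProductSpace ℝ H]

lemma rank_gram_le [Fintype ι] {p : κ → H} {g : ι → H}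
    (h : ∀ i, p i ∈ Submodule.span ℝ (Set.range g)) :
    (Matrix.gram ℝ p).rank ≤ Fintype.card ι := by
  choose V hV using fun i => (Submodule.mem_span_range_iff_exists_fun ℝ).1 (h i)
  have factor : Matrix.gram ℝ p = of V * (Matrix.gram ℝ g * (of V)ᵀ) := by
    ext i j
    simp only [gram_apply, mul_apply, of_apply, transpose_apply, ← hV, sum_inner, inner_sum,
      real_inner_smul_left, real_inner_smul_right, Finset.mul_sum]
    rw [Finset.sum_comm]
    exact Finset.sum_congr rfl fun α _ => Finset.sum_congr rfl fun β _ => by ring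
  rw [factor]
  exact (rank_mul_le_left _ _).trans (rank_le_card_width _)

lemma trace_gram_le {v : κ → H} {b : ℝ} (hb : ∀ i, ‖v i‖ ^ 2 ≤ b) :
    (Matrix.gram ℝ v).trace ≤ Fintype.card κ * b := by
  simp only [trace, diag_apply, gram_apply, real_inner_self_eq_norm_sq]
  simpa using Finset.sum_le_card_nsmul Finset.univ _ b fun i _ => hb i

omit [Fintype κ] in
lemma two_smul_gram_add_sub_gram (v w : κ → H) :
    (2 : ℝ) • Matrix.gram ℝ v + (2 : ℝ) • Matrix.gram ℝ w - Matrix.gram ℝ (v + w)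
      = Matrix.gram ℝ (v - w) := by
  ext i j
  simp only [Matrix.sub_apply, Matrix.add_apply, Matrix.smul_apply, gram_apply, smul_eq_mul,
    Pi.add_apply, Pi.sub_apply, inner_add_left, inner_add_right, inner_sub_left, inner_sub_right]
  ring

lemma log_det_one_add_gram_le [DecidableEq κ] [Fintype ι] {φ p : κ → H} {g : ι → H} {b η : ℝ}
    (hp : ∀ i, p i ∈ Submodule.span ℝ (Set.range g)) (hb : ∀ i, ‖p i‖ ^ 2 ≤ b)
    (hη : ∀ i, ‖φ i - p i‖ ^ 2 ≤ η) :
    Real.log (1 + Matrix.gram ℝ φ).det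
      ≤ Fintype.card ι * Real.log (1 + Fintype.card κ * (2 * b)) + Fintype.card κ * (2 * η) := by
  set M := (2 : ℝ) • Matrix.gram ℝ p with hM
  set Q := (2 : ℝ) • Matrix.gram ℝ (φ - p) with hQ
  have M_psd : M.PosSemidef := (posSemidef_gram ℝ p).smul zero_le_two
  have Q_psd : Q.PosSemidef := (posSemidef_gram ℝ (φ - p)).smul zero_le_two
  have gram_le : (M + Q - Matrix.gram ℝ φ).PosSemidef := by
    have h := two_smul_gram_add_sub_gram p (φ - p)
    rw [add_sub_cancel] at h
    exact h ▸ posSemidef_gram ℝ _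
  have trace_M : M.trace ≤ Fintype.card κ * (2 * b) := by
    rw [hM, trace_smul, smul_eq_mul]
    linarith [trace_gram_le hb]
  have trace_Q : Q.trace ≤ Fintype.card κ * (2 * η) := by
    rw [hQ, trace_smul, smul_eq_mul]
    linarith [trace_gram_le (v := φ - p) hη]
  have rank_M : M.rank ≤ Fintype.card ι := by
    rw [hM, ← Matrix.mul_one (Matrix.gram ℝ p), ← Matrix.mul_smul]
    exact (rank_mul_le_left _ _).trans (rank_gram_le hp)
  have := M_psd.trace_nonneg
  calc Real.log (1 + Matrix.gram ℝ φ).det ≤ Real.log (1 + M).det + Q.trace :=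
        log_det_one_add_le (posSemidef_gram ℝ φ) M_psd Q_psd gram_le
    _ ≤ Real.log ((1 + M.trace) ^ Fintype.card ι) + Q.trace := by
        gcongr
        · exact (PosDef.one.add_posSemidef M_psd).det_pos
        · exact det_one_add_le_pow M_psd rank_M
    _ ≤ _ := by
        rw [Real.log_pow]
        gcongr

omit [Fintype κ] in
lemma gram_sqrt_smul {c : ℝ} (hc : 0 ≤ c) (v : κ → H) :
    Matrix.gram ℝ (√c • v) = c • Matrix.gram ℝ v := by
  ext i j
  simp only [gram_apply, Matrix.smul_apply, Pi.smul_apply, real_inner_smul_left,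
    real_inner_smul_right, smul_eq_mul, ← mul_assoc, Real.mul_self_sqrt hc]

lemma log_det_one_add_smul_gram_le [DecidableEq κ] [Fintype ι] {φ p : κ → H} {g : ι → H}
    {b η c : ℝ} (hc : 0 ≤ c) (hc1 : c ≤ 1) (hp : ∀ i, p i ∈ Submodule.span ℝ (Set.range g))
    (hb : ∀ i, ‖p i‖ ^ 2 ≤ b) (hη : ∀ i, ‖φ i - p i‖ ^ 2 ≤ η) :
    Real.log (1 + c • Matrix.gram ℝ φ).det
      ≤ Fintype.card ι * Real.log (1 + Fintype.card κ * (2 * b)) + Fintype.card κ * (2 * η) := by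
  have sq_norm_smul_le : ∀ v : H, ‖√c • v‖ ^ 2 ≤ ‖v‖ ^ 2 := fun v => by
    rw [norm_smul, mul_pow, Real.norm_of_nonneg (Real.sqrt_nonneg c), Real.sq_sqrt hc]
    exact mul_le_of_le_one_left (sq_nonneg _) hc1
  rw [← gram_sqrt_smul hc]
  refine log_det_one_add_gram_le (p := √c • p) (fun i => Submodule.smul_mem _ _ (hp i))
    (fun i => (sq_norm_smul_le _).trans (hb i)) fun i => ?_
  rw [Pi.smul_apply, Pi.smul_apply, ← smul_sub]
  exact (sq_norm_smul_le _).trans (hη i)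

end Gram

/-! ### The spectral measure of the Matérn kernel -/

section GammaMeasure

variable {ν : ℝ}

lemma gammaMeasure_eq_withDensity_restrict (a r : ℝ) :
    gammaMeasure a r = (volume.restrict (Set.Ioi 0)).withDensity (gammaPDF a r) := by
  rw [← withDensity_indicator measurableSet_Ioi, gammaMeasure]
  refine withDensity_congr_ae ?_
  filter_upwards [Measure.ae_ne volume (0 : ℝ)] with u hu
  rcases hu.lt_or_gt with hu | hu
  · rw [gammaPDF_of_neg hu, Set.indicator_of_notMem (Set.notMem_Ioi.2 hu.le)]
  · rw [Set.indicator_of_mem (Set.mem_Ioi.2 hu)]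

lemma ae_gammaMeasure_pos (a r : ℝ) : ∀ᵐ u ∂gammaMeasure a r, 0 < u := by
  rw [gammaMeasure_eq_withDensity_restrict]
  exact (withDensity_absolutelyContinuous _ _).ae_le (ae_restrict_mem measurableSet_Ioi)

lemma toReal_gammaPDF_one (hν : 0 < ν) {u : ℝ} (hu : 0 < u) :
    (gammaPDF ν 1 u).toReal = (Real.Gamma ν)⁻¹ * mixDensity ν u := by
  have := Real.Gamma_pos_of_pos hν
  rw [gammaPDF_of_nonneg hu.le, ENNReal.toReal_ofReal (by positivity), mixDensity]
  simp only [Real.one_rpow, one_mul]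
  ring

lemma measurable_gammaPDF (a r : ℝ) : Measurable (gammaPDF a r) :=
  (measurable_gammaPDFReal a r).ennreal_ofReal

lemma integral_gammaMeasure_one (hν : 0 < ν) (h : ℝ → ℝ) :
    ∫ u, h u ∂gammaMeasure ν 1 = (Real.Gamma ν)⁻¹ * ∫ u in Set.Ioi 0, mixDensity ν u * h u := by
  rw [gammaMeasure_eq_withDensity_restrict, integral_withDensity_eq_integral_toReal_smul
    (measurable_gammaPDF ν 1) (Eventually.of_forall fun _ => ENNReal.ofReal_lt_top),
    ← integral_const_mul]
  refine setIntegral_congr_fun measurableSet_Ioi fun u hu => ?_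
  rw [toReal_gammaPDF_one hν hu, smul_eq_mul, mul_assoc]

lemma integrable_gammaMeasure_one (hν : 0 < ν) {h : ℝ → ℝ}
    (hh : IntegrableOn (fun u => mixDensity ν u * h u) (Set.Ioi 0)) :
    Integrable h (gammaMeasure ν 1) := by
  rw [gammaMeasure_eq_withDensity_restrict, integrable_withDensity_iff_integrable_smul'
    (measurable_gammaPDF ν 1) (Eventually.of_forall fun _ => ENNReal.ofReal_lt_top)]
  refine (hh.const_mul (Real.Gamma ν)⁻¹).congr ?_
  filter_upwards [ae_restrict_mem measurableSet_Ioi] with u hu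
  rw [toReal_gammaPDF_one hν hu, smul_eq_mul, mul_assoc]

lemma integrable_div_rpow_gammaMeasure {κ : ℝ} (hν : 0 < ν) (hκ : κ < ν) :
    Integrable (fun u => (ν / u) ^ κ) (gammaMeasure ν 1) := by
  refine integrable_gammaMeasure_one hν
    (((integrableOn_mixDensity (sub_pos.2 hκ)).const_mul (ν ^ κ)).congr ?_)
  filter_upwards [ae_restrict_mem measurableSet_Ioi] with u (hu : 0 < u)
  rw [mixDensity, mixDensity, Real.div_rpow hν.le hu.le, sub_right_comm, Real.rpow_sub hu]
  ring

end GammaMeasure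

section SpectralMeasure

variable {ν : ℝ} {E : Type*} [NormedAddCommGroup E] [InnerProductSpace ℝ E]
  [FiniteDimensional ℝ E] [MeasurableSpace E] [BorelSpace E]

variable (ν E) in
/-- The spectral measure of the isotropic Matérn kernel of smoothness `ν` on `E`: the law of
`√(ν / u) • z`, where `u` has the Gamma law of shape `ν` and `z` is an independent standard
Gaussian vector. -/
def maternSpectralMeasure : Measure E :=
  ((gammaMeasure ν 1).prod (stdGaussian E)).map fun s => √(ν / s.1) • s.2

lemma measurable_sqrt_div_smul : Measurable fun s : ℝ × E => √(ν / s.1) • s.2 := by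
  fun_prop

lemma isProbabilityMeasure_maternSpectralMeasure (hν : 0 < ν) :
    IsProbabilityMeasure (maternSpectralMeasure ν E) := by
  have := isProbabilityMeasure_gammaMeasure hν one_pos
  exact Measure.isProbabilityMeasure_map measurable_sqrt_div_smul.aemeasurable

lemma integral_cexp_stdGaussian (hν : 0 < ν) {u : ℝ} (hu : 0 < u) (ξ : E) :
    ∫ z, Complex.exp (inner ℝ (√(ν / u) • z) ξ * Complex.I) ∂stdGaussian E
      = (Real.exp (-(ν / (2 * u) * ‖ξ‖ ^ 2)) : ℂ) := by
  have := charFun_stdGaussian (√(ν / u) • ξ)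
  simp only [charFun_apply, real_inner_smul_right, ← real_inner_smul_left] at this
  rw [this, norm_smul, Real.norm_of_nonneg (Real.sqrt_nonneg _), Complex.ofReal_exp]
  norm_cast
  rw [mul_pow, Real.sq_sqrt (by positivity)]
  congr 1
  field_simp

lemma charFun_maternSpectralMeasure (hν : 0 < ν) (ξ : E) :
    charFun (maternSpectralMeasure ν E) ξ
      = ((Real.Gamma ν)⁻¹ * maternProfile ν (‖ξ‖ ^ 2) : ℝ) := by
  have := isProbabilityMeasure_gammaMeasure hν one_pos
  have integrable_wave : Integrable (fun s : ℝ × E =>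
      Complex.exp (inner ℝ (√(ν / s.1) • s.2) ξ * Complex.I))
      ((gammaMeasure ν 1).prod (stdGaussian E)) :=
    Integrable.of_bound (by fun_prop) 1
      (Eventually.of_forall fun s => (Complex.norm_exp_ofReal_mul_I _).le)
  rw [charFun_apply, maternSpectralMeasure, integral_map
    measurable_sqrt_div_smul.aemeasurable (by fun_prop), integral_prod _ integrable_wave,
    integral_congr_ae ((ae_gammaMeasure_pos ν 1).mono fun u hu =>
      integral_cexp_stdGaussian hν hu ξ), integral_complex_ofReal, integral_gammaMeasure_one hν]
  rfl

lemma integrable_norm_rpow_maternSpectralMeasure {κ : ℝ} (hν : 0 < ν) (hκ0 : 0 < κ)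
    (hκ : κ < ν) : Integrable (fun w => ‖w‖ ^ (2 * κ)) (maternSpectralMeasure ν E) := by
  have := isProbabilityMeasure_gammaMeasure hν one_pos
  have integrable_gaussian : Integrable (fun z : E => ‖z‖ ^ (2 * κ)) (stdGaussian E) := by
    have := (IsGaussian.memLp_id (stdGaussian E) (ENNReal.ofReal (2 * κ))
      ENNReal.ofReal_ne_top).integrable_norm_rpow (by simpa using hκ0) ENNReal.ofReal_ne_top
    rwa [ENNReal.toReal_ofReal (by positivity)] at this
  rw [maternSpectralMeasure, integrable_map_measure
    (measurable_norm.pow_const _).aestronglyMeasurable measurable_sqrt_div_smul.aemeasurable]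
  refine ((integrable_div_rpow_gammaMeasure hν hκ).mul_prod integrable_gaussian).congr ?_
  filter_upwards [Measure.quasiMeasurePreserving_fst.ae (ae_gammaMeasure_pos ν 1)] with s hs
  have hq : 0 ≤ ν / s.1 := by positivity
  rw [Function.comp_apply, norm_smul, Real.norm_of_nonneg (Real.sqrt_nonneg _),
    Real.mul_rpow (Real.sqrt_nonneg _) (norm_nonneg _), Real.rpow_mul (Real.sqrt_nonneg _),
    Real.rpow_two, Real.sq_sqrt hq]

variable (E) in
lemma exists_maternSpectralMeasure_tail_le {κ : ℝ} (hν : 0 < ν) (hκ0 : 0 < κ) (hκ : κ < ν) :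
    ∃ C : ℝ, 0 ≤ C ∧ ∀ Ω : ℝ, 0 < Ω →
      (maternSpectralMeasure ν E).real {w | Ω < ‖w‖} ≤ C * Ω ^ (-(2 * κ)) := by
  have := isProbabilityMeasure_maternSpectralMeasure (E := E) hν
  refine ⟨∫ w, ‖w‖ ^ (2 * κ) ∂maternSpectralMeasure ν E,
    integral_nonneg fun w => by positivity, fun Ω hΩ => ?_⟩
  have markov := mul_meas_ge_le_integral_of_nonneg
    (Eventually.of_forall fun w : E => by positivity)
    (integrable_norm_rpow_maternSpectralMeasure hν hκ0 hκ) (Ω ^ (2 * κ))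
  rw [Real.rpow_neg hΩ.le, ← div_eq_mul_inv, le_div_iff₀' (by positivity)]
  refine le_trans ?_ markov
  gcongr with w
  · exact measure_ne_top _ _
  · intro h
    exact Real.rpow_le_rpow hΩ.le (le_of_lt h) (by positivity)

end SpectralMeasure

/-! ### Low-rank approximation of plane waves -/

section Exponential

lemma pow_div_factorial_mul_two_le {y ε : ℝ} {N : ℕ} (hy : 0 ≤ y) (hε : 0 < ε)
    (hN : 3 * y + Real.log (2 / ε) ≤ N) : y ^ N / N.factorial * 2 ≤ ε := by
  have exp_le_three_pow : Real.exp N ≤ 3 ^ N := by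
    rw [← Real.exp_one_pow]
    gcongr
    exact Real.exp_one_lt_three.le
  have exp_mul_le : Real.exp (3 * y) * (2 / ε) ≤ Real.exp N := by
    rw [← Real.exp_log (x := 2 / ε) (by positivity), ← Real.exp_add]
    exact Real.exp_le_exp.2 hN
  have : Real.exp N * (y ^ N / N.factorial * (2 / ε)) ≤ Real.exp N * 1 :=
    calc Real.exp N * (y ^ N / N.factorial * (2 / ε))
        ≤ 3 ^ N * (y ^ N / N.factorial * (2 / ε)) := by gcongr
      _ = (3 * y) ^ N / N.factorial * (2 / ε) := by ring
      _ ≤ Real.exp (3 * y) * (2 / ε) := by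
        gcongr
        exact Real.pow_div_factorial_le_exp (x := 3 * y) (by positivity) N
      _ ≤ Real.exp N * 1 := by rwa [mul_one]
  rwa [mul_le_mul_iff_right₀ (Real.exp_pos _), ← mul_div_assoc, div_le_one hε] at this

lemma norm_cexp_sub_sum_range_le {z : ℂ} {y ε : ℝ} {N : ℕ} (hz : ‖z‖ ≤ y) (hε : 0 < ε)
    (hε1 : ε ≤ 1) (hN : 3 * y + Real.log (2 / ε) ≤ N) :
    ‖Complex.exp z - ∑ a ∈ Finset.range N, z ^ a / a.factorial‖ ≤ ε := by
  have hlog : 0 ≤ Real.log (2 / ε) := Real.log_nonneg (by rw [le_div_iff₀ hε]; linarith)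
  have hy : 0 ≤ y := (norm_nonneg z).trans hz
  have hratio : ‖z‖ / (N.succ : ℕ) ≤ 1 / 2 := by
    rw [div_le_iff₀ (by positivity)]
    push_cast
    linarith
  calc _ ≤ ‖z‖ ^ N / N.factorial * 2 := Complex.exp_bound' hratio
    _ ≤ y ^ N / N.factorial * 2 := by gcongr
    _ ≤ ε := pow_div_factorial_mul_two_le hy hε hN

end Exponential

section PlaneWave

variable {ι : Type*} [Fintype ι]

lemma sum_smul_pow_mem_span {A : Type*} [CommRing A] [Algebra ℝ A] (c : ι → ℝ) (x : ι → A)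
    {a N : ℕ} (ha : a < N) :
    (∑ i, c i • x i) ^ a
      ∈ Submodule.span ℝ (Set.range fun α : ι → Fin N => ∏ i, x i ^ (α i : ℕ)) := by
  classical
  rw [Finset.sum_pow_eq_sum_piAntidiag]
  refine Submodule.sum_mem _ fun α hα => ?_
  have degree_lt : ∀ i, α i < N := fun i =>
    ((Finset.single_le_sum (fun _ _ => Nat.zero_le _) (Finset.mem_univ i)).trans_eq
      (Finset.mem_piAntidiag.1 hα).1).trans_lt ha
  have monomial_mem : ∏ i, x i ^ α i
      ∈ Submodule.span ℝ (Set.range fun α : ι → Fin N => ∏ i, x i ^ (α i : ℕ)) :=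
    Submodule.subset_span ⟨fun i => ⟨α i, degree_lt i⟩, rfl⟩
  simp only [smul_pow, Finset.prod_smul]
  rw [← nsmul_eq_mul]
  exact nsmul_mem (Submodule.smul_mem _ _ monomial_mem) _

/-- The plane wave of wave vector `ξ`, as a function of the frequency. -/
def planeWave (ξ : EuclideanSpace ℝ ι) : C(EuclideanSpace ℝ ι, ℂ) where
  toFun w := Complex.exp (inner ℝ w ξ * Complex.I)

/-- The `i`-th coordinate of the frequency, times the imaginary unit. -/
def imagCoord (i : ι) : C(EuclideanSpace ℝ ι, ℂ) where
  toFun w := w i * Complex.I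

/-- The Taylor polynomial with `N` terms of the plane wave of wave vector `ξ`. -/
def taylorWave (N : ℕ) (ξ : EuclideanSpace ℝ ι) : C(EuclideanSpace ℝ ι, ℂ) :=
  ∑ a ∈ Finset.range N, ((a.factorial : ℝ)⁻¹ • (∑ i, ξ i • imagCoord i) ^ a)

/-- The monomials of degree less than `N` in each coordinate of the frequency. -/
def freqMonomial (N : ℕ) (α : ι → Fin N) : C(EuclideanSpace ℝ ι, ℂ) :=
  ∏ i, imagCoord i ^ (α i : ℕ)

lemma taylorWave_mem_span (N : ℕ) (ξ : EuclideanSpace ℝ ι) :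
    taylorWave N ξ ∈ Submodule.span ℝ (Set.range (freqMonomial N)) :=
  Submodule.sum_mem _ fun _ ha => Submodule.smul_mem _ _
    (sum_smul_pow_mem_span ξ imagCoord (Finset.mem_range.1 ha))

lemma sum_smul_imagCoord_apply (ξ w : EuclideanSpace ℝ ι) :
    (∑ i, ξ i • imagCoord i) w = inner ℝ w ξ * Complex.I := by
  simp [imagCoord, PiLp.inner_apply, Finset.sum_mul, mul_assoc, ContinuousMap.sum_apply]

lemma taylorWave_apply (N : ℕ) (ξ w : EuclideanSpace ℝ ι) :
    taylorWave N ξ w = ∑ a ∈ Finset.range N, (inner ℝ w ξ * Complex.I) ^ a / a.factorial := by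
  rw [taylorWave, ContinuousMap.sum_apply]
  refine Finset.sum_congr rfl fun a _ => ?_
  rw [ContinuousMap.smul_apply, ContinuousMap.pow_apply, sum_smul_imagCoord_apply,
    Complex.real_smul, div_eq_inv_mul, Complex.ofReal_inv, Complex.ofReal_natCast]

lemma norm_planeWave (ξ w : EuclideanSpace ℝ ι) : ‖planeWave ξ w‖ = 1 :=
  Complex.norm_exp_ofReal_mul_I _

lemma planeWave_sub (ξ ξ' w : EuclideanSpace ℝ ι) :
    planeWave (ξ - ξ') w = planeWave ξ w * starRingEnd ℂ (planeWave ξ' w) := by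
  simp only [planeWave, ContinuousMap.coe_mk, ← Complex.exp_conj, ← Complex.exp_add, map_mul,
    Complex.conj_ofReal, Complex.conj_I, inner_sub_right]
  push_cast
  ring_nf

lemma norm_planeWave_sub_taylorWave_le {ξ w : EuclideanSpace ℝ ι} {Ω ρ ε : ℝ} {N : ℕ}
    (hw : ‖w‖ ≤ Ω) (hξ : ‖ξ‖ ≤ ρ) (hε : 0 < ε) (hε1 : ε ≤ 1)
    (hN : 3 * (Ω * ρ) + Real.log (2 / ε) ≤ N) : ‖planeWave ξ w - taylorWave N ξ w‖ ≤ ε := by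
  rw [taylorWave_apply]
  refine norm_cexp_sub_sum_range_le ?_ hε hε1 hN
  rw [norm_mul, Complex.norm_I, mul_one, Complex.norm_real]
  exact (norm_inner_le_norm w ξ).trans
    (mul_le_mul hw hξ (norm_nonneg ξ) ((norm_nonneg w).trans hw))

end PlaneWave

section LowPass

lemma sq_norm_toLp {E : Type*} [MeasurableSpace E] {P : Measure E} {f : E → ℂ} (hf : MemLp f 2 P) :
    ‖hf.toLp f‖ ^ 2 = ∫ w, ‖f w‖ ^ 2 ∂P := by
  rw [← real_inner_self_eq_norm_sq, L2.inner_def]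
  refine integral_congr_ae (hf.coeFn_toLp.mono fun w hw => ?_)
  simp only [hw, real_inner_self_eq_norm_sq]

variable {E : Type*} [NormedAddCommGroup E] [ProperSpace E] [MeasurableSpace E] [BorelSpace E]
  (P : Measure E) [IsFiniteMeasure P]

lemma memLp_indicator_closedBall (Ω : ℝ) (f : C(E, ℂ)) :
    MemLp ((Metric.closedBall 0 Ω).indicator f) 2 P := by
  obtain ⟨C, hC⟩ := (isCompact_closedBall (0 : E) Ω).exists_bound_of_continuousOn
    f.continuous.continuousOn
  refine MemLp.of_bound (f.continuous.measurable.indicator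
    measurableSet_closedBall).aestronglyMeasurable |C| (Eventually.of_forall fun w => ?_)
  by_cases hw : w ∈ Metric.closedBall 0 Ω
  · rw [Set.indicator_of_mem hw]
    exact (hC w hw).trans (le_abs_self C)
  · rw [Set.indicator_of_notMem hw, norm_zero]
    exact abs_nonneg C

/-- Restriction of a continuous function of the frequency to the frequencies of size at most `Ω`,
as an element of `L²(P)`. -/
def lowPass (Ω : ℝ) : C(E, ℂ) →ₗ[ℝ] Lp ℂ 2 P where
  toFun f := (memLp_indicator_closedBall P Ω f).toLp
  map_add' f g := by
    rw [← MemLp.toLp_add]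
    congr 1
    exact Set.indicator_add _ _ _
  map_smul' c f := by
    rw [RingHom.id_apply, ← MemLp.toLp_const_smul]
    congr 1
    exact Set.indicator_const_smul (Metric.closedBall 0 Ω) c f

end LowPass

section WaveGram

variable {ι : Type*} [Fintype ι] (P : Measure (EuclideanSpace ℝ ι))

lemma memLp_planeWave [IsFiniteMeasure P] (ξ : EuclideanSpace ℝ ι) : MemLp (planeWave ξ) 2 P :=
  MemLp.of_bound (planeWave ξ).continuous.aestronglyMeasurable 1
    (Eventually.of_forall fun w => (norm_planeWave ξ w).le)

lemma inner_toLp_planeWave [IsFiniteMeasure P] (ξ ξ' : EuclideanSpace ℝ ι) :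
    inner ℝ (memLp_planeWave P ξ).toLp (memLp_planeWave P ξ').toLp
      = (charFun P (ξ' - ξ)).re := by
  have integrable_planeWave : Integrable (planeWave (ξ' - ξ)) P :=
    (memLp_planeWave P (ξ' - ξ)).integrable one_le_two
  calc inner ℝ (memLp_planeWave P ξ).toLp (memLp_planeWave P ξ').toLp
      = ∫ w, (planeWave (ξ' - ξ) w).re ∂P := by
        rw [L2.inner_def]
        refine integral_congr_ae ?_
        filter_upwards [(memLp_planeWave P ξ).coeFn_toLp, (memLp_planeWave P ξ').coeFn_toLp]
          with w hw hw'
        rw [hw, hw', Complex.inner, planeWave_sub, mul_comm]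
    _ = (charFun P (ξ' - ξ)).re := by
        rw [charFun_apply]
        exact integral_re integrable_planeWave

lemma sq_norm_planeWave_sub_lowPass_le [IsProbabilityMeasure P] {ξ : EuclideanSpace ℝ ι}
    {f : C(EuclideanSpace ℝ ι, ℂ)} {Ω ε : ℝ}
    (hf : ∀ w, ‖w‖ ≤ Ω → ‖planeWave ξ w - f w‖ ≤ ε) :
    ‖(memLp_planeWave P ξ).toLp - lowPass P Ω f‖ ^ 2 ≤ ε ^ 2 + P.real {w | Ω < ‖w‖} := by
  have measurableSet_tail : MeasurableSet {w : EuclideanSpace ℝ ι | Ω < ‖w‖} :=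
    measurableSet_lt measurable_const measurable_norm
  have integrable_tail : Integrable ({w | Ω < ‖w‖}.indicator (1 : EuclideanSpace ℝ ι → ℝ)) P :=
    (integrable_const 1).indicator measurableSet_tail
  change ‖_ - (memLp_indicator_closedBall P Ω f).toLp‖ ^ 2 ≤ _
  rw [← MemLp.toLp_sub, sq_norm_toLp]
  calc _ ≤ ∫ w, (ε ^ 2 + {w | Ω < ‖w‖}.indicator (1 : EuclideanSpace ℝ ι → ℝ) w) ∂P := by
        refine integral_mono_of_nonneg (ae_of_all _ fun w => by positivity)
          ((integrable_const _).add integrable_tail) (ae_of_all _ fun w => ?_)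
        by_cases hw : ‖w‖ ≤ Ω
        · have hwΩ : w ∈ Metric.closedBall 0 Ω := mem_closedBall_zero_iff.2 hw
          simpa [hw.not_gt, hwΩ] using pow_le_pow_left₀ (norm_nonneg _) (hf w hw) 2
        · have hwΩ : w ∉ Metric.closedBall 0 Ω := mt mem_closedBall_zero_iff.1 hw
          simpa [not_le.1 hw, hwΩ, norm_planeWave] using sq_nonneg ε
    _ = _ := by
        rw [integral_add (integrable_const _) integrable_tail,
          integral_indicator_one measurableSet_tail, integral_const, probReal_univ, one_smul]

lemma sq_norm_lowPass_le [IsProbabilityMeasure P] {ξ : EuclideanSpace ℝ ι}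
    {f : C(EuclideanSpace ℝ ι, ℂ)} {Ω : ℝ} (hf : ∀ w, ‖w‖ ≤ Ω → ‖planeWave ξ w - f w‖ ≤ 1) :
    ‖lowPass P Ω f‖ ^ 2 ≤ 4 := by
  change ‖(memLp_indicator_closedBall P Ω f).toLp‖ ^ 2 ≤ 4
  rw [sq_norm_toLp]
  calc _ ≤ ∫ _, (4 : ℝ) ∂P := by
        refine integral_mono_of_nonneg (ae_of_all _ fun w => by positivity)
          (integrable_const _) (ae_of_all _ fun w => ?_)
        by_cases hw : ‖w‖ ≤ Ω
        · have hwΩ : w ∈ Metric.closedBall 0 Ω := mem_closedBall_zero_iff.2 hw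
          have norm_le : ‖f w‖ ≤ 2 := by
            linarith [norm_le_insert (planeWave ξ w) (f w), hf w hw, norm_planeWave ξ w]
          simp only [Set.indicator_of_mem hwΩ]
          nlinarith [norm_nonneg (f w)]
        · simp [mt mem_closedBall_zero_iff.1 hw]
    _ = 4 := by simp

lemma lowPass_taylorWave_mem_span [IsFiniteMeasure P] (Ω : ℝ) (N : ℕ) (ξ : EuclideanSpace ℝ ι) :
    lowPass P Ω (taylorWave N ξ)
      ∈ Submodule.span ℝ (Set.range fun α => lowPass P Ω (freqMonomial N α)) := by
  have := Submodule.mem_map_of_mem (f := lowPass P Ω) (taylorWave_mem_span N ξ)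
  rwa [Submodule.map_span, ← Set.range_comp] at this

lemma log_det_one_add_smul_charFun_le [IsProbabilityMeasure P] {n N : ℕ} (hn : 1 ≤ n) {c Ω ρ : ℝ}
    (hc : 0 ≤ c) (hc1 : c ≤ 1) (hN : 3 * (Ω * ρ) + Real.log (2 * n) ≤ N)
    {ξ : Fin n → EuclideanSpace ℝ ι} (hξ : ∀ j, ‖ξ j‖ ≤ ρ) :
    Real.log (1 + c • Matrix.of fun j l => (charFun P (ξ l - ξ j)).re).det
      ≤ (N : ℝ) ^ Fintype.card ι * Real.log (1 + 8 * n) + 2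
        + 2 * (n * P.real {w | Ω < ‖w‖}) := by
  classical
  have hn1 : (1 : ℝ) ≤ n := by exact_mod_cast hn
  have hε1 : (1 : ℝ) / n ≤ 1 := (div_le_one (by positivity)).2 hn1
  have approx : ∀ j w, ‖w‖ ≤ Ω → ‖planeWave (ξ j) w - taylorWave N (ξ j) w‖ ≤ 1 / n := fun j w hw =>
    norm_planeWave_sub_taylorWave_le hw (hξ j) (by positivity) hε1
      (by rwa [div_div_eq_mul_div, div_one])
  have gram_eq : Matrix.gram ℝ (fun j => (memLp_planeWave P (ξ j)).toLp)
      = Matrix.of fun j l => (charFun P (ξ l - ξ j)).re := by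
    ext j l
    exact inner_toLp_planeWave P (ξ j) (ξ l)
  have := log_det_one_add_smul_gram_le hc hc1
    (fun j => lowPass_taylorWave_mem_span P Ω N (ξ j))
    (fun j => sq_norm_lowPass_le P fun w hw => (approx j w hw).trans hε1)
    (fun j => sq_norm_planeWave_sub_lowPass_le P (approx j))
  rw [gram_eq, Fintype.card_fun, Fintype.card_fin, Fintype.card_fin] at this
  have square_le : (n : ℝ) * (1 / n) ^ 2 ≤ 1 := by
    calc (n : ℝ) * (1 / n) ^ 2 = 1 / n := by field_simp
      _ ≤ 1 := hε1
  push_cast at this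
  calc _ ≤ _ := this
    _ = (N : ℝ) ^ Fintype.card ι * Real.log (1 + 8 * n) + 2 * (n * (1 / n) ^ 2)
        + 2 * (n * P.real {w | Ω < ‖w‖}) := by ring_nf
    _ ≤ _ := by gcongr; linarith

end WaveGram

section MaternGain

variable {d m : ℕ} {ν : ℝ}

/-- The point `x` with each coordinate divided by its lengthscale. -/
def rescale (grp : Fin d → Fin m) (θ : Fin m → ℝ) (x : EuclideanSpace ℝ (Fin d)) :
    EuclideanSpace ℝ (Fin d) :=
  WithLp.toLp 2 fun i => x i / θ (grp i)

lemma matern_eq_charFun (hν : 0 < ν) (var : ℝ) (grp : Fin d → Fin m) (θ : Fin m → ℝ)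
    (x x' : EuclideanSpace ℝ (Fin d)) :
    matern ν var grp θ x x'
      = var * (charFun (maternSpectralMeasure ν (EuclideanSpace ℝ (Fin d)))
          (rescale grp θ x' - rescale grp θ x)).re := by
  have norm_sq : ‖rescale grp θ x' - rescale grp θ x‖ ^ 2
      = ∑ i, ((x i - x' i) / θ (grp i)) ^ 2 := by
    rw [EuclideanSpace.real_norm_sq_eq]
    refine Finset.sum_congr rfl fun i _ => ?_
    simp only [rescale, PiLp.sub_apply]
    ring
  rw [charFun_maternSpectralMeasure hν, Complex.ofReal_re, norm_sq, matern_eq hν]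
  ring

lemma infoGain_matern_le (hν : 0 < ν) {var : ℝ} (hvar : 0 ≤ var) (hvar1 : var ≤ 1)
    (grp : Fin d → Fin m) (θ : Fin m → ℝ) {σ : ℝ} (hσ : 1 ≤ σ) {n N : ℕ} (hn : 1 ≤ n)
    {Ω ρ : ℝ} (hN : 3 * (Ω * ρ) + Real.log (2 * n) ≤ N)
    (x : Fin n → EuclideanSpace ℝ (Fin d)) (hx : ∀ j, ‖rescale grp θ (x j)‖ ≤ ρ) :
    infoGain (matern ν var grp θ) σ x ≤ (N : ℝ) ^ d * Real.log (1 + 8 * n) + 1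
      + n * (maternSpectralMeasure ν (EuclideanSpace ℝ (Fin d))).real {w | Ω < ‖w‖} := by
  have := isProbabilityMeasure_maternSpectralMeasure (E := EuclideanSpace ℝ (Fin d)) hν
  have gram_eq : gram (matern ν var grp θ) x
      = var • Matrix.of fun j l => (charFun (maternSpectralMeasure ν (EuclideanSpace ℝ (Fin d)))
          (rescale grp θ (x l) - rescale grp θ (x j))).re := by
    ext j l
    exact matern_eq_charFun hν var grp θ (x j) (x l)
  have log_det_le := log_det_one_add_smul_charFun_le
    (maternSpectralMeasure ν (EuclideanSpace ℝ (Fin d))) (c := (σ ^ 2)⁻¹ * var) hn (by positivity)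
    (mul_le_one₀ (inv_le_one_of_one_le₀ (one_le_pow₀ hσ)) hvar hvar1) hN hx
  have : 0 ≤ (N : ℝ) ^ d * Real.log (1 + 8 * n) :=
    mul_nonneg (by positivity) (Real.log_nonneg (by linarith [Nat.cast_nonneg (α := ℝ) n]))
  rw [infoGain, gram_eq, smul_smul]
  rw [Fintype.card_fin] at log_det_le
  linarith

end MaternGain

/-! ### Growth of the information gain and of the regret rate -/

section GainGrowth

variable {d m : ℕ}

lemma norm_rescale_le (grp : Fin d → Fin m) {θ : Fin m → ℝ} {lo : ℝ} (hlo : 0 < lo)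
    (hθ : ∀ i, lo ≤ θ i) (x : EuclideanSpace ℝ (Fin d)) : ‖rescale grp θ x‖ ≤ ‖x‖ / lo := by
  refine abs_le_of_sq_le_sq' ?_ (by positivity) |>.2
  rw [div_pow, EuclideanSpace.real_norm_sq_eq, EuclideanSpace.real_norm_sq_eq, Finset.sum_div]
  refine Finset.sum_le_sum fun i _ => ?_
  rw [rescale, div_pow]
  exact div_le_div_of_nonneg_left (sq_nonneg _) (by positivity)
    (pow_le_pow_left₀ hlo.le (hθ (grp i)) 2)

lemma Problem.exists_norm_rescale_le (P : Problem d m) :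
    ∃ ρ : ℝ, 0 ≤ ρ ∧ ∀ x ∈ P.X, ∀ θ ∈ P.Θ, ‖rescale P.grp θ x‖ ≤ ρ := by
  obtain ⟨lo, hi, hlo, -, hb⟩ := P.exists_bounds
  obtain ⟨r, hr⟩ := P.X_compact.isBounded.exists_norm_le
  obtain ⟨x₀, hx₀⟩ := P.X_nonempty
  have hr0 : 0 ≤ r := (norm_nonneg x₀).trans (hr x₀ hx₀)
  refine ⟨r / lo, by positivity, fun x hx θ hθ => ?_⟩
  calc ‖rescale P.grp θ x‖ ≤ ‖x‖ / lo := norm_rescale_le P.grp hlo (fun i => (hb θ hθ i).1) x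
    _ ≤ r / lo := by gcongr; exact hr x hx

lemma natCeil_add_log_le {t s ρ : ℝ} (ht : 1 ≤ t) (hs : 0 < s) (hρ : 0 ≤ ρ) :
    (⌈3 * (t ^ s * ρ) + Real.log (2 * t)⌉₊ : ℝ) ≤ (3 * ρ + 2 ^ s / s + 1) * t ^ s := by
  have log_nonneg : 0 ≤ Real.log (2 * t) := Real.log_nonneg (by linarith)
  have log_le : Real.log (2 * t) ≤ 2 ^ s * t ^ s / s := by
    rw [← Real.mul_rpow zero_le_two (by linarith)]
    exact Real.log_le_rpow_div (by linarith) hs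
  calc (⌈3 * (t ^ s * ρ) + Real.log (2 * t)⌉₊ : ℝ)
      ≤ 3 * (t ^ s * ρ) + Real.log (2 * t) + 1 := (Nat.ceil_lt_add_one (by positivity)).le
    _ ≤ 3 * (t ^ s * ρ) + 2 ^ s * t ^ s / s + t ^ s := by
      gcongr
      exact Real.one_le_rpow ht hs.le
    _ = _ := by ring

lemma log_one_add_eight_mul_le {t ε : ℝ} (ht : 1 ≤ t) (hε : 0 < ε) :
    Real.log (1 + 8 * t) ≤ 9 ^ ε / ε * t ^ ε :=
  calc Real.log (1 + 8 * t) ≤ Real.log (9 * t) := Real.log_le_log (by linarith) (by linarith)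
    _ ≤ (9 * t) ^ ε / ε := Real.log_le_rpow_div (by linarith) hε
    _ = 9 ^ ε / ε * t ^ ε := by
      rw [Real.mul_rpow (by norm_num) (by linarith)]
      ring

lemma natCeil_pow_mul_log_le {t s ρ ε : ℝ} (d : ℕ) (ht : 1 ≤ t) (hs : 0 < s) (hρ : 0 ≤ ρ)
    (hε : 0 < ε) :
    (⌈3 * (t ^ s * ρ) + Real.log (2 * t)⌉₊ : ℝ) ^ d * Real.log (1 + 8 * t)
      ≤ (3 * ρ + 2 ^ s / s + 1) ^ d * (9 ^ ε / ε) * t ^ (s * d + ε) := by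
  have ht0 : 0 < t := by linarith
  calc _ ≤ ((3 * ρ + 2 ^ s / s + 1) * t ^ s) ^ d * (9 ^ ε / ε * t ^ ε) := by
        gcongr
        · exact Real.log_nonneg (by linarith)
        · exact natCeil_add_log_le ht hs hρ
        · exact log_one_add_eight_mul_le ht hε
    _ = _ := by
      rw [Real.rpow_add ht0, Real.rpow_mul ht0.le, Real.rpow_natCast, mul_pow]
      ring

lemma mul_rpow_rpow_cutoff {t κ d : ℝ} (ht : 0 < t) (h : 2 * κ + d ≠ 0) :
    t * (t ^ (1 / (2 * κ + d))) ^ (-(2 * κ)) = t ^ (1 / (2 * κ + d) * d) := by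
  rw [← Real.rpow_mul ht.le]
  nth_rewrite 1 [← Real.rpow_one t]
  rw [← Real.rpow_add ht]
  congr 1
  field_simp
  ring

-- The cutoff frequency `n ^ s` with `s = 1 / (2 * κ + d)` makes the number of features,
-- of order `n ^ (s * d)`, match the contribution `n * (n ^ s) ^ (-(2 * κ))` of the tail.
lemma exists_infoGain_matern_le_rpow {ν κ ε ρ : ℝ} (d m : ℕ) (hν : 0 < ν) (hκ0 : 0 < κ)
    (hκ : κ < ν) (hε : 0 < ε) (hρ : 0 ≤ ρ) :
    ∃ C : ℝ, 0 ≤ C ∧ ∀ (n : ℕ) (var σ : ℝ) (grp : Fin d → Fin m) (θ : Fin m → ℝ)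
      (x : Fin n → EuclideanSpace ℝ (Fin d)), 1 ≤ n → 0 ≤ var → var ≤ 1 → 1 ≤ σ →
      (∀ j, ‖rescale grp θ (x j)‖ ≤ ρ) →
      infoGain (matern ν var grp θ) σ x ≤ C * (n : ℝ) ^ (1 / (2 * κ + d) * d + ε) := by
  obtain ⟨C, hC, tail_le⟩ :=
    exists_maternSpectralMeasure_tail_le (EuclideanSpace ℝ (Fin d)) hν hκ0 hκ
  set s := 1 / (2 * κ + d)
  have hs : 0 < s := by positivity
  refine ⟨(3 * ρ + 2 ^ s / s + 1) ^ d * (9 ^ ε / ε) + 1 + C, by positivity,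
    fun n var σ grp θ x hn hvar hvar1 hσ hx => ?_⟩
  have hn1 : (1 : ℝ) ≤ n := by exact_mod_cast hn
  have tail_contribution_le :
      n * (maternSpectralMeasure ν (EuclideanSpace ℝ (Fin d))).real {w | (n : ℝ) ^ s < ‖w‖}
        ≤ C * (n : ℝ) ^ (s * d + ε) :=
    calc _ ≤ n * (C * ((n : ℝ) ^ s) ^ (-(2 * κ))) := by
          gcongr
          exact tail_le _ (by positivity)
      _ = C * (n : ℝ) ^ (s * d) := by
        rw [mul_left_comm, mul_rpow_rpow_cutoff (by positivity) (by positivity)]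
      _ ≤ C * (n : ℝ) ^ (s * d + ε) := by
        gcongr
        exact le_add_of_nonneg_right hε.le
  have one_le : 1 ≤ (n : ℝ) ^ (s * d + ε) := Real.one_le_rpow hn1 (by positivity)
  have := infoGain_matern_le hν hvar hvar1 grp θ hσ hn (Ω := (n : ℝ) ^ s)
    (Nat.le_ceil _) x hx
  rw [add_mul, add_mul, one_mul]
  linarith [natCeil_pow_mul_log_le d hn1 hs hρ hε]

lemma Problem.exists_supGain_le_rpow (P : Problem d m) {κ ε : ℝ} (hκ0 : 0 < κ) (hκ : κ < P.ν)
    (hε : 0 < ε) :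
    ∃ C : ℝ, 0 ≤ C ∧ ∀ (n : ℕ) (σ : ℝ), 1 ≤ n → 1 ≤ σ →
      P.supGain σ n ≤ C * (n : ℝ) ^ (1 / (2 * κ + d) * d + ε) := by
  obtain ⟨ρ, hρ, hx⟩ := P.exists_norm_rescale_le
  obtain ⟨C, hC, infoGain_le⟩ := exists_infoGain_matern_le_rpow d m P.ν_pos hκ0 hκ hε hρ
  refine ⟨C, hC, fun n σ hn hσ =>
    Real.iSup_le (fun θ => Real.iSup_le (fun x => ?_) (by positivity)) (by positivity)⟩
  exact infoGain_le n P.var σ P.grp θ _ hn P.var_pos.le P.var_le_one hσ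
    fun j => hx _ (x j).2 _ θ.2

lemma Problem.exists_supGain_le_rpow_lt_half (P : Problem d m) (hd : (d : ℝ) < 2 * P.ν) :
    ∃ C a : ℝ, 0 ≤ C ∧ 0 < a ∧ a < 1 / 2 ∧ ∀ (n : ℕ) (σ : ℝ), 1 ≤ n → 1 ≤ σ →
      P.supGain σ n ≤ C * (n : ℝ) ^ a := by
  obtain ⟨κ, hdκ, hκ⟩ := exists_between (show (d : ℝ) / 2 < P.ν by linarith)
  have hκ0 : 0 < κ := lt_of_le_of_lt (by positivity) hdκ
  have lt_half : 1 / (2 * κ + d) * d < 1 / 2 := by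
    rw [one_div_mul_eq_div, div_lt_div_iff₀ (by positivity) two_pos]
    linarith
  obtain ⟨a, ha, ha2⟩ := exists_between lt_half
  obtain ⟨C, hC, supGain_le⟩ := P.exists_supGain_le_rpow hκ0 hκ (sub_pos.2 ha)
  rw [add_sub_cancel] at supGain_le
  exact ⟨C, a, hC, lt_of_le_of_lt (by positivity) ha, ha2, supGain_le⟩

end GainGrowth

section RateGrowth

variable {d m : ℕ}

lemma Problem.exists_log_covNum_le_rpow (P : Problem d m) {δ a : ℝ} (hδ : 0 < δ) (hδ1 : δ < 1)
    (ha : 0 < a) : ∃ C : ℝ, 0 ≤ C ∧ ∀ T : ℕ, 1 ≤ T →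
      Real.log (6 * P.covNum (epsT T) / δ) ≤ C * (T : ℝ) ^ a := by
  obtain ⟨K, hK, covNum_le⟩ := P.exists_covNum_le
  have log_nonneg : 0 ≤ Real.log (6 * K ^ m / δ) := Real.log_nonneg (by
    rw [le_div_iff₀ hδ]
    linarith [one_le_pow₀ hK (n := m)])
  refine ⟨Real.log (6 * K ^ m / δ) + (4 * m : ℕ) / a, by positivity, fun T hT => ?_⟩
  have hT1 : (1 : ℝ) ≤ T := by exact_mod_cast hT
  have covNum_pos : (0 : ℝ) < P.covNum (epsT T) := by
    exact_mod_cast P.one_le_covNum (epsT_pos hT) (epsT_le_one hT)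
  have covNum_epsT_le : (P.covNum (epsT T) : ℝ) ≤ K ^ m * (T : ℝ) ^ (4 * m) := by
    rw [pow_mul, ← mul_pow, ← div_inv_eq_mul]
    exact covNum_le _ (epsT_pos hT) (epsT_le_one hT)
  calc Real.log (6 * P.covNum (epsT T) / δ)
      ≤ Real.log (6 * (K ^ m * (T : ℝ) ^ (4 * m)) / δ) := by gcongr
    _ = Real.log (6 * K ^ m / δ) + (4 * m : ℕ) * Real.log T := by
      rw [← mul_assoc, mul_div_right_comm, Real.log_mul (by positivity) (by positivity),
        Real.log_pow]
    _ ≤ Real.log (6 * K ^ m / δ) * (T : ℝ) ^ a + (4 * m : ℕ) * ((T : ℝ) ^ a / a) := by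
      gcongr
      · exact le_mul_of_one_le_right log_nonneg (Real.one_le_rpow hT1 ha.le)
      · exact Real.log_le_rpow_div (by positivity) ha
    _ = _ := by ring

lemma regretRate_nonneg (P : Problem d m) (σ : ℝ) {B : ℝ} (hB : 0 ≤ B) (δ : ℝ) (T : ℕ)
    (θ : Fin m → ℝ) : 0 ≤ regretRate P σ B δ T θ := by
  unfold regretRate
  positivity

lemma sqrt_le_sqrt_mul_rpow {g c t a : ℝ} (hc : 0 ≤ c) (ht : 0 ≤ t) (hg : g ≤ c * t ^ a) :
    √g ≤ √c * t ^ (a / 2) :=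
  calc √g ≤ √(c * t ^ a) := Real.sqrt_le_sqrt hg
    _ = √c * t ^ (a / 2) := by
      rw [Real.sqrt_mul hc, Real.sqrt_eq_rpow (t ^ a), ← Real.rpow_mul ht, mul_one_div]

lemma add_sqrt_le_mul_rpow {B g c t a : ℝ} (hB : 0 ≤ B) (hc : 0 ≤ c) (ht : 1 ≤ t) (ha : 0 ≤ a)
    (hg : g ≤ c * t ^ a) : B + √g ≤ (B + √c) * t ^ (a / 2) := by
  rw [add_mul]
  exact add_le_add (le_mul_of_one_le_right hB (Real.one_le_rpow ht (by positivity)))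
    (sqrt_le_sqrt_mul_rpow hc (zero_le_one.trans ht) hg)

lemma rpow_add_sqrt_le_mul_rpow {g c t a : ℝ} (hc : 0 ≤ c) (ht : 1 ≤ t) (ha : a ≤ 1 / 2)
    (hg : g ≤ c * t ^ a) :
    t ^ (3 / 4 : ℝ) + √(t * g) ≤ (1 + √c) * t ^ (3 / 4 : ℝ) := by
  have ht0 : 0 < t := by linarith
  have mul_le : t * g ≤ c * t ^ (1 + a) :=
    calc t * g ≤ t * (c * t ^ a) := by gcongr
      _ = c * t ^ (1 + a) := by rw [Real.rpow_add ht0, Real.rpow_one]; ring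
  calc t ^ (3 / 4 : ℝ) + √(t * g) ≤ t ^ (3 / 4 : ℝ) + √c * t ^ ((1 + a) / 2) := by
        gcongr
        exact sqrt_le_sqrt_mul_rpow hc ht0.le mul_le
    _ ≤ t ^ (3 / 4 : ℝ) + √c * t ^ (3 / 4 : ℝ) := by
      refine add_le_add_right (mul_le_mul_of_nonneg_left ?_ (Real.sqrt_nonneg c)) _
      exact Real.rpow_le_rpow_of_exponent_le ht (by linarith)
    _ = _ := by ring

lemma regretRate_div_le (P : Problem d m) {σ B δ C C' a : ℝ} {T : ℕ} {θ : Fin m → ℝ}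
    (hσ : 1 ≤ σ) (hB : 0 ≤ B) (hT : 1 ≤ T) (hθ : θ ∈ P.Θ) (hC : 0 ≤ C) (hC' : 0 ≤ C')
    (ha0 : 0 ≤ a) (ha : a ≤ 1 / 2) (hgain : P.supGain σ T ≤ C * (T : ℝ) ^ a)
    (hcov : Real.log (6 * P.covNum (epsT T) / δ) ≤ C' * (T : ℝ) ^ a) :
    regretRate P σ B δ T θ / T
      ≤ (B + √(C + C')) * (1 + √C) * (T : ℝ) ^ (-(1 / 4 - a / 2)) := by
  have hT1 : (1 : ℝ) ≤ T := by exact_mod_cast hT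
  have hT0 : (0 : ℝ) < T := by linarith
  have width_le : P.supGain σ (T - 1) + Real.log (6 * P.covNum (epsT T) / δ)
      ≤ (C + C') * (T : ℝ) ^ a := by
    linarith [P.supGain_mono hσ (Nat.sub_le T 1)]
  rw [div_le_iff₀ hT0]
  calc regretRate P σ B δ T θ
      ≤ ((B + √(C + C')) * (T : ℝ) ^ (a / 2)) * ((1 + √C) * (T : ℝ) ^ (3 / 4 : ℝ)) := by
        unfold regretRate
        gcongr
        · exact add_sqrt_le_mul_rpow hB (add_nonneg hC hC') hT1 ha0 width_le
        · exact rpow_add_sqrt_le_mul_rpow hC hT1 ha ((P.gain_le_supGain hσ T hθ).trans hgain)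
    _ = (B + √(C + C')) * (1 + √C) * ((T : ℝ) ^ (a / 2) * (T : ℝ) ^ (3 / 4 : ℝ)) := by ring
    _ = (B + √(C + C')) * (1 + √C) * ((T : ℝ) ^ (-(1 / 4 - a / 2)) * (T : ℝ) ^ (1 : ℝ)) := by
      rw [← Real.rpow_add hT0, ← Real.rpow_add hT0]
      ring_nf
    _ = _ := by
      rw [Real.rpow_one]
      ring

lemma tendsto_regretRate_div (P : Problem d m) (hd : (d : ℝ) < 2 * P.ν) {B δ : ℝ} (hB : 0 ≤ B)
    (hδ : 0 < δ) (hδ1 : δ < 1) {θ : Fin m → ℝ} (hθ : θ ∈ P.Θ) {σ : ℕ → ℝ} (hσ : ∀ T, 1 ≤ σ T) :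
    Tendsto (fun T : ℕ => regretRate P (σ T) B δ T θ / T) atTop (𝓝 0) := by
  obtain ⟨C, a, hC, ha0, ha, supGain_le⟩ := P.exists_supGain_le_rpow_lt_half hd
  obtain ⟨C', hC', log_covNum_le⟩ := P.exists_log_covNum_le_rpow hδ hδ1 ha0
  have tendsto_rpow : Tendsto (fun T : ℕ =>
      (B + √(C + C')) * (1 + √C) * (T : ℝ) ^ (-(1 / 4 - a / 2))) atTop (𝓝 0) := by
    simpa using ((tendsto_rpow_neg_atTop (y := 1 / 4 - a / 2) (by linarith)).comp
      tendsto_natCast_atTop_atTop).const_mul ((B + √(C + C')) * (1 + √C))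
  refine squeeze_zero' (Eventually.of_forall fun T =>
    div_nonneg (regretRate_nonneg P _ hB δ T θ) (Nat.cast_nonneg T)) ?_ tendsto_rpow
  filter_upwards [eventually_ge_atTop 1] with T hT
  exact regretRate_div_le P (hσ T) hB hT hθ hC hC' ha0.le ha.le
    (supGain_le T (σ T) hT (hσ T)) (log_covNum_le T hT)

end RateGrowth

end OSCBO

end

theorem mainTheorem1_general {d m : ℕ} (P : OSCBO.Problem d m) (R σmax : ℝ) (hR : 0 ≤ R) :
    ∃ C : ℝ, 0 < C ∧
      (∀ c : OSCBO.Config, c.R = R → 1 ≤ c.σ → c.σ ≤ σmax → 0 ≤ c.B →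
        0 < c.δ → c.δ < 1 → 1 ≤ c.T →
        ∀ θ ∈ P.Θ, ∀ f : EuclideanSpace ℝ (Fin d) → ℝ,
        (∀ θ' ∈ P.Θ, OSCBO.InRKHSBall P.X (P.ker θ') c.B f) →
        ∀ z ∈ P.X, ∀ (Ω : Type*) [MeasurableSpace Ω] (μ : Measure Ω) [IsProbabilityMeasure μ]
          (r : OSCBO.UCBRun μ P c f),
          ENNReal.ofReal (1 - c.δ) ≤
            μ {ω | r.regret z ω ≤ C * OSCBO.regretRate P c.σ c.B c.δ c.T θ}) ∧
      ((d : ℝ) < 2 * P.ν →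
        ∀ B δ : ℝ, 0 ≤ B → 0 < δ → δ < 1 → ∀ θ ∈ P.Θ, ∀ σ : ℕ → ℝ, (∀ T, 1 ≤ σ T) →
          Tendsto (fun T : ℕ => C * OSCBO.regretRate P (σ T) B δ T θ / T) atTop (𝓝 0)) := by
  obtain ⟨b, hb, hcmp⟩ := P.exists_kernelLE
  refine ⟨4 * (1 + 2 * R) * (√b * |σmax|) + 4 * (R + 2), by positivity, ?_, ?_⟩
  · rintro c rfl hσ hσmax hB hδ hδ1 hT θ hθ f hf z hz _ _ μ _ r
    have regretRate_nonneg := OSCBO.regretRate_nonneg P c.σ hB c.δ c.T θ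
    refine (r.measure_regret_le_ge hR hσ hB hδ hδ1.le hT hf hz hb hcmp hθ).trans
      (measure_mono fun ω hω => (Set.mem_ofPred.1 hω).trans ?_)
    gcongr
    exact hσmax.trans (le_abs_self σmax)
  · intro hd B δ hB hδ hδ1 θ hθ σ hσ
    simpa only [mul_div_assoc, mul_zero] using
      (OSCBO.tendsto_regretRate_div P hd hB hδ hδ1 hθ hσ).const_mul _

theorem mainTheorem1 {d m : ℕ} (P : OSCBO.Problem d m) (R σmax : ℝ) (hR : 0 ≤ R) :
    ∃ (C : ℝ) (q : ℕ), 0 < C ∧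
      (∀ (c : OSCBO.Config), c.R = R → 1 ≤ c.σ → c.σ ≤ σmax → 0 < c.B →
        0 < c.δ → c.δ < 1 → 1 ≤ c.T →
        ∀ (a : OSCBO.Tuning) (θ : Fin m → ℝ), θ ∈ P.Θ →
        ∀ (f : EuclideanSpace ℝ (Fin d) → ℝ),
        (∀ θ' ∈ P.Θ, OSCBO.InRKHSBall P.X (P.ker θ') c.B f) →
        ∀ (xstar : EuclideanSpace ℝ (Fin d)), xstar ∈ P.X → IsMaxOn f P.X xstar →
        ∀ (Ω : Type*) [MeasurableSpace Ω] (μ : Measure Ω) [IsProbabilityMeasure μ]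
          (r : OSCBO.Run μ P c a f),
          ENNReal.ofReal (1 - c.δ) ≤
            μ {ω | r.regret xstar ω ≤
              C * (1 + Real.log c.T) ^ q * OSCBO.regretRate P c.σ c.B c.δ c.T θ}) ∧
      ((d : ℝ) < 2 * P.ν →
        ∀ (B δ : ℝ), 0 < B → 0 < δ → δ < 1 → ∀ θ ∈ P.Θ,
        ∀ (σ : ℕ → ℝ), (∀ T, 1 ≤ σ T ∧ σ T ≤ σmax) →
          Tendsto (fun T : ℕ =>
            C * (1 + Real.log T) ^ q * OSCBO.regretRate P (σ T) B δ T θ / T) atTop (𝓝 0)) := by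
  obtain ⟨C, hC, hregret, hrate⟩ := mainTheorem1_general P R σmax hR
  refine ⟨C, 0, hC, fun c hcR hσ hσmax hB hδ hδ1 hT a θ hθ f hf xstar hx _ Ω _ μ _ r => ?_,
    fun hd B δ hB hδ hδ1 θ hθ σ hσ => ?_⟩
  · rw [pow_zero, mul_one]
    exact hregret c hcR hσ hσmax hB.le hδ hδ1 hT θ hθ f hf xstar hx Ω μ r.toUCBRun
  · simpa only [pow_zero, mul_one] using hrate hd B δ hB.le hδ hδ1 θ hθ σ fun T => (hσ T).1
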